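/- Let $M$ be a smooth real supermanifold of dimension $p|q$ and let $\mathfrak V(M)$ be its graded commutative algebra of densities: finite formal sums of sections of the bundles $|\mathrm{Vol}\,M|^{w}$, $w\in\mathbb R$. In local coordinates $x^a$ (of parity $\tilde a$) an element is written $\psi=\sum_w\psi_w(x)\,|Dx|^w$, with $|Dx'|^w=|J|^w|Dx|^w$, where $J=Dx'/Dx$ is the Berezinian of the change of coordinates, and it is regarded as the function $\psi(x,t)=\sum_w\psi_w(x)t^w$, $t>0$, on the extended manifold $\hat M$ with coordinates $x^a,t$ ($t$ even). Let $p_a,p_t$ be the conjugate momenta and let $(\ ,\ )$ denote the canonical even Poisson bracket on a cotangent bundle, normalised by $(p_a,x^b)=\delta_a^b$, $(p_t,t)=1$. An odd long bracket of weight zero on $M$ is an odd graded symmetric bi-derivation $\{\ ;\ \}$ of $\mathfrak V(M)$ that adds weights. Suppose that it is specified by an odd extended master Hamiltonian, i.e. that in every coordinate chart of an atlas $$\{\psi;\chi\}=((\hat S,\psi),\chi),\qquad \hat S=\tfrac12\left(S^{ab}p_bp_a+2t\,\gamma^a p_a p_t+t^2\theta\,p_t^2\right),$$ where $S^{ab}=(-1)^{\tilde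 a\tilde b}S^{ba}$, $\gamma^a$, $\theta$ are functions of the coordinates $x$ of the chart, of parities $\tilde a+\tilde b+1$, $\tilde a+1$ and $1$. Put $S=\frac12S^{ab}p_bp_a$ and $\gamma=\gamma^ap_a$. Then the Jacobi identity $$(-1)^{\tilde\psi\tilde\omega}\{\{\psi;\chi\};\omega\}+(-1)^{\tilde\omega\tilde\chi}\{\{\omega;\psi\};\chi\}+(-1)^{\tilde\chi\tilde\psi}\{\{\chi;\omega\};\psi\}=0$$ holds for all parity-homogeneous $\psi,\chi,\omega\in\mathfrak V(M)$ if and only if in every chart of the atlas the following four equations hold identically on $T^*M$: $$(S,S)=0,\qquad (S,\gamma)=0,\qquad (S,\theta)+(\gamma,\gamma)=0,\qquad (\gamma,\theta)=0 .$$ -/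

import Mathlib

open Set TopologicalSpace
open scoped ContDiff

noncomputable section

/-! ## Grassmann algebras -/

/-- The real Grassmann algebra with generators `ξ_j`, `j : κ`. -/
abbrev Grassmann (κ : Type*) := ExteriorAlgebra ℝ (κ →₀ ℝ)

namespace Grassmann

variable {κ κ' : Type*}

instance instModuleFinite [Finite κ] : Module.Finite ℝ (Grassmann κ) := by
  let _ : LinearOrder κ := LinearOrder.lift' (Finite.equivFin κ) (Finite.equivFin κ).injective
  exact Module.Finite.of_basis (Finsupp.basisSingleOne (R := ℝ) (ι := κ)).ExteriorAlgebra

/-- A norm on the (finite-dimensional) Grassmann algebra: the sup norm of the coordinates in a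
basis. It only serves to speak of smooth maps with values in the Grassmann algebra, and which
maps are smooth, and their derivatives, do not depend on it. -/
instance instNormedAddCommGroup [Finite κ] : NormedAddCommGroup (Grassmann κ) :=
  NormedAddCommGroup.induced _ _ (Module.finBasis ℝ (Grassmann κ)).equivFun.toLinearMap
    (Module.finBasis ℝ (Grassmann κ)).equivFun.injective

instance instNormedSpace [Finite κ] : NormedSpace ℝ (Grassmann κ) :=
  NormedSpace.induced ℝ (Grassmann κ) _ (Module.finBasis ℝ (Grassmann κ)).equivFun.toLinearMap

/-- The generator `ξ_j`. -/
def gen (j : κ) : Grassmann κ := ExteriorAlgebra.ι ℝ (Finsupp.single j 1)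

/-- The body (numerical part) of an element, obtained by setting all `ξ_j = 0`. -/
def body : Grassmann κ →ₐ[ℝ] ℝ := ExteriorAlgebra.algebraMapInv

/-- The parity automorphism: `a ↦ (-1)^{parity of a} a` on homogeneous elements. -/
def inv : Grassmann κ →ₐ[ℝ] Grassmann κ := CliffordAlgebra.involute

/-- The left derivative `∂/∂ξ_j`: the antiderivation with `∂ξ_k/∂ξ_j = δ_{jk}`. -/
def leftDeriv (j : κ) : Grassmann κ →ₗ[ℝ] Grassmann κ :=
  CliffordAlgebra.contractLeft (Finsupp.lapply j)

/-- The homomorphism of Grassmann algebras that sends `ξ_j` to `ξ_{o j}`. -/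
def rename (o : κ → κ') : Grassmann κ →ₐ[ℝ] Grassmann κ' :=
  ExteriorAlgebra.map (Finsupp.lmapDomain ℝ ℝ o)

/-- The even part of the Grassmann algebra. -/
abbrev Even (κ : Type*) := CliffordAlgebra.even (0 : QuadraticForm ℝ (κ →₀ ℝ))

theorem even_central (x : Grassmann κ) (hx : x ∈ Even κ) (y : Grassmann κ) : Commute x y := by
  have key : ∀ (a b : κ →₀ ℝ) (y : Grassmann κ),
      Commute (ExteriorAlgebra.ι ℝ a * ExteriorAlgebra.ι ℝ b) y := by
    intro a b y
    induction y using ExteriorAlgebra.induction with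
    | algebraMap r => exact (Algebra.commutes r _).symm
    | ι c =>
      have h1 := ExteriorAlgebra.ι_add_mul_swap (R := ℝ) b c
      have h2 := ExteriorAlgebra.ι_add_mul_swap (R := ℝ) a c
      have h1' := eq_neg_of_add_eq_zero_left h1
      have h2' := eq_neg_of_add_eq_zero_left h2
      change _ * _ * _ = _ * (_ * _)
      rw [mul_assoc, h1', mul_neg, ← mul_assoc, h2', neg_mul, neg_neg, mul_assoc]
    | mul u v hu hv => exact hu.mul_right hv
    | add u v hu hv => exact hu.add_right hv
  have hx' : x ∈ CliffordAlgebra.evenOdd (0 : QuadraticForm ℝ (κ →₀ ℝ)) 0 := hx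
  induction x, hx' using CliffordAlgebra.even_induction with
  | algebraMap r => exact Algebra.commutes r y
  | add u v hu hv h1 h2 => exact (h1 hu).add_left (h2 hv)
  | ι_mul_ι_mul a b u hu h => exact (key a b y).mul_left (h hu)

instance instEvenCommRing : CommRing (Even κ) where
  mul_comm a b := Subtype.ext (even_central a.1 a.2 b.1).eq

/-- The projection `a ↦ (a + inv a) / 2` to the even part. -/
def evenProj (a : Grassmann κ) : Even κ :=
  ⟨(GradedRing.proj (CliffordAlgebra.evenOdd (0 : QuadraticForm ℝ (κ →₀ ℝ))) 0 a),
    SetLike.coe_mem _⟩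

section Berezinian

variable {ι : Type*} [Fintype ι] [DecidableEq ι] [Fintype κ] [DecidableEq κ]

/-- The Berezinian `Ber X = det (A - B D⁻¹ C) · (det D)⁻¹` of an even supermatrix
`X = (A B; C D)`: the blocks `A`, `D` have even entries and the blocks `B`, `C` odd entries, so that
`A`, `D` and `B D⁻¹ C` are matrices over the commutative ring of even elements
(and are not changed by `evenProj`). -/
def ber {κ' : Type*} (X : Matrix (ι ⊕ κ) (ι ⊕ κ) (Grassmann κ')) : Even κ' :=
  let A : Matrix ι ι (Even κ') := X.toBlocks₁₁.map evenProj
  let D : Matrix κ κ (Even κ') := X.toBlocks₂₂.map evenProj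
  let BDC : Matrix ι ι (Even κ') :=
    (X.toBlocks₁₂ * D⁻¹.map Subtype.val * X.toBlocks₂₁).map evenProj
  (A - BDC).det * D⁻¹.det

end Berezinian

section AbsPow

variable [Fintype κ]

/-- The power `|g|^w`, `w` real, of an even element `g` with body `b ≠ 0`: writing
`g = b (1 + n)` with `n` nilpotent, `|g|^w = |b|^w ∑_k (w choose k) n^k`. (Recall that
`Real.log b = log |b|`; the series stops because `n` is nilpotent.) -/
def absPow (g : Grassmann κ) (w : ℝ) : Grassmann κ :=
  Real.exp (w * Real.log (body g)) •
    ∑ k ∈ Finset.range (Fintype.card κ + 1),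
      Ring.choose w k • ((body g)⁻¹ • (g - algebraMap ℝ _ (body g))) ^ k

theorem pow_eq_zero_of_body (n : Grassmann κ) (hn : body n = 0) :
    n ^ (Fintype.card κ + 1) = 0 := by
  set R : Submodule ℝ (Grassmann κ) := LinearMap.range (ExteriorAlgebra.ι ℝ) with hR
  let F : ℕ → Submodule ℝ (Grassmann κ) := fun k => ⨆ d : ℕ, R ^ (k + d)
  have hmul : ∀ k l, F k * F l ≤ F (k + l) := by
    intro k l
    simp only [F, Submodule.iSup_mul, Submodule.mul_iSup]
    refine iSup_le fun d => iSup_le fun e => ?_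
    rw [← pow_add]
    refine le_trans (le_of_eq ?_) (le_iSup (fun d => R ^ (k + l + d)) (d + e))
    congr 1
    ring
  have h0 : ∀ d, Fintype.card κ < d → R ^ d = ⊥ := by
    intro d hd
    have h1 : Module.finrank ℝ (⋀[ℝ]^d (κ →₀ ℝ)) = 0 := by
      rw [exteriorPower.finrank_eq, Module.finrank_finsupp_self, Nat.choose_eq_zero_of_lt hd]
    exact Submodule.finrank_eq_zero.mp h1
  have hF : F (Fintype.card κ + 1) = ⊥ := by
    simp only [F]
    rw [iSup_eq_bot]
    intro d
    exact h0 _ (by omega)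
  have hbodyR : ∀ d : ℕ, ∀ x ∈ R ^ (1 + d), body x = 0 := by
    intro d x hx
    rw [pow_add, pow_one] at hx
    refine Submodule.mul_induction_on hx ?_ ?_
    · rintro _ ⟨m, rfl⟩ y _
      simp [body, ExteriorAlgebra.algebraMapInv]
    · intro x y hx hy
      rw [map_add, hx, hy, add_zero]
  have hbodyF : ∀ x ∈ F 1, body x = 0 := by
    intro x hx
    have : F 1 ≤ LinearMap.ker (body (κ := κ)).toLinearMap :=
      iSup_le fun d y hy => hbodyR d y hy
    exact this hx
  have htop : n ∈ (1 : Submodule ℝ (Grassmann κ)) ⊔ F 1 := by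
    have : (⊤ : Submodule ℝ (Grassmann κ)) ≤ 1 ⊔ F 1 := by
      rw [← CliffordAlgebra.iSup_ι_range_eq_top (0 : QuadraticForm ℝ (κ →₀ ℝ))]
      refine iSup_le fun d => ?_
      rcases d with _ | d
      · rw [pow_zero]; exact le_sup_left
      · refine le_trans ?_ le_sup_right
        have := le_iSup (fun d => R ^ (1 + d)) d
        rw [add_comm]
        exact this
    exact this trivial
  obtain ⟨a, ha, f, hf, rfl⟩ := Submodule.mem_sup.mp htop
  obtain ⟨r, rfl⟩ := Submodule.mem_one.mp ha
  have hr : r = 0 := by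
    rw [map_add, hbodyF f hf, add_zero] at hn
    simpa [body] using hn
  subst hr
  rw [map_zero, zero_add]
  have hpow : ∀ k, f ^ (k + 1) ∈ F (k + 1) := by
    intro k
    induction k with
    | zero => simpa using hf
    | succ k ih =>
      rw [pow_succ]
      exact hmul _ _ (Submodule.mul_mem_mul ih hf)
  have := hpow (Fintype.card κ)
  rw [hF] at this
  simpa using this

theorem absPow_zero (g : Grassmann κ) : absPow g 0 = 1 := by
  rw [absPow, Finset.sum_range_succ', Finset.sum_eq_zero]
  · simp
  · intro k _
    rw [Ring.choose_zero_succ, zero_smul]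

theorem absPow_add (g : Grassmann κ) (v w : ℝ) : absPow g (v + w) = absPow g v * absPow g w := by
  unfold absPow
  set n : Grassmann κ := (body g)⁻¹ • (g - algebraMap ℝ _ (body g)) with hn
  have hn0 : n ^ (Fintype.card κ + 1) = 0 := by
    apply pow_eq_zero_of_body
    simp [hn]
  set N := Fintype.card κ + 1
  rw [smul_mul_smul_comm, add_mul, Real.exp_add]
  congr 1
  rw [Finset.sum_mul_sum, ← Finset.sum_product']
  rw [← Finset.sum_filter_add_sum_filter_not _ (fun p : ℕ × ℕ => p.1 + p.2 < N)]
  rw [Finset.sum_eq_zero (s := Finset.filter (fun p : ℕ × ℕ => ¬ (p.1 + p.2 < N)) _), add_zero]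
  · simp_rw [Ring.add_choose_eq _ (Commute.all v w), Finset.sum_smul]
    rw [Finset.sum_sigma']
    refine Finset.sum_bij' (fun x _ => x.2) (fun p _ => ⟨p.1 + p.2, p⟩) ?_ ?_ ?_ ?_ ?_
    · rintro ⟨k, a, b⟩ h
      simp at h ⊢
      omega
    · rintro ⟨a, b⟩ h
      simp at h ⊢
      omega
    · rintro ⟨k, a, b⟩ h
      simp at h ⊢
      obtain ⟨_, rfl⟩ := h
      simp
    · rintro ⟨a, b⟩ h
      rfl
    · rintro ⟨k, a, b⟩ h
      simp at h
      rw [smul_mul_smul_comm, ← pow_add, h.2]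
  · rintro ⟨a, b⟩ h
    simp at h
    rw [smul_mul_smul_comm, ← pow_add, pow_eq_zero_of_le h.2 hn0, smul_zero]

theorem absPow_mem_even (g : Grassmann κ) (hg : g ∈ Even κ) (w : ℝ) : absPow g w ∈ Even κ := by
  unfold absPow
  refine Subalgebra.smul_mem _ (Subalgebra.sum_mem _ fun k _ => Subalgebra.smul_mem _
    (Subalgebra.pow_mem _ (Subalgebra.smul_mem _ (Subalgebra.sub_mem _ hg
      (Subalgebra.algebraMap_mem _ _)) _) _) _) _

end AbsPow

end Grassmann

/-! ## Superdomains -/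

/-- The superalgebra of smooth functions on the superdomain with even coordinates `x_i`, `i : ι`,
ranging over the open set `V`, and odd coordinates `ξ_j`, `j : κ`: smooth functions on `V` with
values in the Grassmann algebra, that is, `C^∞(V) ⊗ Λ(ξ)`. (A function on `V` is extended by
zero in order to speak of its smoothness on `V`.) -/
def SuperFun {ι : Type*} (κ : Type*) [Fintype ι] [Fintype κ] (V : Opens (ι → ℝ)) :
    Subalgebra ℝ (V → Grassmann κ) where
  carrier := {f | ContDiffOn ℝ ∞ (Function.extend Subtype.val f 0) V}
  algebraMap_mem' r := by
    refine (contDiffOn_const (c := algebraMap ℝ (Grassmann κ) r)).congr fun x hx => ?_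
    exact Subtype.val_injective.extend_apply _ _ (⟨x, hx⟩ : V)
  add_mem' {f g} hf hg := by
    refine (hf.add hg).congr fun x hx => ?_
    have h := fun k : V → Grassmann κ =>
      Subtype.val_injective.extend_apply k 0 (⟨x, hx⟩ : V)
    simp only at h
    simp only [Pi.add_apply, h]
  mul_mem' {f g} hf hg := by
    let m := (LinearMap.mul ℝ (Grassmann κ)).toContinuousBilinearMap
    refine (m.isBoundedBilinearMap.contDiff.comp_contDiffOn (hf.prodMk hg)).congr fun x hx => ?_
    have h := fun k : V → Grassmann κ =>
      Subtype.val_injective.extend_apply k 0 (⟨x, hx⟩ : V)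
    simp only at h
    simp only [Function.comp, h]
    rfl

namespace SuperFun

variable {ι ι' κ κ' : Type*} [Fintype ι] [Fintype κ] [Fintype ι'] [Fintype κ']
  {V V' : Opens (ι → ℝ)}

/-- Extension by zero of a superfunction on `V` to the whole coordinate space. -/
def extZ (f : SuperFun κ V) : (ι → ℝ) → Grassmann κ := Function.extend Subtype.val f.1 0

theorem extZ_apply (f : SuperFun κ V) (x : V) : (extZ f) x = f.1 x :=
  Subtype.val_injective.extend_apply _ _ x

theorem contDiffOn_extZ (f : SuperFun κ V) : ContDiffOn ℝ ∞ (extZ f) V := f.2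

/-- A Grassmann-valued function on the whole coordinate space that is smooth on `V`, as
a superfunction on `V`. -/
def ofContDiffOn (V : Opens (ι → ℝ)) (f : (ι → ℝ) → Grassmann κ) (hf : ContDiffOn ℝ ∞ f V) :
    SuperFun κ V :=
  ⟨fun x => f x, hf.congr fun x hx => Subtype.val_injective.extend_apply _ _ (⟨x, hx⟩ : V)⟩

/-- Restriction to a smaller domain. -/
def res (h : V' ≤ V) : SuperFun κ V →ₐ[ℝ] SuperFun κ V' where
  toFun f := ofContDiffOn V' (extZ f) ((contDiffOn_extZ f).mono h)
  map_one' := Subtype.ext <| funext fun x => extZ_apply (1 : SuperFun κ V) ⟨x, h x.2⟩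
  map_zero' := Subtype.ext <| funext fun x => extZ_apply (0 : SuperFun κ V) ⟨x, h x.2⟩
  map_mul' f g := Subtype.ext <| funext fun x => by
    have e := fun k : SuperFun κ V => extZ_apply k ⟨x, h x.2⟩
    exact (e (f * g)).trans (congrArg₂ (· * ·) (e f).symm (e g).symm)
  map_add' f g := Subtype.ext <| funext fun x => by
    have e := fun k : SuperFun κ V => extZ_apply k ⟨x, h x.2⟩
    exact (e (f + g)).trans (congrArg₂ (· + ·) (e f).symm (e g).symm)
  commutes' r := Subtype.ext <| funext fun x =>
    extZ_apply (algebraMap ℝ (SuperFun κ V) r) ⟨x, h x.2⟩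

/-- Substitution of coordinates: for index maps `e`, `o`, with the superdomain over `V'` mapped
to that over `V` by `x_i = y_{e i}`, `ξ_j = η_{o j}`, the function `f(x, ξ)` is sent to
`f(y_{e i}, η_{o j})`. -/
def pull {W : Opens (ι' → ℝ)} (e : ι → ι') (o : κ → κ') (h : ∀ y ∈ W, y ∘ e ∈ V) :
    SuperFun κ V →ₐ[ℝ] SuperFun κ' W where
  toFun f := ofContDiffOn W (fun y => Grassmann.rename o ((extZ f) (y ∘ e))) <| by
    refine (Grassmann.rename (κ := κ) o).toLinearMap.toContinuousLinearMap.contDiff.comp_contDiffOn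
      ((contDiffOn_extZ f).comp (contDiff_pi.mpr fun i => contDiff_apply ℝ ℝ (e i)).contDiffOn h)
  map_one' := Subtype.ext <| funext fun y =>
    (congrArg (Grassmann.rename o) (extZ_apply (1 : SuperFun κ V) ⟨y.1 ∘ e, h _ y.2⟩)).trans (map_one (Grassmann.rename o))
  map_zero' := Subtype.ext <| funext fun y =>
    (congrArg (Grassmann.rename o) (extZ_apply (0 : SuperFun κ V) ⟨y.1 ∘ e, h _ y.2⟩)).trans (map_zero (Grassmann.rename o))
  map_mul' f g := Subtype.ext <| funext fun y => by
    have e1 := fun k : SuperFun κ V => extZ_apply k ⟨y.1 ∘ e, h _ y.2⟩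
    refine (congrArg (Grassmann.rename o) ((e1 (f * g)).trans (congrArg₂ (· * ·) (e1 f).symm (e1 g).symm))).trans ?_
    exact map_mul (Grassmann.rename o) _ _
  map_add' f g := Subtype.ext <| funext fun y => by
    have e1 := fun k : SuperFun κ V => extZ_apply k ⟨y.1 ∘ e, h _ y.2⟩
    refine (congrArg (Grassmann.rename o) ((e1 (f + g)).trans (congrArg₂ (· + ·) (e1 f).symm (e1 g).symm))).trans ?_
    exact map_add (Grassmann.rename o) _ _
  commutes' r := Subtype.ext <| funext fun y =>
    (congrArg (Grassmann.rename o) (extZ_apply (algebraMap ℝ (SuperFun κ V) r) ⟨y.1 ∘ e, h _ y.2⟩)).trans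
      ((Grassmann.rename o).commutes r)

/-- Application of a linear endomorphism of the Grassmann algebra to the values. -/
def mapVal (L : Grassmann κ →ₗ[ℝ] Grassmann κ) : SuperFun κ V →ₗ[ℝ] SuperFun κ V where
  toFun f := ofContDiffOn V (fun x => L ((extZ f) x))
    (L.toContinuousLinearMap.contDiff.comp_contDiffOn (contDiffOn_extZ f))
  map_add' f g := Subtype.ext <| funext fun x => by
    change L ((extZ (f + g)) x) = L ((extZ f) x) + L ((extZ g) x)
    rw [extZ_apply, extZ_apply, extZ_apply, ← map_add]
    rfl
  map_smul' r f := Subtype.ext <| funext fun x => by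
    change L ((extZ (r • f)) x) = r • L ((extZ f) x)
    rw [extZ_apply, extZ_apply, ← map_smul]
    rfl

/-- The parity operator: `f ↦ (-1)^{parity of f} f` on homogeneous superfunctions. -/
def inv : SuperFun κ V →ₗ[ℝ] SuperFun κ V := mapVal Grassmann.inv.toLinearMap

/-- `f` is homogeneous, of parity `k` modulo `2`. -/
def HasParity (f : SuperFun κ V) (k : ℕ) : Prop := inv f = (-1 : ℝ) ^ k • f

/-- The coordinate functions: `x_i` for the index `inl i` and `ξ_j` for the index `inr j`. -/
def coord : ι ⊕ κ → SuperFun κ V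
  | .inl i => ofContDiffOn V (fun x => algebraMap ℝ _ (x i)) <| by
      exact ((Algebra.linearMap ℝ (Grassmann κ)).toContinuousLinearMap.contDiff.comp
        (contDiff_apply ℝ ℝ i)).contDiffOn
  | .inr j => ofContDiffOn V (fun _ => Grassmann.gen j) contDiffOn_const

/-- The parity `ã` of a coordinate: `0` for the even ones, `1` for the odd ones. -/
def parity : ι ⊕ κ → ℕ
  | .inl _ => 0
  | .inr _ => 1

/-- The partial derivative `∂/∂x_i`. -/
def evenDeriv [DecidableEq ι] (i : ι) : SuperFun κ V →ₗ[ℝ] SuperFun κ V where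
  toFun f := ofContDiffOn V (fun x => fderiv ℝ (extZ f) x (Pi.single i 1))
    (((contDiffOn_extZ f).fderiv_of_isOpen V.isOpen (by simp)).clm_apply contDiffOn_const)
  map_add' f g := Subtype.ext <| funext fun x => by
    have hd := fun k : SuperFun κ V =>
      ((contDiffOn_extZ k).contDiffAt (V.isOpen.mem_nhds x.2)).differentiableAt (by simp)
    have he : (extZ (f + g)) =ᶠ[nhds x.1] (extZ f) + (extZ g) := by
      filter_upwards [V.isOpen.mem_nhds x.2] with y hy
      have e := fun k : SuperFun κ V => extZ_apply k ⟨y, hy⟩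
      exact (e (f + g)).trans (congrArg₂ (· + ·) (e f).symm (e g).symm)
    change fderiv ℝ (extZ (f + g)) x _ = fderiv ℝ (extZ f) x _ + fderiv ℝ (extZ g) x _
    rw [he.fderiv_eq, fderiv_add (hd f) (hd g)]
    rfl
  map_smul' r f := Subtype.ext <| funext fun x => by
    have hd := fun k : SuperFun κ V =>
      ((contDiffOn_extZ k).contDiffAt (V.isOpen.mem_nhds x.2)).differentiableAt (by simp)
    have he : (extZ (r • f)) =ᶠ[nhds x.1] r • (extZ f) := by
      filter_upwards [V.isOpen.mem_nhds x.2] with y hy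
      have e := fun k : SuperFun κ V => extZ_apply k ⟨y, hy⟩
      exact (e (r • f)).trans (congrArg (r • ·) (e f).symm)
    change fderiv ℝ (extZ (r • f)) x _ = r • fderiv ℝ (extZ f) x _
    rw [he.fderiv_eq, fderiv_const_smul (hd f)]
    rfl

/-- The left partial derivative with respect to the coordinate of index `a`. -/
def pderiv [DecidableEq ι] : ι ⊕ κ → (SuperFun κ V →ₗ[ℝ] SuperFun κ V)
  | .inl i => evenDeriv i
  | .inr j => mapVal (Grassmann.leftDeriv j)

/-! ### The cotangent bundle and the canonical Poisson bracket -/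

/-- The body of the cotangent bundle of the superdomain over `V`. Its even coordinates are the
`x_i` (index `inl i`) with `x ∈ V` and their momenta (index `inr i`), its odd coordinates the `ξ_j`
(index `inl j`) and their momenta (index `inr j`). -/
def cot (V : Opens (ι → ℝ)) : Opens (ι ⊕ ι → ℝ) :=
  ⟨{y | y ∘ Sum.inl ∈ V}, V.isOpen.preimage (by fun_prop)⟩

/-- A function on the superdomain as a function on its cotangent bundle. -/
def toCot : SuperFun κ V →ₐ[ℝ] SuperFun (κ ⊕ κ) (cot V) :=
  pull Sum.inl Sum.inl fun _ h => h

/-- The momentum `p_a` conjugate to the coordinate of index `a`. -/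
def mom (a : ι ⊕ κ) : SuperFun (κ ⊕ κ) (cot V) := coord (Sum.map Sum.inr Sum.inr a)

/-- The canonical even Poisson bracket on the cotangent bundle, with left derivatives and with
`(p_a, x^b) = δ_a^b`:
`(F, G) = ∑_a (-1)^{ã (F̃ + 1)} (∂F/∂p_a) (∂G/∂x^a) - (-1)^{ã F̃} (∂F/∂x^a) (∂G/∂p_a)`.
In the second sum below (odd coordinates) the signs are `(-1)^{F̃ + 1}`, which is the sign that
`inv` puts on a derivative of `F` along an odd coordinate. -/
def poisson [DecidableEq ι] (F G : SuperFun (κ ⊕ κ) (cot V)) : SuperFun (κ ⊕ κ) (cot V) :=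
  (∑ i : ι, (pderiv (.inl (.inr i)) F * pderiv (.inl (.inl i)) G
      - pderiv (.inl (.inl i)) F * pderiv (.inl (.inr i)) G))
  + ∑ j : κ, (inv (pderiv (.inr (.inr j)) F) * pderiv (.inr (.inl j)) G
      + inv (pderiv (.inr (.inl j)) F) * pderiv (.inr (.inr j)) G)

/-! ### The extended domain -/

/-- The body of the extended superdomain: `V × (0, ∞)`, the extra even coordinate being `t`
(index `inr ()`). -/
def hat (V : Opens (ι → ℝ)) : Opens (ι ⊕ Unit → ℝ) :=
  ⟨{y | y ∘ Sum.inl ∈ V ∧ 0 < y (Sum.inr ())},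
    (V.isOpen.preimage (by fun_prop : Continuous fun y : ι ⊕ Unit → ℝ => y ∘ Sum.inl)).inter
      (isOpen_lt continuous_const (continuous_apply (Sum.inr ())))⟩

/-- A function of `x` as a function on the extended superdomain. -/
def toHat : SuperFun κ V →ₐ[ℝ] SuperFun κ (hat V) := pull Sum.inl id fun _ h => h.1

/-- The function `t^w` on the extended superdomain. -/
def tpow (w : ℝ) : SuperFun κ (hat V) :=
  ofContDiffOn (hat V) (fun y => algebraMap ℝ _ (y (Sum.inr ()) ^ w)) <| by
    refine (Algebra.linearMap ℝ (Grassmann κ)).toContinuousLinearMap.contDiff.comp_contDiffOn ?_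
    intro y hy
    exact ((contDiff_apply ℝ ℝ (Sum.inr ())).contDiffAt.rpow_const_of_ne
      hy.2.ne').contDiffWithinAt

/-- The generating function `∑_w ψ_w(x) t^w` on the extended superdomain of a formal finite sum of
densities of weights `w` with coefficients `ψ_w`. -/
def generating (ψ : AddMonoidAlgebra (SuperFun κ V) ℝ) : SuperFun κ (hat V) :=
  ψ.coeff.sum fun w f => toHat f * tpow w

end SuperFun

/-! ## Supermanifolds -/

universe u v

/-- The image `φ(W ∩ U)` of an open set `W` under a chart `φ` with domain `U`. -/
def chartImage {X : Type*} [TopologicalSpace X] {p : ℕ}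
    (φ : OpenPartialHomeomorph X (Fin p → ℝ)) (W : Opens X) : Opens (Fin p → ℝ) :=
  ⟨φ.target ∩ φ.symm ⁻¹' W, φ.isOpen_inter_preimage_symm W.isOpen⟩

theorem chartImage_mono {X : Type*} [TopologicalSpace X] {p : ℕ}
    (φ : OpenPartialHomeomorph X (Fin p → ℝ)) {W' W : Opens X} (h : W' ≤ W) :
    chartImage φ W' ≤ chartImage φ W := fun _ hx => ⟨hx.1, h hx.2⟩

open SuperFun in
/-- A smooth real supermanifold of dimension `p|q`, glued from superdomains: a Hausdorff second
countable space `carrier` covered by the domains `U_i` of homeomorphisms `φ_i = chart i` onto open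
sets of `ℝ^p`, together with changes of coordinates. The change of coordinates from chart `j` to
chart `i` over an open set `W ⊆ U_i ∩ U_j` is a parity-preserving isomorphism of the superalgebras
of functions `C^∞(φ_j(W)) ⊗ Λ_q → C^∞(φ_i(W)) ⊗ Λ_q` (it rewrites a function of the `j`-coordinates
in the `i`-coordinates), compatible with restriction and satisfying the cocycle conditions
(invertibility is a consequence of them). -/
structure Supermanifold (p q : ℕ) where
  carrier : Type u
  [topology : TopologicalSpace carrier]
  [t2 : T2Space carrier]
  [secondCountable : SecondCountableTopology carrier]
  /-- the index set of the atlas -/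
  Idx : Type v
  chart : Idx → OpenPartialHomeomorph carrier (Fin p → ℝ)
  cover : ∀ x, ∃ i, x ∈ (chart i).source
  change : ∀ (i j : Idx) (W : Opens carrier),
    (W : Set carrier) ⊆ (chart i).source → (W : Set carrier) ⊆ (chart j).source →
    (SuperFun (Fin q) (chartImage (chart j) W) →ₐ[ℝ] SuperFun (Fin q) (chartImage (chart i) W))
  change_parity : ∀ i j W hi hj F, change i j W hi hj (inv F) = inv (change i j W hi hj F)
  change_res : ∀ i j (W W' : Opens carrier) (h : W' ≤ W) hi hj F,
    change i j W' (fun _ hx => hi (h hx)) (fun _ hx => hj (h hx))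
        (res (chartImage_mono (chart j) h) F) =
      res (chartImage_mono (chart i) h) (change i j W hi hj F)
  change_self : ∀ i W hi, change i i W hi hi = AlgHom.id ℝ _
  change_comp : ∀ i j k W hi hj hk,
    (change i j W hi hj).comp (change j k W hj hk) = change i k W hi hk

attribute [instance] Supermanifold.topology Supermanifold.t2 Supermanifold.secondCountable

namespace Supermanifold

open SuperFun

variable {p q : ℕ} (M : Supermanifold.{u, v} p q)

/-- The coordinate domain `φ_i(U_i)` of the chart `i`. -/
def dom (i : M.Idx) : Opens (Fin p → ℝ) := ⟨(M.chart i).target, (M.chart i).open_target⟩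

/-- The overlap `U_i ∩ U_j` of the domains of two charts. -/
def overlap (i j : M.Idx) : Opens M.carrier :=
  ⟨(M.chart i).source ∩ (M.chart j).source, (M.chart i).open_source.inter (M.chart j).open_source⟩

theorem chartImage_le_dom (i : M.Idx) (W : Opens M.carrier) : chartImage (M.chart i) W ≤ M.dom i :=
  inter_subset_left

/-- The change of coordinates from chart `j` to chart `i` on the overlap of the charts. -/
def transition (i j : M.Idx) :
    SuperFun (Fin q) (chartImage (M.chart j) (M.overlap i j)) →ₐ[ℝ]
      SuperFun (Fin q) (chartImage (M.chart i) (M.overlap i j)) :=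
  M.change i j (M.overlap i j) inter_subset_left inter_subset_right

/-- The Jacobi matrix `∂x_j^b / ∂x_i^a` (row `a`, column `b`) of the coordinates of chart `j` as
functions of those of chart `i`, at the point `x` of `φ_i(U_i ∩ U_j)`. -/
def jacobiMatrix (i j : M.Idx) (x : chartImage (M.chart i) (M.overlap i j)) :
    Matrix (Fin p ⊕ Fin q) (Fin p ⊕ Fin q) (Grassmann (Fin q)) :=
  fun a b => (pderiv a (M.transition i j (coord b))).1 x

/-- The Jacobian (Berezinian) `J = Dx_j / Dx_i` at the point `x` of `φ_i(U_i ∩ U_j)`. -/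
def jacobian (i j : M.Idx) (x : chartImage (M.chart i) (M.overlap i j)) :
    Grassmann.Even (Fin q) :=
  Grassmann.ber (M.jacobiMatrix i j x)

/-! ### The algebra of densities -/

/-- The rule `|Dx_j|^w = |J|^w |Dx_i|^w`, with `J = Dx_j / Dx_i`, as a map that rewrites formal sums
of densities `∑_w ψ_w |Dx|^w` from the chart `j` in the chart `i`, at a point `x` of
`φ_i(U_i ∩ U_j)`; see `coeff_transformAt`. -/
def transformAt (i j : M.Idx) (x : chartImage (M.chart i) (M.overlap i j)) :
    AddMonoidAlgebra (SuperFun (Fin q) (M.dom j)) ℝ →+* AddMonoidAlgebra (Grassmann (Fin q)) ℝ :=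
  AddMonoidAlgebra.liftNCRingHom
    (AddMonoidAlgebra.singleZeroRingHom.comp <|
      ((Pi.evalAlgHom ℝ (fun _ => Grassmann (Fin q)) x).comp <| (SuperFun (Fin q) _).val.comp <|
        (M.transition i j).comp (res (M.chartImage_le_dom j _))).toRingHom)
    { toFun := fun w => AddMonoidAlgebra.single w.toAdd
        (Grassmann.absPow (M.jacobian i j x).1 w.toAdd)
      map_one' := by
        rw [toAdd_one, Grassmann.absPow_zero]
        rfl
      map_mul' := fun v w => by
        rw [toAdd_mul, Grassmann.absPow_add, AddMonoidAlgebra.single_mul_single] }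
    (fun f w => by
      change AddMonoidAlgebra.single _ _ * AddMonoidAlgebra.single _ _
        = AddMonoidAlgebra.single _ _ * AddMonoidAlgebra.single _ _
      rw [AddMonoidAlgebra.single_mul_single, AddMonoidAlgebra.single_mul_single, zero_add,
        add_zero]
      congr 1
      exact (Grassmann.even_central _
        (Grassmann.absPow_mem_even _ (M.jacobian i j x).2 _) _).symm.eq)

theorem coeff_transformAt (i j : M.Idx) (x : chartImage (M.chart i) (M.overlap i j))
    (ψ : AddMonoidAlgebra (SuperFun (Fin q) (M.dom j)) ℝ) (w : ℝ) :
    (M.transformAt i j x ψ).coeff w =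
      (M.transition i j (res (M.chartImage_le_dom j _) (ψ.coeff w))).1 x *
        Grassmann.absPow (M.jacobian i j x).1 w := by
  induction ψ using AddMonoidAlgebra.induction_linear with
  | zero => simp
  | add f g hf hg =>
    rw [map_add, AddMonoidAlgebra.coeff_add, Finsupp.add_apply, hf, hg, AddMonoidAlgebra.coeff_add,
      Finsupp.add_apply, map_add, map_add, ← add_mul]
    rfl
  | single v f =>
    have h : M.transformAt i j x (AddMonoidAlgebra.single v f) = AddMonoidAlgebra.single v
        ((M.transition i j (res (M.chartImage_le_dom j _) f)).1 x *
          Grassmann.absPow (M.jacobian i j x).1 v) := by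
      refine (AddMonoidAlgebra.liftNC_single _ _ _ _).trans ?_
      refine (AddMonoidAlgebra.single_mul_single _ _ _ _).trans ?_
      rw [zero_add]
      rfl
    rw [h]
    rcases eq_or_ne v w with rfl | hvw
    · simp
    · simp [AddMonoidAlgebra.coeff_single, Finsupp.single_eq_of_ne hvw.symm]

/-- The ring homomorphism that evaluates the coefficients of a formal sum in the chart `i` at the
point `x`. -/
def evalAt (i j : M.Idx) (x : chartImage (M.chart i) (M.overlap i j)) :
    AddMonoidAlgebra (SuperFun (Fin q) (M.dom i)) ℝ →+* AddMonoidAlgebra (Grassmann (Fin q)) ℝ :=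
  AddMonoidAlgebra.mapRingHom ℝ ((Pi.evalAlgHom ℝ (fun _ => Grassmann (Fin q)) x).comp <|
    (SuperFun (Fin q) _).val.comp <| res (M.chartImage_le_dom i _)).toRingHom

theorem compatible_iff (ψ : ∀ i, AddMonoidAlgebra (SuperFun (Fin q) (M.dom i)) ℝ) :
    (∀ (i j : M.Idx) (w : ℝ) (x : chartImage (M.chart i) (M.overlap i j)),
      extZ ((ψ i).coeff w) x =
        (M.transition i j (res (M.chartImage_le_dom j _) ((ψ j).coeff w))).1 x *
          Grassmann.absPow (M.jacobian i j x).1 w) ↔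
    ∀ i j x, M.evalAt i j x (ψ i) = M.transformAt i j x (ψ j) := by
  have h : ∀ i j w x, (M.evalAt i j x (ψ i)).coeff w = extZ ((ψ i).coeff w) x := by
    intro i j w x
    rw [evalAt, AddMonoidAlgebra.coeff_mapRingHom]
    rfl
  constructor
  · intro H i j x
    ext w
    rw [h, H, coeff_transformAt]
  · intro H i j w x
    rw [← h i j w x, H, coeff_transformAt]

/-- The algebra `𝔙(M)` of densities on `M`. An element is a formal finite sum of densities
of weights `w ∈ ℝ`; it is given in each chart `i` by a formal finite sum
`∑_w ψ_{i,w} |Dx_i|^w` (and multiplied accordingly), and on overlaps these agree under the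
transformation law `ψ_{i,w} = ψ_{j,w} |J|^w` with `J = Dx_j / Dx_i`. -/
def Densities : Subalgebra ℝ (∀ i, AddMonoidAlgebra (SuperFun (Fin q) (M.dom i)) ℝ) where
  carrier := {ψ | (∃ T : Finset ℝ, ∀ i, (ψ i).coeff.support ⊆ T) ∧
    ∀ (i j : M.Idx) (w : ℝ) (x : chartImage (M.chart i) (M.overlap i j)),
      extZ ((ψ i).coeff w) x =
        (M.transition i j (res (M.chartImage_le_dom j _) ((ψ j).coeff w))).1 x *
          Grassmann.absPow (M.jacobian i j x).1 w}
  mul_mem' {ψ χ} hψ hχ := by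
    obtain ⟨⟨T, hT⟩, hψ⟩ := hψ
    obtain ⟨⟨T', hT'⟩, hχ⟩ := hχ
    refine ⟨⟨Finset.image (fun p : ℝ × ℝ => p.1 + p.2) (T ×ˢ T'), fun i w hw => ?_⟩, ?_⟩
    · by_contra hn
      refine Finsupp.mem_support_iff.mp hw ?_
      rw [Pi.mul_apply, AddMonoidAlgebra.coeff_mul, Finsupp.sum]
      refine Finset.sum_eq_zero fun a ha => ?_
      refine Finset.sum_eq_zero fun b hb => if_neg fun h => hn ?_
      exact Finset.mem_image.mpr ⟨(a, b), Finset.mem_product.mpr ⟨hT i ha, hT' i hb⟩, h⟩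
    · exact (M.compatible_iff _).mpr fun i j x => by
        rw [Pi.mul_apply, Pi.mul_apply, map_mul, map_mul, (M.compatible_iff ψ).mp hψ,
          (M.compatible_iff χ).mp hχ]
  add_mem' {ψ χ} hψ hχ := by
    obtain ⟨⟨T, hT⟩, hψ⟩ := hψ
    obtain ⟨⟨T', hT'⟩, hχ⟩ := hχ
    refine ⟨⟨T ∪ T', fun i => ?_⟩, ?_⟩
    · exact (Finsupp.support_add).trans (Finset.union_subset_union (hT i) (hT' i))
    · exact (M.compatible_iff _).mpr fun i j x => by
        rw [Pi.add_apply, Pi.add_apply, map_add, map_add, (M.compatible_iff ψ).mp hψ,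
          (M.compatible_iff χ).mp hχ]
  algebraMap_mem' r := by
    have h : ∀ i, algebraMap ℝ (∀ i, AddMonoidAlgebra (SuperFun (Fin q) (M.dom i)) ℝ) r i =
        AddMonoidAlgebra.single 0 (algebraMap ℝ _ r) := fun i => rfl
    refine ⟨⟨{0}, fun i => ?_⟩, ?_⟩
    · rw [h]
      exact Finsupp.support_single_subset
    · intro i j w x
      rw [h, h, AddMonoidAlgebra.coeff_single, AddMonoidAlgebra.coeff_single]
      rcases eq_or_ne w 0 with rfl | hw
      · rw [Finsupp.single_eq_same, Finsupp.single_eq_same, Grassmann.absPow_zero, mul_one,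
          AlgHom.commutes, AlgHom.commutes]
        exact extZ_apply _ (⟨x, M.chartImage_le_dom i _ x.2⟩ : M.dom i)
      · rw [Finsupp.single_eq_of_ne hw, Finsupp.single_eq_of_ne hw, map_zero, map_zero]
        refine (extZ_apply _ (⟨x, M.chartImage_le_dom i _ x.2⟩ : M.dom i)).trans ?_
        exact (zero_mul _).symm

/-- All coefficients of a density have parity `k` modulo `2`. -/
def HasParity {M : Supermanifold.{u, v} p q} (ψ : M.Densities) (k : ℕ) : Prop :=
  ∀ i w, SuperFun.HasParity ((ψ.1 i).coeff w) k

/-- The density is homogeneous of weight `w`. -/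
def HasWeight {M : Supermanifold.{u, v} p q} (ψ : M.Densities) (w : ℝ) : Prop :=
  ∀ i v, v ≠ w → (ψ.1 i).coeff v = 0

/-! ### Long brackets -/

/-- A long bracket on `M` of parity `ε`: a bracket in the algebra of densities, that is, a
symmetric bi-derivation of parity `ε`. -/
structure LongBracket (ε : ℕ) where
  toFun : M.Densities →ₗ[ℝ] M.Densities →ₗ[ℝ] M.Densities
  parity : ∀ a b k l, HasParity a k → HasParity b l → HasParity (toFun a b) (k + l + ε)
  symm : ∀ a b k l, HasParity a k → HasParity b l →
    toFun a b = (-1 : ℝ) ^ (k * l) • toFun b a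
  leibniz : ∀ a b c k l, HasParity a k → HasParity b l →
    toFun a (b * c) = toFun a b * c + (-1 : ℝ) ^ ((k + ε) * l) • (b * toFun a c)

namespace LongBracket

variable {M} {ε : ℕ}

/-- The long bracket has weight `lam`. -/
def OfWeight (B : M.LongBracket ε) (lam : ℝ) : Prop :=
  ∀ a b v w, HasWeight a v → HasWeight b w → HasWeight (B.toFun a b) (v + w + lam)

/-- The Jacobi identity for an odd symmetric bracket:
`(-1)^{ã c̃} {{a,b},c} + (-1)^{c̃ b̃} {{c,a},b} + (-1)^{b̃ ã} {{b,c},a} = 0`. -/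
def Jacobi (B : M.LongBracket 1) : Prop :=
  ∀ a b c k l m, HasParity a k → HasParity b l → HasParity c m →
    (-1 : ℝ) ^ (k * m) • B.toFun (B.toFun a b) c + (-1 : ℝ) ^ (m * l) • B.toFun (B.toFun c a) b
      + (-1 : ℝ) ^ (l * k) • B.toFun (B.toFun b c) a = 0

end LongBracket

end Supermanifold

/-! ## Extended master Hamiltonians -/

open SuperFun in
/-- The coefficients `S^{ab}`, `γ^a`, `θ` of an extended master Hamiltonian of odd parity on a
superdomain: `S^{ab}` has parity `ã + b̃ + 1` and is symmetric in the graded sense, `γ^a` has parity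
`ã + 1`, and `θ` is odd. -/
structure OddCoeffs {ι : Type*} (κ : Type*) [Fintype ι] [Fintype κ] (V : Opens (ι → ℝ)) where
  S : ι ⊕ κ → ι ⊕ κ → SuperFun κ V
  γ : ι ⊕ κ → SuperFun κ V
  θ : SuperFun κ V
  symm_S : ∀ a b, S a b = (-1 : ℝ) ^ (parity a * parity b) • S b a
  parity_S : ∀ a b, HasParity (S a b) (parity a + parity b + 1)
  parity_γ : ∀ a, HasParity (γ a) (parity a + 1)
  parity_θ : HasParity θ 1

namespace OddCoeffs

open SuperFun

variable {ι κ : Type*} [Fintype ι] [Fintype κ] {V : Opens (ι → ℝ)} (H : OddCoeffs κ V)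

/-- `S = ½ S^{ab} p_b p_a` on the cotangent bundle of the superdomain. -/
def hamS : SuperFun (κ ⊕ κ) (cot V) :=
  (1 / 2 : ℝ) • ∑ a, ∑ b, toCot (H.S a b) * mom b * mom a

/-- `γ = γ^a p_a` on the cotangent bundle of the superdomain. -/
def hamγ : SuperFun (κ ⊕ κ) (cot V) := ∑ a, toCot (H.γ a) * mom a

/-- `θ` as a function on the cotangent bundle of the superdomain. -/
def hamθ : SuperFun (κ ⊕ κ) (cot V) := toCot H.θ

/-- The extended master Hamiltonian `Ŝ = ½ (S^{ab} p_b p_a + 2 t γ^a p_a p_t + t² θ p_t²)` on the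
cotangent bundle of the extended superdomain with coordinates `x^a`, `t`. -/
def hamHat : SuperFun (κ ⊕ κ) (cot (hat V)) :=
  let lift : SuperFun κ V → SuperFun (κ ⊕ κ) (cot (hat V)) := fun f => toCot (toHat f)
  let P : ι ⊕ κ → SuperFun (κ ⊕ κ) (cot (hat V)) := fun a => mom (Sum.map Sum.inl id a)
  let t : SuperFun (κ ⊕ κ) (cot (hat V)) := toCot (coord (.inl (.inr ())))
  let pt : SuperFun (κ ⊕ κ) (cot (hat V)) := mom (.inl (.inr ()))
  (1 / 2 : ℝ) • (∑ a, ∑ b, lift (H.S a b) * P b * P a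
    + (2 : ℝ) • (t * (∑ a, lift (H.γ a) * P a) * pt)
    + t ^ 2 * lift H.θ * pt ^ 2)

end OddCoeffs

open SuperFun in
/-- The long bracket `B` is specified by the extended master Hamiltonian `Ŝ` whose local
coefficients are `H`: in every chart `{ψ; χ} = ((Ŝ, ψ), χ)`, where the parentheses are the
canonical Poisson bracket on the cotangent bundle of the extended manifold and densities
`∑_w ψ_w |Dx|^w` are seen as functions `∑_w ψ_w(x) t^w`. -/
def Supermanifold.LongBracket.IsSpecifiedBy {p q : ℕ} {M : Supermanifold.{u, v} p q}
    (B : M.LongBracket 1) (H : ∀ i, OddCoeffs (Fin q) (M.dom i)) : Prop :=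
  ∀ (a b : M.Densities) (i : M.Idx),
    toCot (generating ((B.toFun a b).1 i)) =
      poisson (poisson (H i).hamHat (toCot (generating (a.1 i)))) (toCot (generating (b.1 i)))

end

/-! The long bracket is the derived bracket of Ŝ for the canonical Poisson bracket on the cotangent
bundle of M̂. Functions on M̂ Poisson commute, so the Jacobi identity of the canonical bracket
identifies the Jacobiator of {ψ; χ} = ((Ŝ, ψ), χ), up to a sign, with ½ ((((Ŝ, Ŝ), ψ), χ), ω)
(`poisson_jacobi`, `derived_jacobiator`). The function (Ŝ, Ŝ) is a homogeneous cubic in the momenta;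
by Euler's identity it vanishes as soon as its triple brackets with the coordinates x^a, t vanish
(`val_eq_zero_of_poisson₃`). Near any point these coordinates agree with generating functions of
global densities: x^a in weight 0, t in weight 1 (`exists_density_coord`). Hence the Jacobi identity
is equivalent to (Ŝ, Ŝ) = 0 in every chart (`jacobi_iff`).

The function τ = t p_t commutes with itself and with all functions pulled back from T*M, and Ŝ = S +
τγ + ½τ²θ. The parts are odd, so their brackets are symmetric, and (θ, θ) = 0; therefore (Ŝ, Ŝ) =
(S, S) + 2τ(S, γ) + τ²((S, θ) + (γ, γ)) + τ³(γ, θ). Over each point of T*M the function τ takes all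
real values, so the four coefficients vanish separately (`poisson_hamHat`,
`poisson_hamHat_eq_zero_iff`).

The longest part of the work is the supply of global densities (`exists_density`). A superfunction
cut off by a bump function in one chart is rewritten in the other charts and extended by zero; the
results fit together by the cocycle law of |J|^w (`jacPow_mul`). Changes of coordinates are given
only as algebra homomorphisms, so this law rests on four facts. Changes of coordinates lie over the
point maps, hence are local (`body_change`, `apply_eq_zero`). Jacobi matrices obey the chain rule,
by Hadamard's lemma and nilpotency (`pderiv_map`). The Berezinian is multiplicative, because det(1 +
BC) det(1 + CB) = 1 for odd B, C (`det_mul_det`, `isBer_mul`). Powers |g|^w are multiplicative and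
commute with homomorphisms: apart from a common exponential factor both sides are polynomial in w,
and they agree at even integers (`absPow_mul`, `map_absPowFun`). -/

open Set TopologicalSpace
open scoped ContDiff

noncomputable section

/-! ### Sign rules and derivatives in Grassmann algebras. -/

namespace Grassmann

variable {κ κ' : Type*}

theorem inv_inv (x : Grassmann κ) : inv (inv x) = x :=
  CliffordAlgebra.involute_involute x

theorem inv_ι (v : κ →₀ ℝ) : inv (ExteriorAlgebra.ι ℝ v) = -ExteriorAlgebra.ι ℝ v :=
  CliffordAlgebra.involute_ι v

theorem inv_gen (j : κ) : inv (gen j) = -gen j := inv_ι _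

theorem inv_algebraMap (r : ℝ) : inv (algebraMap ℝ (Grassmann κ) r) = algebraMap ℝ _ r :=
  inv.commutes r

theorem exists_even_add_odd (x : Grassmann κ) :
    ∃ a ∈ CliffordAlgebra.evenOdd (0 : QuadraticForm ℝ (κ →₀ ℝ)) 0,
      ∃ b ∈ CliffordAlgebra.evenOdd (0 : QuadraticForm ℝ (κ →₀ ℝ)) 1, a + b = x :=
  Submodule.mem_sup.mp <| by
    rw [(CliffordAlgebra.evenOdd_isCompl (0 : QuadraticForm ℝ (κ →₀ ℝ))).sup_eq_top]
    trivial

theorem eq_zero_of_eq_neg {E : Type*} [AddCommGroup E] [Module ℝ E] {x : E} (h : x = -x) :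
    x = 0 := by
  have h2 : (2 : ℝ) • x = 0 := by rw [two_smul]; exact add_eq_zero_iff_eq_neg.mpr h
  exact (smul_eq_zero.mp h2).resolve_left two_ne_zero

theorem mem_even_iff {x : Grassmann κ} : x ∈ Even κ ↔ inv x = x := by
  refine ⟨fun h => CliffordAlgebra.involute_eq_of_mem_even h, fun h => ?_⟩
  obtain ⟨a, ha, b, hb, rfl⟩ := exists_even_add_odd x
  have h1 : inv a = a := CliffordAlgebra.involute_eq_of_mem_even ha
  have h2 : inv b = -b := CliffordAlgebra.involute_eq_of_mem_odd hb
  rw [map_add, h1, h2] at h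
  have h3 : b = 0 := eq_zero_of_eq_neg (add_left_cancel h).symm
  rw [h3, add_zero]
  exact ha

theorem mem_odd_of_inv {x : Grassmann κ} (h : inv x = -x) :
    x ∈ CliffordAlgebra.evenOdd (0 : QuadraticForm ℝ (κ →₀ ℝ)) 1 := by
  obtain ⟨a, ha, b, hb, rfl⟩ := exists_even_add_odd x
  have h1 : inv a = a := CliffordAlgebra.involute_eq_of_mem_even ha
  have h2 : inv b = -b := CliffordAlgebra.involute_eq_of_mem_odd hb
  rw [map_add, h1, h2, neg_add] at h
  have h3 : a = 0 := eq_zero_of_eq_neg (add_right_cancel h)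
  rw [h3, zero_add]
  exact hb

theorem ι_mul_of_inv (v : κ →₀ ℝ) (y : Grassmann κ) :
    ExteriorAlgebra.ι ℝ v * y = inv y * ExteriorAlgebra.ι ℝ v := by
  induction y using ExteriorAlgebra.induction with
  | algebraMap r => rw [inv_algebraMap, Algebra.commutes]
  | ι c =>
    rw [inv_ι, neg_mul]
    exact eq_neg_of_add_eq_zero_left (ExteriorAlgebra.ι_add_mul_swap (R := ℝ) v c)
  | mul u v hu hv => rw [map_mul, ← mul_assoc, hu, mul_assoc, hv, mul_assoc]
  | add u v hu hv => rw [map_add, mul_add, add_mul, hu, hv]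

/-- The sign rule in a form that does not require `y` to be homogeneous: crossing an odd element
flips exactly the odd part of `y`. Odd elements are built from generators by sums and by
multiplication with pairs of generators, and such pairs are central. -/
theorem odd_mul {x : Grassmann κ} (h : inv x = -x) (y : Grassmann κ) : x * y = inv y * x := by
  induction x, mem_odd_of_inv h using CliffordAlgebra.odd_induction with
  | ι v => exact ι_mul_of_inv v y
  | add u v hu hv h1 h2 =>
    rw [add_mul, mul_add, h1 (CliffordAlgebra.involute_eq_of_mem_odd hu),
      h2 (CliffordAlgebra.involute_eq_of_mem_odd hv)]
  | ι_mul_ι_mul a b x hx h1 =>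
    have e : Commute _ (inv y) := even_central _ (CliffordAlgebra.ι_mul_ι_mem_evenOdd_zero
      (0 : QuadraticForm ℝ (κ →₀ ℝ)) a b) (inv y)
    rw [mul_assoc, h1 (CliffordAlgebra.involute_eq_of_mem_odd hx), ← mul_assoc, e.eq, mul_assoc]

theorem mul_comm_of_parity {x y : Grassmann κ} {k l : ℕ} (hx : inv x = (-1 : ℝ) ^ k • x)
    (hy : inv y = (-1 : ℝ) ^ l • y) : x * y = (-1 : ℝ) ^ (k * l) • (y * x) := by
  rcases Nat.even_or_odd k with hk | hk
  · rw [hk.neg_one_pow, one_smul] at hx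
    rw [(hk.mul_right l).neg_one_pow, one_smul]
    exact (even_central x (mem_even_iff.mpr hx) y).eq
  · rw [hk.neg_one_pow, neg_one_smul] at hx
    rw [odd_mul hx, hy, smul_mul_assoc, pow_mul, hk.neg_one_pow]

@[elab_as_elim]
theorem induction_mul {P : Grassmann κ → Prop} (halg : ∀ r, P (algebraMap ℝ _ r))
    (hι : ∀ v x, P x → P (ExteriorAlgebra.ι ℝ v * x)) (hadd : ∀ x y, P x → P y → P (x + y))
    (x : Grassmann κ) : P x :=
  CliffordAlgebra.left_induction (0 : QuadraticForm ℝ (κ →₀ ℝ)) (P := P) halg (fun x y => hadd x y) (fun x m h => hι m x h) x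

theorem leftDeriv_algebraMap (j : κ) (r : ℝ) : leftDeriv j (algebraMap ℝ _ r) = 0 :=
  CliffordAlgebra.contractLeft_algebraMap (0 : QuadraticForm ℝ (κ →₀ ℝ)) _ r

theorem leftDeriv_ι_mul (j : κ) (v : κ →₀ ℝ) (y : Grassmann κ) :
    leftDeriv j (ExteriorAlgebra.ι ℝ v * y) = v j • y - ExteriorAlgebra.ι ℝ v * leftDeriv j y :=
  CliffordAlgebra.contractLeft_ι_mul (Q := (0 : QuadraticForm ℝ (κ →₀ ℝ))) (Finsupp.lapply j) v y

theorem leftDeriv_mul (j : κ) (x y : Grassmann κ) :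
    leftDeriv j (x * y) = leftDeriv j x * y + inv x * leftDeriv j y := by
  induction x using induction_mul generalizing y with
  | halg r =>
    rw [leftDeriv_algebraMap, inv_algebraMap, zero_mul, zero_add, ← Algebra.smul_def, map_smul,
      Algebra.smul_def]
  | hι v x hx =>
    rw [mul_assoc, leftDeriv_ι_mul, leftDeriv_ι_mul, hx, map_mul, inv_ι]
    simp only [mul_add, sub_mul, mul_assoc, smul_mul_assoc, neg_mul]
    abel
  | hadd x x' h h' => rw [add_mul, map_add, h, h', map_add, map_add, add_mul, add_mul]; abel

theorem leftDeriv_leftDeriv (j k : κ) (x : Grassmann κ) :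
    leftDeriv j (leftDeriv k x) = -leftDeriv k (leftDeriv j x) :=
  CliffordAlgebra.contractLeft_comm (Q := (0 : QuadraticForm ℝ (κ →₀ ℝ))) _ _ x

theorem inv_leftDeriv (j : κ) (x : Grassmann κ) : inv (leftDeriv j x) = -leftDeriv j (inv x) := by
  induction x using induction_mul with
  | halg r => rw [leftDeriv_algebraMap, inv_algebraMap, leftDeriv_algebraMap, map_zero, neg_zero]
  | hι v x hx =>
    rw [leftDeriv_ι_mul, map_mul, inv_ι, map_sub, map_smul, map_mul, hx, inv_ι, neg_mul, neg_mul, map_neg,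
      leftDeriv_ι_mul]
    simp
  | hadd x y hx hy => rw [map_add, map_add, hx, hy, map_add, map_add, neg_add]

theorem leftDeriv_gen [DecidableEq κ] (j k : κ) :
    leftDeriv j (gen k) = if k = j then 1 else 0 := by
  rw [← mul_one (gen k), gen, leftDeriv_ι_mul, ← map_one (algebraMap ℝ (Grassmann κ)),
    leftDeriv_algebraMap, mul_zero, sub_zero, Finsupp.single_apply, map_one]
  split_ifs <;> simp

theorem rename_ι (o : κ → κ') (v : κ →₀ ℝ) :
    rename o (ExteriorAlgebra.ι ℝ v) = ExteriorAlgebra.ι ℝ (Finsupp.mapDomain o v) :=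
  ExteriorAlgebra.map_apply_ι _ _

theorem rename_gen (o : κ → κ') (j : κ) : rename o (gen j) = gen (o j) := by
  rw [gen, rename_ι, Finsupp.mapDomain_single]
  rfl

theorem rename_id (x : Grassmann κ) : rename id x = x := by
  induction x using induction_mul with
  | halg r => exact AlgHom.commutes _ r
  | hι v x hx => rw [map_mul, hx, rename_ι, Finsupp.mapDomain_id]
  | hadd x y hx hy => rw [map_add, hx, hy]

theorem inv_rename (o : κ → κ') (x : Grassmann κ) : inv (rename o x) = rename o (inv x) := by
  induction x using induction_mul with
  | halg r => rw [AlgHom.commutes, inv_algebraMap, inv_algebraMap, AlgHom.commutes]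
  | hι v x hx => rw [map_mul, map_mul, hx, rename_ι, map_mul, map_mul, inv_ι, inv_ι, map_neg,
      rename_ι]
  | hadd x y hx hy => rw [map_add, map_add, hx, hy, map_add, map_add]

theorem leftDeriv_rename {o : κ → κ'} (ho : Function.Injective o) (j : κ) (x : Grassmann κ) :
    leftDeriv (o j) (rename o x) = rename o (leftDeriv j x) := by
  induction x using induction_mul with
  | halg r => rw [AlgHom.commutes, leftDeriv_algebraMap, leftDeriv_algebraMap, map_zero]
  | hι v x hx => rw [map_mul, rename_ι, leftDeriv_ι_mul, leftDeriv_ι_mul, hx, map_sub, map_smul,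
      map_mul, rename_ι, Finsupp.mapDomain_apply ho]
  | hadd x y hx hy => rw [map_add, map_add, hx, hy, map_add, map_add]

theorem leftDeriv_rename_of_notMem {o : κ → κ'} {k : κ'} (hk : k ∉ Set.range o)
    (x : Grassmann κ) : leftDeriv k (rename o x) = 0 := by
  induction x using induction_mul with
  | halg r => rw [AlgHom.commutes, leftDeriv_algebraMap]
  | hι v x hx => rw [map_mul, rename_ι, leftDeriv_ι_mul, hx, Finsupp.mapDomain_of_notMem_range _ _ hk,
      zero_smul, mul_zero, sub_zero]
  | hadd x y hx hy => rw [map_add, map_add, hx, hy, add_zero]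

theorem rename_injective {o : κ → κ'} (ho : Function.Injective o) :
    Function.Injective (rename o) := by
  refine ExteriorAlgebra.map_injective_field ?_
  rw [LinearMap.ker_eq_bot]
  exact Finsupp.mapDomain_injective ho

theorem body_algebraMap (r : ℝ) : body (algebraMap ℝ (Grassmann κ) r) = r :=
  AlgHom.commutes body r

theorem body_inv (x : Grassmann κ) : body (inv x) = body x := by
  induction x using induction_mul with
  | halg r => rw [inv_algebraMap]
  | hι v x hx => simp [inv_ι, body, ExteriorAlgebra.algebraMapInv]
  | hadd x y hx hy => rw [map_add, map_add, hx, hy, map_add]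

theorem body_of_odd {x : Grassmann κ} (h : inv x = -x) : body x = 0 := by
  have := body_inv x
  rw [h, map_neg] at this
  linarith

theorem coe_evenProj {x : Grassmann κ} (h : inv x = x) : (evenProj x : Grassmann κ) = x :=
  DirectSum.decompose_of_mem_same (CliffordAlgebra.evenOdd (0 : QuadraticForm ℝ (κ →₀ ℝ)))
    (mem_even_iff.mpr h)

theorem evenProj_coe (x : Even κ) : evenProj (x : Grassmann κ) = x :=
  Subtype.ext (coe_evenProj (mem_even_iff.mp x.2))

theorem inv_coe_even (x : Even κ) : inv (x : Grassmann κ) = x := mem_even_iff.mp x.2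

end Grassmann

/-! ### Superfunctions: pointwise description, parity, derivatives, substitutions. -/

namespace SuperFun

variable {ι ι' κ κ' : Type*} [Fintype ι] [Fintype κ] [Fintype ι'] [Fintype κ']
  {V V' : Opens (ι → ℝ)}

@[ext]
theorem ext {f g : SuperFun κ V} (h : ∀ x, f.1 x = g.1 x) : f = g :=
  Subtype.ext (funext h)

theorem extZ_of_notMem (f : SuperFun κ V) {x : ι → ℝ} (hx : x ∉ V) : extZ f x = 0 :=
  Function.extend_apply' _ _ _ fun ⟨y, hy⟩ => hx (hy ▸ y.2)

theorem extZ_mk (f : SuperFun κ V) {x : ι → ℝ} (hx : x ∈ V) : extZ f x = f.1 ⟨x, hx⟩ :=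
  extZ_apply f ⟨x, hx⟩

theorem extZ_mul (f g : SuperFun κ V) (x : ι → ℝ) : extZ (f * g) x = extZ f x * extZ g x := by
  by_cases hx : x ∈ V
  · rw [extZ_mk _ hx, extZ_mk _ hx, extZ_mk _ hx]
    rfl
  · rw [extZ_of_notMem _ hx, extZ_of_notMem _ hx, zero_mul]

theorem extZ_mapVal (L : Grassmann κ →ₗ[ℝ] Grassmann κ) (f : SuperFun κ V) (x : ι → ℝ) :
    extZ (mapVal L f) x = L (extZ f x) := by
  by_cases hx : x ∈ V
  · rw [extZ_mk _ hx]
    rfl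
  · rw [extZ_of_notMem _ hx, extZ_of_notMem _ hx, map_zero]

theorem val_mapVal (L : Grassmann κ →ₗ[ℝ] Grassmann κ) (f : SuperFun κ V) (x : V) :
    (mapVal L f).1 x = L (f.1 x) :=
  congrArg L (extZ_apply f x)

theorem val_inv (f : SuperFun κ V) (x : V) : (inv f).1 x = Grassmann.inv (f.1 x) :=
  val_mapVal _ f x

theorem val_res (h : V' ≤ V) (f : SuperFun κ V) (x : V') : (res h f).1 x = f.1 ⟨x, h x.2⟩ :=
  extZ_apply f ⟨x, h x.2⟩

theorem val_pull {W : Opens (ι' → ℝ)} (e : ι → ι') (o : κ → κ') (h : ∀ y ∈ W, y ∘ e ∈ V)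
    (f : SuperFun κ V) (y : W) :
    (pull e o h f).1 y = Grassmann.rename o (f.1 ⟨y.1 ∘ e, h y y.2⟩) :=
  congrArg (Grassmann.rename o) (extZ_apply f ⟨y.1 ∘ e, h y y.2⟩)

theorem inv_mul (f g : SuperFun κ V) : inv (f * g) = inv f * inv g := by
  ext x
  change _ = (inv f).1 x * (inv g).1 x
  rw [val_inv, val_inv, val_inv, ← map_mul]
  rfl

theorem inv_one : inv (1 : SuperFun κ V) = 1 := by
  ext x
  rw [val_inv]
  exact map_one _

theorem HasParity.val {f : SuperFun κ V} {k : ℕ} (h : HasParity f k) (x : V) :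
    Grassmann.inv (f.1 x) = (-1 : ℝ) ^ k • f.1 x := by
  rw [← val_inv, h]
  rfl

theorem HasParity.mul_comm {f g : SuperFun κ V} {k l : ℕ} (hf : HasParity f k)
    (hg : HasParity g l) : f * g = (-1 : ℝ) ^ (k * l) • (g * f) := by
  ext x
  exact Grassmann.mul_comm_of_parity (hf.val x) (hg.val x)

theorem HasParity.mul {f g : SuperFun κ V} {k l : ℕ} (hf : HasParity f k)
    (hg : HasParity g l) : HasParity (f * g) (k + l) := by
  rw [HasParity, inv_mul, hf, hg, smul_mul_smul_comm, pow_add]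

theorem HasParity.add {f g : SuperFun κ V} {k : ℕ} (hf : HasParity f k)
    (hg : HasParity g k) : HasParity (f + g) k := by
  rw [HasParity, map_add, hf, hg, smul_add]

theorem HasParity.smul {f : SuperFun κ V} {k : ℕ} (c : ℝ) (hf : HasParity f k) :
    HasParity (c • f) k := by
  rw [HasParity, map_smul, hf, smul_comm]

theorem HasParity.sum {α : Type*} {s : Finset α} {f : α → SuperFun κ V} {k : ℕ}
    (hf : ∀ a ∈ s, HasParity (f a) k) : HasParity (∑ a ∈ s, f a) k := by
  rw [HasParity, map_sum, Finset.smul_sum]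
  exact Finset.sum_congr rfl hf

theorem HasParity.zero (k : ℕ) : HasParity (0 : SuperFun κ V) k := by
  rw [HasParity, map_zero, smul_zero]

theorem HasParity.one : HasParity (1 : SuperFun κ V) 0 := by
  rw [HasParity, inv_one, pow_zero, one_smul]

theorem HasParity.congr {f : SuperFun κ V} {k l : ℕ} (hf : HasParity f k)
    (h : (-1 : ℝ) ^ k = (-1) ^ l) : HasParity f l := by
  rw [HasParity, hf, h]

theorem coord_parity (a : ι ⊕ κ) : HasParity (coord a : SuperFun κ V) (parity a) := by
  ext x
  rw [val_inv]
  rcases a with i | j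
  · change Grassmann.inv (algebraMap ℝ _ _) = (-1 : ℝ) ^ 0 • algebraMap ℝ (Grassmann κ) (x.1 i)
    rw [Grassmann.inv_algebraMap, pow_zero, one_smul]
  · change Grassmann.inv (Grassmann.gen j) = (-1 : ℝ) ^ 1 • Grassmann.gen j
    rw [Grassmann.inv_gen, pow_one, neg_one_smul]

section Pull

variable {W : Opens (ι' → ℝ)} {e : ι → ι'} {o : κ → κ'} (h : ∀ y ∈ W, y ∘ e ∈ V)

theorem inv_pull (f : SuperFun κ V) : inv (pull e o h f) = pull e o h (inv f) := by
  ext y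
  rw [val_inv, val_pull, val_pull, val_inv, Grassmann.inv_rename]

theorem HasParity.pull {f : SuperFun κ V} {k : ℕ} (hf : HasParity f k) :
    HasParity (pull e o h f) k := by
  rw [HasParity, inv_pull, hf, map_smul]

theorem pull_coord (a : ι ⊕ κ) : pull e o h (coord a) = coord (Sum.map e o a) := by
  ext y
  rw [val_pull]
  rcases a with i | j
  · exact AlgHom.commutes _ _
  · exact Grassmann.rename_gen o j

end Pull

/-! ### Derivatives -/

theorem differentiableAt_extZ (f : SuperFun κ V) {x : ι → ℝ} (hx : x ∈ V) :
    DifferentiableAt ℝ (extZ f) x :=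
  ((contDiffOn_extZ f).contDiffAt (V.isOpen.mem_nhds hx)).differentiableAt (by simp)

section

variable [DecidableEq ι] [DecidableEq ι']

theorem val_evenDeriv (i : ι) (f : SuperFun κ V) (x : V) :
    (evenDeriv i f).1 x = fderiv ℝ (extZ f) x (Pi.single i 1) := rfl

theorem evenDeriv_mul (i : ι) (f g : SuperFun κ V) :
    evenDeriv i (f * g) = evenDeriv i f * g + f * evenDeriv i g := by
  ext x
  have e : extZ (f * g) = fun y =>
      (LinearMap.mul ℝ (Grassmann κ)).toContinuousBilinearMap (extZ f y) (extZ g y) :=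
    funext (extZ_mul f g)
  have h := ((LinearMap.mul ℝ (Grassmann κ)).toContinuousBilinearMap).hasFDerivAt_of_bilinear
    (differentiableAt_extZ f x.2).hasFDerivAt (differentiableAt_extZ g x.2).hasFDerivAt
  rw [val_evenDeriv, e, h.fderiv]
  change extZ f x * fderiv ℝ (extZ g) x _ + fderiv ℝ (extZ f) x _ * extZ g x = _
  rw [extZ_apply, extZ_apply, add_comm]
  rfl

theorem evenDeriv_mapVal (i : ι) (L : Grassmann κ →ₗ[ℝ] Grassmann κ) (f : SuperFun κ V) :
    evenDeriv i (mapVal L f) = mapVal L (evenDeriv i f) := by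
  ext x
  have e : extZ (mapVal L f) = fun y => L.toContinuousLinearMap (extZ f y) :=
    funext (extZ_mapVal L f)
  have h := L.toContinuousLinearMap.hasFDerivAt.comp x.1
    (differentiableAt_extZ f x.2).hasFDerivAt
  rw [val_evenDeriv, e, val_mapVal]
  exact congrArg (· (Pi.single i 1)) h.fderiv

theorem evenDeriv_comm (i j : ι) (f : SuperFun κ V) :
    evenDeriv i (evenDeriv j f) = evenDeriv j (evenDeriv i f) := by
  ext x
  have hc : ContDiffAt ℝ ∞ (extZ f) x := (contDiffOn_extZ f).contDiffAt (V.isOpen.mem_nhds x.2)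
  have hd : DifferentiableAt ℝ (fderiv ℝ (extZ f)) x :=
    (hc.fderiv_right (m := 1) (WithTop.coe_le_coe.mpr le_top)).differentiableAt (by simp)
  have key : ∀ i j : ι, (evenDeriv i (evenDeriv j f)).1 x =
      fderiv ℝ (fderiv ℝ (extZ f)) x (Pi.single i 1) (Pi.single j 1) := by
    intro i j
    have he : extZ (evenDeriv j f) =ᶠ[nhds x.1] fun y => fderiv ℝ (extZ f) y (Pi.single j 1) := by
      filter_upwards [V.isOpen.mem_nhds x.2] with y hy
      exact extZ_mk _ hy
    rw [val_evenDeriv, he.fderiv_eq, fderiv_clm_apply hd (differentiableAt_const _)]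
    simp
  rw [key, key]
  exact (hc.isSymmSndFDerivAt (by simp only [minSmoothness_of_isRCLikeNormedField]; exact WithTop.coe_le_coe.mpr le_top)) _ _

/-- The sign automorphism that accompanies the derivative along the coordinate of index `a`:
the identity for an even coordinate, the parity operator for an odd one. -/
def twist (a : ι ⊕ κ) : SuperFun κ V →ₗ[ℝ] SuperFun κ V := a.elim (fun _ => .id) fun _ => inv

theorem pderiv_mul (a : ι ⊕ κ) (f g : SuperFun κ V) :
    pderiv a (f * g) = pderiv a f * g + twist a f * pderiv a g := by
  rcases a with i | j
  · exact evenDeriv_mul i f g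
  · ext x
    change (mapVal _ _).1 x = (mapVal (Grassmann.leftDeriv j) f).1 x * g.1 x +
      (inv f).1 x * (mapVal (Grassmann.leftDeriv j) g).1 x
    rw [val_mapVal, val_mapVal, val_mapVal, val_inv, ← Grassmann.leftDeriv_mul]
    rfl

theorem pderiv_pderiv (a b : ι ⊕ κ) (f : SuperFun κ V) :
    pderiv a (pderiv b f) = (-1 : ℝ) ^ (parity a * parity b) • pderiv b (pderiv a f) := by
  rcases a with i | j <;> rcases b with i' | j'
  · exact (evenDeriv_comm i i' f).trans (one_smul ℝ _).symm
  · exact (evenDeriv_mapVal i _ f).trans (one_smul ℝ _).symm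
  · exact (evenDeriv_mapVal i' _ f).symm.trans (one_smul ℝ _).symm
  · ext x
    change (mapVal _ (mapVal _ f)).1 x = (-1 : ℝ) ^ 1 • (mapVal _ (mapVal _ f)).1 x
    rw [val_mapVal, val_mapVal, val_mapVal, val_mapVal, Grassmann.leftDeriv_leftDeriv, pow_one,
      neg_one_smul]

theorem inv_pderiv (a : ι ⊕ κ) (f : SuperFun κ V) :
    inv (pderiv a f) = (-1 : ℝ) ^ parity a • pderiv a (inv f) := by
  rcases a with i | j
  · exact (evenDeriv_mapVal i _ f).symm.trans (one_smul ℝ _).symm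
  · ext x
    change (inv (mapVal _ f)).1 x = (-1 : ℝ) ^ 1 • (mapVal _ (inv f)).1 x
    rw [val_inv, val_mapVal, val_mapVal, val_inv, Grassmann.inv_leftDeriv, pow_one, neg_one_smul]

theorem HasParity.pderiv {f : SuperFun κ V} {k : ℕ} (hf : HasParity f k) (a : ι ⊕ κ) :
    HasParity (pderiv a f) (k + parity a) := by
  rw [HasParity, inv_pderiv, hf, map_smul, smul_smul, pow_add, _root_.mul_comm]

theorem pderiv_coord [DecidableEq κ] (a b : ι ⊕ κ) :
    pderiv a (coord b : SuperFun κ V) = if a = b then 1 else 0 := by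
  rcases a with i | j <;> rcases b with i' | j'
  · ext x
    have he : extZ (coord (.inl i') : SuperFun κ V) =ᶠ[nhds x.1]
        fun y => ((Algebra.linearMap ℝ (Grassmann κ)).toContinuousLinearMap.comp
          (ContinuousLinearMap.proj i')) y := by
      filter_upwards [V.isOpen.mem_nhds x.2] with y hy
      exact extZ_mk _ hy
    change fderiv ℝ (extZ (coord (.inl i') : SuperFun κ V)) x (Pi.single i 1) = _
    rw [he.fderiv_eq, ContinuousLinearMap.fderiv]
    change algebraMap ℝ (Grassmann κ) ((Pi.single i 1 : ι → ℝ) i') = _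
    rcases eq_or_ne i i' with rfl | h
    · simp
    · rw [Pi.single_eq_of_ne h.symm, map_zero, if_neg (by simpa using h)]
      rfl
  · ext x
    have he : extZ (coord (.inr j') : SuperFun κ V) =ᶠ[nhds x.1] fun _ => Grassmann.gen j' := by
      filter_upwards [V.isOpen.mem_nhds x.2] with y hy
      exact extZ_mk _ hy
    change fderiv ℝ (extZ (coord (.inr j') : SuperFun κ V)) x (Pi.single i 1) = _
    rw [he.fderiv_eq]
    simp
  · ext x
    change (mapVal _ _).1 x = _
    rw [val_mapVal]
    change Grassmann.leftDeriv j (algebraMap ℝ (Grassmann κ) (x.1 i')) = _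
    rw [Grassmann.leftDeriv_algebraMap]
    simp
  · ext x
    change (mapVal _ _).1 x = _
    rw [val_mapVal]
    change Grassmann.leftDeriv j (Grassmann.gen j') = _
    rw [Grassmann.leftDeriv_gen]
    rcases eq_or_ne j j' with rfl | h
    · simp
    · rw [if_neg h.symm, if_neg (by simpa using h)]
      rfl

/-- A derivative over an open set depends only on the function over this set. -/
theorem pderiv_congr (a : ι ⊕ κ) {f g : SuperFun κ V} {U : Set (ι → ℝ)} (hU : IsOpen U)
    (h : ∀ x : V, x.1 ∈ U → f.1 x = g.1 x) (x : V) (hx : x.1 ∈ U) :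
    (pderiv a f).1 x = (pderiv a g).1 x := by
  rcases a with i | j
  · have he : extZ f =ᶠ[nhds x.1] extZ g := by
      filter_upwards [hU.mem_nhds hx] with y hy
      by_cases hV : y ∈ V
      · rw [extZ_mk _ hV, extZ_mk _ hV, h _ hy]
      · rw [extZ_of_notMem _ hV, extZ_of_notMem _ hV]
    change fderiv ℝ (extZ f) x _ = fderiv ℝ (extZ g) x _
    rw [he.fderiv_eq]
  · change (mapVal _ f).1 x = (mapVal _ g).1 x
    rw [val_mapVal, val_mapVal, h x hx]

theorem pderiv_res (a : ι ⊕ κ) (h : V' ≤ V) (f : SuperFun κ V) :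
    pderiv a (res h f) = res h (pderiv a f) := by
  ext x
  rw [val_res]
  rcases a with i | j
  · have he : extZ (res h f) =ᶠ[nhds x.1] extZ f := by
      filter_upwards [V'.isOpen.mem_nhds x.2] with y hy
      rw [extZ_mk _ hy, extZ_mk _ (h hy), val_res]
    change fderiv ℝ (extZ (res h f)) x _ = fderiv ℝ (extZ f) x _
    rw [he.fderiv_eq]
  · change (mapVal _ _).1 x = (mapVal _ _).1 _
    rw [val_mapVal, val_mapVal, val_res]

/-! ### Substitution of coordinates -/

section Pull

variable {W : Opens (ι' → ℝ)} {e : ι → ι'} {o : κ → κ'} (h : ∀ y ∈ W, y ∘ e ∈ V)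

theorem val_evenDeriv_pull (i' : ι') (f : SuperFun κ V) (y : W) :
    (evenDeriv i' (pull e o h f)).1 y = Grassmann.rename o
      (fderiv ℝ (extZ f) (y.1 ∘ e) ((Pi.single i' 1 : ι' → ℝ) ∘ e)) := by
  have he : extZ (pull e o h f) =ᶠ[nhds y.1] fun z =>
      (Grassmann.rename (κ := κ) o).toLinearMap.toContinuousLinearMap
        (extZ f ((ContinuousLinearMap.pi fun i => ContinuousLinearMap.proj (R := ℝ)
          (φ := fun _ => ℝ) (e i)) z)) := by
    filter_upwards [W.isOpen.mem_nhds y.2] with z hz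
    exact extZ_mk _ hz
  have hf : DifferentiableAt ℝ (extZ f) (y.1 ∘ e) := differentiableAt_extZ f (h _ y.2)
  let E : (ι' → ℝ) →L[ℝ] (ι → ℝ) := ContinuousLinearMap.pi fun i => ContinuousLinearMap.proj
    (R := ℝ) (φ := fun _ => ℝ) (e i)
  have hf' : HasFDerivAt (extZ f) (fderiv ℝ (extZ f) (y.1 ∘ e)) (E y) := hf.hasFDerivAt
  have hc := ((Grassmann.rename (κ := κ) o).toLinearMap.toContinuousLinearMap).hasFDerivAt.comp y.1
    (hf'.comp y.1 E.hasFDerivAt)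
  rw [val_evenDeriv, he.fderiv_eq]
  exact congrArg (· (Pi.single i' 1)) hc.fderiv

theorem pderiv_pull (he : Function.Injective e) (ho : Function.Injective o) (a : ι ⊕ κ)
    (f : SuperFun κ V) :
    pderiv (Sum.map e o a) (pull e o h f) = pull e o h (pderiv a f) := by
  ext y
  rw [val_pull]
  rcases a with i | j
  · refine (val_evenDeriv_pull h _ f y).trans ?_
    congr 2
    ext k
    simp [Pi.single_apply, he.eq_iff]
  · change (mapVal _ _).1 _ = Grassmann.rename o ((mapVal _ _).1 _)
    rw [val_mapVal, val_mapVal, val_pull, Grassmann.leftDeriv_rename ho]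

theorem pderiv_pull_of_notMem (a : ι' ⊕ κ') (ha : a ∉ Set.range (Sum.map e o))
    (f : SuperFun κ V) : pderiv a (pull e o h f) = 0 := by
  ext y
  rcases a with i | j
  · refine (val_evenDeriv_pull h _ f y).trans ?_
    have : (Pi.single i 1 : ι' → ℝ) ∘ e = 0 := by
      ext k
      have : e k ≠ i := fun hk => ha ⟨.inl k, congrArg Sum.inl hk⟩
      simp [this]
    rw [this, map_zero, map_zero]
    rfl
  · change (mapVal _ _).1 _ = _
    rw [val_mapVal, val_pull, Grassmann.leftDeriv_rename_of_notMem]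
    · rfl
    · rintro ⟨k, hk⟩
      exact ha ⟨.inr k, congrArg Sum.inr hk⟩

end Pull

end

end SuperFun

namespace SuperFun

/-! ### The Poisson bracket on the cotangent bundle -/

section Poisson

variable {ι κ : Type*}

/-- The coordinate on the cotangent bundle conjugate to a given one. -/
def conj (A : (ι ⊕ ι) ⊕ (κ ⊕ κ)) : (ι ⊕ ι) ⊕ (κ ⊕ κ) := Sum.map Sum.swap Sum.swap A

/-- The constant coefficients of the Poisson bracket. -/
def poissonSign : (ι ⊕ ι) ⊕ (κ ⊕ κ) → ℝ
  | .inl (.inl _) => 1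
  | .inl (.inr _) => -1
  | .inr _ => 1

theorem conj_conj (A : (ι ⊕ ι) ⊕ (κ ⊕ κ)) : conj (conj A) = A := by
  rcases A with (i | i) | (j | j) <;> rfl

theorem parity_conj (A : (ι ⊕ ι) ⊕ (κ ⊕ κ)) : parity (conj A) = parity A := by
  rcases A with (i | i) | (j | j) <;> rfl

/-- The coefficients are antisymmetric in the even directions and symmetric in the odd ones;
together with reindexing by `conj` this yields the antisymmetry of the bracket. -/
theorem poissonSign_conj (A : (ι ⊕ ι) ⊕ (κ ⊕ κ)) :
    poissonSign (conj A) = -(-1 : ℝ) ^ parity A * poissonSign A := by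
  rcases A with (i | i) | (j | j) <;> simp [conj, poissonSign, parity]

variable [Fintype ι] [Fintype κ] {V : Opens (ι → ℝ)}

theorem sum_conj {E : Type*} [AddCommMonoid E] (f : (ι ⊕ ι) ⊕ (κ ⊕ κ) → E) :
    ∑ A, f (conj A) = ∑ A, f A :=
  Equiv.sum_comp (⟨conj, conj, conj_conj, conj_conj⟩ : Equiv.Perm ((ι ⊕ ι) ⊕ (κ ⊕ κ))) f

theorem twist_of_parity {f : SuperFun κ V} {k : ℕ} (hf : HasParity f k) (a : ι ⊕ κ) :
    twist a f = (-1 : ℝ) ^ (k * parity a) • f := by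
  rcases a with i | j
  · exact (one_smul ℝ f).symm
  · change inv f = (-1 : ℝ) ^ (k * 1) • f
    rw [hf, mul_one]

theorem HasParity.twist {f : SuperFun κ V} {k : ℕ} (hf : HasParity f k) (a : ι ⊕ κ) :
    HasParity (twist a f) k := by
  rw [twist_of_parity hf]
  exact hf.smul _

variable [DecidableEq ι] {F G : SuperFun (κ ⊕ κ) (cot V)} {k l m : ℕ}

/-- Positions and momenta, even and odd, are put on one footing: a single sum with constant
coefficients over all coordinates of the cotangent bundle. The bracket axioms then reduce to checks
of one summand, by cases on the parity of the index. -/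
theorem poisson_eq_sum (F G : SuperFun (κ ⊕ κ) (cot V)) :
    poisson F G = ∑ A, poissonSign A • (twist A (pderiv (conj A) F) * pderiv A G) := by
  simp only [poisson, Fintype.sum_sum_type, poissonSign, one_smul, neg_one_smul,
    Finset.sum_add_distrib, Finset.sum_neg_distrib, sub_eq_add_neg]
  rfl

theorem poisson_of_parity (hF : HasParity F k) (G : SuperFun (κ ⊕ κ) (cot V)) :
    poisson F G = ∑ A, (poissonSign A * (-1 : ℝ) ^ ((k + parity A) * parity A)) •
      (pderiv (conj A) F * pderiv A G) := by
  rw [poisson_eq_sum]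
  refine Finset.sum_congr rfl fun A _ => ?_
  have h := hF.pderiv (conj A)
  rw [parity_conj] at h
  rw [twist_of_parity h, smul_mul_assoc, smul_smul]

theorem poisson_add_left (F F' G : SuperFun (κ ⊕ κ) (cot V)) :
    poisson (F + F') G = poisson F G + poisson F' G := by
  simp only [poisson_eq_sum, map_add, add_mul, smul_add, Finset.sum_add_distrib]

theorem poisson_add_right (F G G' : SuperFun (κ ⊕ κ) (cot V)) :
    poisson F (G + G') = poisson F G + poisson F G' := by
  simp only [poisson_eq_sum, map_add, mul_add, smul_add, Finset.sum_add_distrib]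

theorem poisson_smul_left (c : ℝ) (F G : SuperFun (κ ⊕ κ) (cot V)) :
    poisson (c • F) G = c • poisson F G := by
  simp only [poisson_eq_sum, map_smul, smul_mul_assoc, Finset.smul_sum, smul_comm c]

theorem poisson_smul_right (c : ℝ) (F G : SuperFun (κ ⊕ κ) (cot V)) :
    poisson F (c • G) = c • poisson F G := by
  simp only [poisson_eq_sum, map_smul, mul_smul_comm, Finset.smul_sum, smul_comm c]

theorem poisson_zero_left (G : SuperFun (κ ⊕ κ) (cot V)) : poisson 0 G = 0 := by
  simpa using poisson_smul_left 0 0 G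

theorem poisson_zero_right (F : SuperFun (κ ⊕ κ) (cot V)) : poisson F 0 = 0 := by
  simpa using poisson_smul_right 0 F 0

theorem HasParity.poisson (hF : HasParity F k) (hG : HasParity G l) :
    HasParity (poisson F G) (k + l) := by
  rw [poisson_eq_sum]
  refine HasParity.sum fun A _ => ((((hF.pderiv (conj A)).twist A).mul (hG.pderiv A)).smul _).congr
    ?_
  rw [parity_conj]
  rcases A with i | j <;> simp [parity, pow_add]

theorem poisson_swap (hF : HasParity F k) (hG : HasParity G l) :
    poisson F G = -(-1 : ℝ) ^ (k * l) • poisson G F := by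
  rw [poisson_of_parity hF, poisson_of_parity hG, ← sum_conj, Finset.smul_sum]
  refine Finset.sum_congr rfl fun A _ => ?_
  have h1 := hF.pderiv (conj (conj A))
  have h2 := hG.pderiv (conj A)
  rw [parity_conj] at h1 h2
  rw [parity_conj] at h1
  rw [h1.mul_comm h2, parity_conj, poissonSign_conj, conj_conj, smul_smul, smul_smul]
  congr 1
  rcases A with i | j
  · simp [parity, pow_mul, mul_comm]
  · simp only [parity]
    rcases neg_one_pow_eq_or ℝ k with hk | hk <;> rcases neg_one_pow_eq_or ℝ l with hl | hl <;>
      simp [pow_add, pow_mul, hk, hl]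

theorem poisson_mul_right (hF : HasParity F k) (hG : HasParity G l)
    (H : SuperFun (κ ⊕ κ) (cot V)) :
    poisson F (G * H) = poisson F G * H + (-1 : ℝ) ^ (k * l) • (G * poisson F H) := by
  simp only [poisson_of_parity hF, Finset.sum_mul, Finset.mul_sum, Finset.smul_sum,
    ← Finset.sum_add_distrib]
  refine Finset.sum_congr rfl fun A _ => ?_
  have h1 := hF.pderiv (conj A)
  rw [parity_conj] at h1
  rw [pderiv_mul, twist_of_parity hG, mul_add, smul_add, smul_mul_assoc, ← mul_assoc, smul_mul_assoc]
  congr 1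
  rw [mul_smul_comm, mul_smul_comm, ← mul_assoc, h1.mul_comm hG, ← mul_assoc]
  simp only [smul_mul_assoc, smul_smul]
  congr 1
  rcases A with i | j
  · simp [parity, mul_comm]
  · simp only [parity]
    rcases neg_one_pow_eq_or ℝ k with hk | hk <;> rcases neg_one_pow_eq_or ℝ l with hl | hl <;>
      simp [pow_add, pow_mul, hk, hl]

/-- The coefficients of the bracket are constant and partial derivatives commute up to sign, so each
partial derivative acts on the bracket as a derivation. -/
theorem pderiv_poisson (hF : HasParity F k) (G : SuperFun (κ ⊕ κ) (cot V))
    (B : (ι ⊕ ι) ⊕ (κ ⊕ κ)) :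
    pderiv B (poisson F G) =
      poisson (pderiv B F) G + (-1 : ℝ) ^ (k * parity B) • poisson F (pderiv B G) := by
  simp only [poisson_of_parity hF, poisson_of_parity (hF.pderiv B), map_sum, Finset.smul_sum,
    ← Finset.sum_add_distrib]
  refine Finset.sum_congr rfl fun A _ => ?_
  have h1 := hF.pderiv (conj A)
  rw [parity_conj] at h1
  rw [map_smul, pderiv_mul, twist_of_parity h1, pderiv_pderiv B (conj A), pderiv_pderiv B A,
    smul_add]
  simp only [smul_mul_assoc, mul_smul_comm, smul_smul, parity_conj]
  congr 2
  · rcases A with i | j <;> rcases B with i' | j' <;> simp [parity, pow_add]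
  · rcases A with i | j <;> rcases B with i' | j' <;>
      simp [parity, pow_add, mul_comm]

/-- The Jacobi identity for the canonical even Poisson bracket. -/
theorem poisson_jacobi (hF : HasParity F k) (hG : HasParity G l)
    (H : SuperFun (κ ⊕ κ) (cot V)) :
    poisson F (poisson G H) =
      poisson (poisson F G) H + (-1 : ℝ) ^ (k * l) • poisson G (poisson F H) := by
  -- The coefficients of the Hamiltonian vector fields: (F, ·) = ∑ c_A ∂_A and (G, ·) = ∑ d_A ∂_A.
  -- In the iterated brackets the second-order terms agree up to the sign (-1)^{kl}, so only
  -- first-order terms remain.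
  let c : (ι ⊕ ι) ⊕ (κ ⊕ κ) → SuperFun (κ ⊕ κ) (cot V) := fun A =>
    poissonSign A • twist A (pderiv (conj A) F)
  let d : (ι ⊕ ι) ⊕ (κ ⊕ κ) → SuperFun (κ ⊕ κ) (cot V) := fun A =>
    poissonSign A • twist A (pderiv (conj A) G)
  have hc : ∀ A, HasParity (c A) (k + parity A) := fun A => by
    have h := ((hF.pderiv (conj A)).twist A).smul (poissonSign A)
    rwa [parity_conj] at h
  have hd : ∀ A, HasParity (d A) (l + parity A) := fun A => by
    have h := ((hG.pderiv (conj A)).twist A).smul (poissonSign A)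
    rwa [parity_conj] at h
  have eF : ∀ K, poisson F K = ∑ A, c A * pderiv A K := fun K => by
    rw [poisson_eq_sum]
    exact Finset.sum_congr rfl fun A _ => (smul_mul_assoc _ _ _).symm
  have eG : ∀ K, poisson G K = ∑ A, d A * pderiv A K := fun K => by
    rw [poisson_eq_sum]
    exact Finset.sum_congr rfl fun A _ => (smul_mul_assoc _ _ _).symm
  have sumR : ∀ (K : SuperFun (κ ⊕ κ) (cot V))
      (f : (ι ⊕ ι) ⊕ (κ ⊕ κ) → SuperFun (κ ⊕ κ) (cot V)),
      poisson K (∑ A, f A) = ∑ A, poisson K (f A) := fun K f =>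
    map_sum (AddMonoidHom.mk' (poisson K) (poisson_add_right K)) f Finset.univ
  have e1 : poisson F (poisson G H) = ∑ B, poisson F (d B) * pderiv B H +
      ∑ A, ∑ B, (-1 : ℝ) ^ (k * (l + parity B)) • (d B * (c A * pderiv A (pderiv B H))) := by
    rw [eG H, sumR, Finset.sum_comm, ← Finset.sum_add_distrib]
    refine Finset.sum_congr rfl fun B _ => ?_
    rw [poisson_mul_right hF (hd B), eF (pderiv B H), Finset.mul_sum, Finset.smul_sum]
  have e2 : poisson G (poisson F H) = ∑ B, poisson G (c B) * pderiv B H +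
      ∑ A, ∑ B, (-1 : ℝ) ^ (l * (k + parity A)) • (c A * (d B * pderiv B (pderiv A H))) := by
    rw [eF H, sumR, ← Finset.sum_add_distrib]
    refine Finset.sum_congr rfl fun A _ => ?_
    rw [poisson_mul_right hG (hc A), eG (pderiv A H), Finset.mul_sum, Finset.smul_sum]
  -- The first-order part: by `pderiv_poisson`, the vector field of (F, G) has the coefficients (F,
  -- d_B) - (-1)^{kl} (G, c_B).
  have e3 : poisson (poisson F G) H = ∑ B, poisson F (d B) * pderiv B H -
      (-1 : ℝ) ^ (k * l) • ∑ B, poisson G (c B) * pderiv B H := by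
    rw [poisson_eq_sum, Finset.smul_sum, ← Finset.sum_sub_distrib]
    refine Finset.sum_congr rfl fun B _ => ?_
    rw [← smul_mul_assoc, ← smul_mul_assoc, ← sub_mul]
    congr 1
    have hFB := hF.pderiv (conj B)
    have hGB := hG.pderiv (conj B)
    have hP := (hF.poisson hG).pderiv (conj B)
    rw [parity_conj] at hFB hGB hP
    rw [poisson_swap hG (hc B)]
    simp only [c, d]
    rw [twist_of_parity hFB, twist_of_parity hGB, twist_of_parity hP, pderiv_poisson hF]
    simp only [poisson_smul_left, poisson_smul_right, smul_add, smul_smul, parity_conj]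
    rw [add_comm, sub_eq_add_neg, ← neg_smul]
    congr 2
    · rcases B with i | j <;> simp only [parity]
      · simp
      · rcases neg_one_pow_eq_or ℝ k with hk | hk <;> rcases neg_one_pow_eq_or ℝ l with hl | hl <;>
          simp [pow_add, hk, hl]
    · rcases B with i | j <;> simp only [parity]
      · rcases neg_one_pow_eq_or ℝ k with hk | hk <;> rcases neg_one_pow_eq_or ℝ l with hl | hl <;>
          simp [pow_mul, hk, hl]
      · rcases neg_one_pow_eq_or ℝ k with hk | hk <;> rcases neg_one_pow_eq_or ℝ l with hl | hl <;>
          simp [pow_add, pow_mul, hk, hl]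
  rw [e1, e2, e3, smul_add, ← add_assoc, sub_add_cancel, Finset.smul_sum]
  congr 1
  refine Finset.sum_congr rfl fun A _ => ?_
  rw [Finset.smul_sum]
  refine Finset.sum_congr rfl fun B _ => ?_
  rw [← mul_assoc, ← mul_assoc, (hc A).mul_comm (hd B), pderiv_pderiv B A]
  simp only [smul_mul_assoc, mul_smul_comm, smul_smul]
  congr 1
  rcases A with i | j <;> rcases B with i' | j' <;> simp only [parity] <;>
    rcases neg_one_pow_eq_or ℝ k with hk | hk <;> rcases neg_one_pow_eq_or ℝ l with hl | hl <;>
    simp [pow_add, pow_mul, hk, hl]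

/-! ### Derived brackets -/

variable {Θ a b c : SuperFun (κ ⊕ κ) (cot V)}

/-- In the Jacobi identity for Θ, a, b the term (Θ, (a, b)) drops out; interchanging a and (Θ, b) in
what is left gives the other order of the derived bracket. -/
theorem derived_symm (hΘ : HasParity Θ 1) (ha : HasParity a k) (hb : HasParity b l)
    (hab : poisson a b = 0) :
    poisson (poisson Θ a) b = (-1 : ℝ) ^ (k * l) • poisson (poisson Θ b) a := by
  have h := poisson_jacobi hΘ ha b
  rw [hab, poisson_zero_right, poisson_swap ha (hΘ.poisson hb), smul_smul] at h
  rw [eq_neg_of_add_eq_zero_left h.symm, ← neg_smul]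
  congr 1
  rcases neg_one_pow_eq_or ℝ k with hk | hk <;> rcases neg_one_pow_eq_or ℝ l with hl | hl <;>
    simp [pow_add, pow_mul, hk, hl]

/-- The Jacobiator of the derived bracket `((Θ, a), b)` of an odd Hamiltonian `Θ` is the ternary
derived bracket of `(Θ, Θ) / 2`. -/
theorem derived_jacobiator (hΘ : HasParity Θ 1) (ha : HasParity a k) (hb : HasParity b l)
    (hc : HasParity c m) (hac : poisson a c = 0)
    (h1 : poisson a (poisson (poisson Θ b) c) = 0) (h2 : poisson b (poisson (poisson Θ a) c) = 0) :
    (-1 : ℝ) ^ (k * m) • poisson (poisson Θ (poisson (poisson Θ a) b)) c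
      + (-1 : ℝ) ^ (m * l) • poisson (poisson Θ (poisson (poisson Θ c) a)) b
      + (-1 : ℝ) ^ (l * k) • poisson (poisson Θ (poisson (poisson Θ b) c)) a
      = ((-1 : ℝ) ^ (k * m) / 2) • poisson (poisson (poisson (poisson Θ Θ) a) b) c := by
  have hDa := hΘ.poisson ha
  have hDb := hΘ.poisson hb
  -- For odd Θ the operator (Θ, ·) squares to ½ ((Θ, Θ), ·).
  have e1 : poisson (poisson Θ Θ) a = (2 : ℝ) • poisson Θ (poisson Θ a) := by
    have h := poisson_jacobi hΘ hΘ a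
    rw [mul_one, pow_one, neg_one_smul, ← sub_eq_add_neg, eq_sub_iff_add_eq] at h
    rw [← h, two_smul]
  -- Expanding (Θ, ((Θ, a), b)) leaves, besides the square of (Θ, ·), the bracket of (Θ, a) with (Θ,
  -- b). By `e3`, and by the symmetries `e4`, `e5`, `e6`, its bracket with c is a combination of the
  -- two other cyclic terms and cancels them.
  have e2 := poisson_jacobi hΘ hDa b
  have e3 := poisson_jacobi hDa hDb c
  have e4 := derived_symm hΘ ha ((hDb.poisson hc)) h1
  have e5 := derived_symm hΘ hb ((hDa.poisson hc)) h2
  have e6 := derived_symm hΘ ha hc hac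
  rw [e4, e5, e6] at e3
  rw [e2, e1]
  simp only [poisson_add_left, poisson_smul_left]
  rw [eq_sub_of_add_eq e3.symm]
  simp only [poisson_smul_left, poisson_smul_right, smul_add, smul_sub, smul_smul]
  rw [div_mul_cancel₀ _ (two_ne_zero), add_assoc, add_assoc, add_eq_left]
  set X := poisson (poisson Θ (poisson (poisson Θ b) c)) a
  set Y := poisson (poisson Θ (poisson (poisson Θ c) a)) b
  rw [sub_add_eq_add_sub, sub_eq_zero, ← add_assoc]
  have s1 : (-1 : ℝ) ^ (k * m) * ((-1) ^ (1 * (1 + k)) * (-1) ^ (k * (1 + l + m))) =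
      -(-1) ^ (l * k) := by
    rcases neg_one_pow_eq_or ℝ k with hk | hk <;> rcases neg_one_pow_eq_or ℝ l with hl | hl <;>
    rcases neg_one_pow_eq_or ℝ m with hm | hm <;> simp [pow_add, pow_mul, hk, hl, hm]
  have s2 : (-1 : ℝ) ^ (k * m) * ((-1) ^ (1 * (1 + k)) * ((-1) ^ ((1 + k) * (1 + l)) *
      ((-1) ^ (l * (1 + k + m)) * (-1) ^ (k * m)))) = (-1) ^ (m * l) := by
    rcases neg_one_pow_eq_or ℝ k with hk | hk <;> rcases neg_one_pow_eq_or ℝ l with hl | hl <;>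
    rcases neg_one_pow_eq_or ℝ m with hm | hm <;> simp [pow_add, pow_mul, hk, hl, hm]
  simp only [← mul_assoc] at s1 s2 ⊢
  rw [s1, s2, neg_smul]
  abel

/-! ### Momentum-free functions -/

theorem pderiv_mom_toCot (a : ι ⊕ κ) (f : SuperFun κ V) :
    pderiv (Sum.map Sum.inr Sum.inr a) (toCot f) = 0 := by
  refine pderiv_pull_of_notMem _ _ ?_ f
  rintro ⟨b, hb⟩
  rcases a with i | j <;> rcases b with i' | j' <;> simp at hb

theorem pderiv_toCot (a : ι ⊕ κ) (f : SuperFun κ V) :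
    pderiv (Sum.map Sum.inl Sum.inl a) (toCot f) = toCot (pderiv a f) :=
  pderiv_pull _ Sum.inl_injective Sum.inl_injective a f

theorem poisson_toCot_toCot (f g : SuperFun κ V) : poisson (toCot f) (toCot g) = 0 := by
  have h1 := fun i => pderiv_mom_toCot (V := V) (κ := κ) (.inl i)
  have h2 := fun j => pderiv_mom_toCot (V := V) (κ := κ) (.inr j)
  simp only [Sum.map_inl, Sum.map_inr] at h1 h2
  simp [poisson, h1, h2]

end Poisson

end SuperFun

namespace SuperFun

theorem val_toCot {ι κ : Type*} [Fintype ι] [Fintype κ] {V : Opens (ι → ℝ)} (f : SuperFun κ V)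
    (y : cot V) : (toCot f).1 y = Grassmann.rename Sum.inl (f.1 ⟨y.1 ∘ Sum.inl, y.2⟩) :=
  val_pull _ _ _ f y

/-! ### Homogeneity in the momenta -/

section Euler

variable {ι κ : Type*} [Fintype ι] [Fintype κ] {V : Opens (ι → ℝ)}

/-- The sign in the Leibniz rule for ∂/∂p_a is the sign of moving p_a across f. Thus p_a ∂/∂p_a, and
with it the Euler operator, is a derivation without signs. -/
theorem coord_mul_twist (a : ι ⊕ κ) (f : SuperFun κ V) : coord a * twist a f = f * coord a := by
  ext x
  rcases a with i | j
  · exact Algebra.commutes (A := Grassmann κ) (x.1 i) (f.1 x)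
  · change Grassmann.gen j * (inv f).1 x = f.1 x * Grassmann.gen j
    rw [val_inv, Grassmann.odd_mul (Grassmann.inv_gen j), Grassmann.inv_inv]

variable [DecidableEq ι]

/-- The Euler operator `∑_a p_a ∂/∂p_a` on the cotangent bundle. -/
def euler : SuperFun (κ ⊕ κ) (cot V) →ₗ[ℝ] SuperFun (κ ⊕ κ) (cot V) :=
  ∑ a : ι ⊕ κ, LinearMap.mulLeft ℝ (mom a) ∘ₗ pderiv (Sum.map Sum.inr Sum.inr a)

theorem euler_apply (F : SuperFun (κ ⊕ κ) (cot V)) :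
    euler F = ∑ a : ι ⊕ κ, mom a * pderiv (Sum.map Sum.inr Sum.inr a) F := by
  rw [euler, LinearMap.sum_apply]
  rfl

theorem euler_mul (F G : SuperFun (κ ⊕ κ) (cot V)) : euler (F * G) = euler F * G + F * euler G := by
  simp only [euler_apply, Finset.sum_mul, Finset.mul_sum, ← Finset.sum_add_distrib]
  refine Finset.sum_congr rfl fun a _ => ?_
  rw [pderiv_mul, mul_add, ← mul_assoc, ← mul_assoc, mom, coord_mul_twist, mul_assoc F]

/-- Homogeneous of degree `n` in the momenta. -/
def IsHomogeneous (F : SuperFun (κ ⊕ κ) (cot V)) (n : ℝ) : Prop := euler F = n • F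

namespace IsHomogeneous

variable {F G : SuperFun (κ ⊕ κ) (cot V)} {n m : ℝ}

theorem mul (hF : IsHomogeneous F n) (hG : IsHomogeneous G m) : IsHomogeneous (F * G) (n + m) := by
  rw [IsHomogeneous, euler_mul, hF, hG, add_smul, smul_mul_assoc, mul_smul_comm]

theorem add (hF : IsHomogeneous F n) (hG : IsHomogeneous G n) : IsHomogeneous (F + G) n := by
  rw [IsHomogeneous, map_add, hF, hG, smul_add]

theorem smul (c : ℝ) (hF : IsHomogeneous F n) : IsHomogeneous (c • F) n := by
  rw [IsHomogeneous, map_smul, hF, smul_comm]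

theorem sum {α : Type*} {s : Finset α} {F : α → SuperFun (κ ⊕ κ) (cot V)}
    (hF : ∀ a ∈ s, IsHomogeneous (F a) n) : IsHomogeneous (∑ a ∈ s, F a) n := by
  rw [IsHomogeneous, map_sum, Finset.smul_sum]
  exact Finset.sum_congr rfl hF

theorem congr (hF : IsHomogeneous F n) (h : n = m) : IsHomogeneous F m := h ▸ hF

theorem toCot (f : SuperFun κ V) : IsHomogeneous (toCot f) 0 := by
  rw [IsHomogeneous, euler_apply, zero_smul]
  refine Finset.sum_eq_zero fun a _ => ?_
  rw [pderiv_mom_toCot, mul_zero]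

theorem mom (a : ι ⊕ κ) : IsHomogeneous (mom a : SuperFun (κ ⊕ κ) (cot V)) 1 := by
  classical
  rw [IsHomogeneous, euler_apply, one_smul, Finset.sum_eq_single a]
  · rw [SuperFun.mom, pderiv_coord, if_pos rfl, mul_one]
  · intro b _ hb
    rw [SuperFun.mom, SuperFun.mom, pderiv_coord, if_neg, mul_zero]
    exact fun h => hb ((Sum.map_injective.mpr ⟨Sum.inr_injective, Sum.inr_injective⟩) h)
  · exact fun h => (h (Finset.mem_univ a)).elim

theorem inv (hF : IsHomogeneous F n) : IsHomogeneous (inv F) n := by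
  have h : euler (SuperFun.inv F) = SuperFun.inv (euler F) := by
    rw [euler_apply, euler_apply, map_sum]
    refine Finset.sum_congr rfl fun a _ => ?_
    rw [inv_mul, inv_pderiv, SuperFun.mom, coord_parity, smul_mul_smul_comm, ← pow_add, ← two_mul]
    have : parity (Sum.map Sum.inr Sum.inr a : (ι ⊕ ι) ⊕ (κ ⊕ κ)) = parity a := by
      rcases a with i | j <;> rfl
    rw [this, pow_mul, neg_one_sq, one_pow, one_smul]
  rw [IsHomogeneous, h, hF, map_smul]

theorem twist (hF : IsHomogeneous F n) (A : (ι ⊕ ι) ⊕ (κ ⊕ κ)) :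
    IsHomogeneous (SuperFun.twist A F) n := by
  rcases A with i | j
  · exact hF
  · exact hF.inv

theorem mul_pderiv_pderiv (a A : (ι ⊕ ι) ⊕ (κ ⊕ κ)) :
    SuperFun.twist A (coord a) * pderiv A (pderiv a F) = coord a * pderiv a (pderiv A F) := by
  rw [twist_of_parity (coord_parity a), pderiv_pderiv A a, smul_mul_assoc, mul_smul_comm, smul_smul,
    mul_comm (parity A), ← pow_add, ← two_mul, pow_mul, neg_one_sq, one_pow, one_smul]

theorem pderiv_euler (A : (ι ⊕ ι) ⊕ (κ ⊕ κ)) : pderiv A (euler F) =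
    ∑ a : ι ⊕ κ, pderiv A (SuperFun.mom a) * pderiv (Sum.map Sum.inr Sum.inr a) F
      + euler (pderiv A F) := by
  rw [euler_apply, euler_apply, map_sum, ← Finset.sum_add_distrib]
  refine Finset.sum_congr rfl fun a _ => ?_
  rw [pderiv_mul, SuperFun.mom, mul_pderiv_pderiv]

theorem pderiv_pos (hF : IsHomogeneous F n) (a : ι ⊕ κ) :
    IsHomogeneous (pderiv (Sum.map Sum.inl Sum.inl a) F) n := by
  classical
  have h := pderiv_euler (F := F) (Sum.map Sum.inl Sum.inl a)
  rw [hF, map_smul, Finset.sum_eq_zero, zero_add] at h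
  · exact h.symm
  · intro b _
    rw [SuperFun.mom, pderiv_coord, if_neg, zero_mul]
    rcases a with i | j <;> rcases b with i' | j' <;> simp

theorem pderiv_mom (hF : IsHomogeneous F n) (a : ι ⊕ κ) :
    IsHomogeneous (pderiv (Sum.map Sum.inr Sum.inr a) F) (n - 1) := by
  classical
  have h := pderiv_euler (F := F) (Sum.map Sum.inr Sum.inr a)
  rw [hF, map_smul, Finset.sum_eq_single a] at h
  · rw [SuperFun.mom, pderiv_coord, if_pos rfl, one_mul] at h
    rw [IsHomogeneous, sub_smul, one_smul, h, add_sub_cancel_left]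
  · intro b _ hb
    rw [SuperFun.mom, pderiv_coord, if_neg, zero_mul]
    exact fun h => hb ((Sum.map_injective.mpr ⟨Sum.inr_injective, Sum.inr_injective⟩) h).symm
  · exact fun h => (h (Finset.mem_univ a)).elim

theorem poisson (hF : IsHomogeneous F n) (hG : IsHomogeneous G m) :
    IsHomogeneous (poisson F G) (n + m - 1) := by
  rw [poisson_eq_sum]
  refine IsHomogeneous.sum fun A _ => IsHomogeneous.smul _ ?_
  rcases A with (i | i) | (j | j)
  · exact (((hF.pderiv_mom (.inl i)).twist _).mul (hG.pderiv_pos (.inl i))).congr (by ring)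
  · exact (((hF.pderiv_pos (.inl i)).twist _).mul (hG.pderiv_mom (.inl i))).congr (by ring)
  · exact (((hF.pderiv_mom (.inr j)).twist _).mul (hG.pderiv_pos (.inr j))).congr (by ring)
  · exact (((hF.pderiv_pos (.inr j)).twist _).mul (hG.pderiv_mom (.inr j))).congr (by ring)

/-- Euler's identity n F = ∑ p_a ∂F/∂p_a, read at a single point. -/
theorem val_eq_zero (hF : IsHomogeneous F n) (hn : n ≠ 0) (y : cot V)
    (h : ∀ a, (pderiv (Sum.map Sum.inr Sum.inr a) F).1 y = 0) : F.1 y = 0 := by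
  have e : (euler F).1 y = n • F.1 y := by
    rw [hF]
    rfl
  have e' : (euler F).1 y = 0 := by
    rw [euler_apply, AddSubmonoidClass.coe_finsetSum, Finset.sum_apply]
    refine Finset.sum_eq_zero fun a _ => ?_
    change _ * (pderiv _ F).1 y = 0
    rw [h, mul_zero]
  rw [e'] at e
  exact (smul_eq_zero.mp e.symm).resolve_left hn

end IsHomogeneous

/-- The bracket is local: where f agrees with the coordinate x^a on an open set, (F, f) is ∂F/∂p_a,
up to the parity operator if x^a is odd. The formulation with `U` is needed because global densities
agree with coordinates only locally. -/
theorem val_pderiv_eq_zero_of_poisson (F : SuperFun (κ ⊕ κ) (cot V)) {f : SuperFun κ V}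
    {a : ι ⊕ κ} {U : Set (ι → ℝ)} (hU : IsOpen U)
    (hf : ∀ x : V, x.1 ∈ U → f.1 x = (coord a : SuperFun κ V).1 x) (y : cot V)
    (hy : y.1 ∘ Sum.inl ∈ U) (h : (poisson F (toCot f)).1 y = 0) :
    (pderiv (Sum.map Sum.inr Sum.inr a) F).1 y = 0 := by
  classical
  have key : ∀ b, (pderiv (Sum.map Sum.inl Sum.inl b) (toCot f)).1 y = if b = a then 1 else 0 := by
    intro b
    rw [pderiv_toCot, val_toCot, pderiv_congr b hU hf _ hy, pderiv_coord]
    split_ifs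
    · exact map_one _
    · exact map_zero _
  have e : (poisson F (toCot f)).1 y =
      (twist (Sum.map Sum.inl Sum.inl a) (pderiv (Sum.map Sum.inr Sum.inr a) F)).1 y := by
    rw [poisson_eq_sum, AddSubmonoidClass.coe_finsetSum, Finset.sum_apply,
      Finset.sum_eq_single (Sum.map Sum.inl Sum.inl a)]
    · change poissonSign _ • ((twist _ _).1 y * (pderiv (Sum.map Sum.inl Sum.inl a) (toCot f)).1 y)
        = _
      rw [key, if_pos rfl, mul_one]
      rcases a with i | j <;> exact one_smul ℝ _
    · intro A _ hA
      change poissonSign _ • ((twist _ _).1 y * (pderiv A (toCot f)).1 y) = 0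
      have : (pderiv A (toCot f)).1 y = 0 := by
        rcases A with (i | i) | (j | j)
        · exact (key (.inl i)).trans (if_neg fun h' : .inl i = a => hA (h' ▸ rfl))
        · exact congrArg (fun g => g.1 y) (pderiv_mom_toCot (.inl i) f)
        · exact (key (.inr j)).trans (if_neg fun h' : .inr j = a => hA (h' ▸ rfl))
        · exact congrArg (fun g => g.1 y) (pderiv_mom_toCot (.inr j) f)
      rw [this, mul_zero, smul_zero]
    · exact fun h => (h (Finset.mem_univ _)).elim
  rw [e] at h
  rcases a with i | j
  · exact h
  · have h' : Grassmann.inv ((pderiv (.inr (.inr j)) F).1 y) = 0 := (val_inv _ y).symm.trans h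
    have h2 := congrArg Grassmann.inv h'
    rw [Grassmann.inv_inv, map_zero] at h2
    exact h2

/-- A function homogeneous of non-zero degree in the momenta vanishes if its brackets with the
coordinates do. -/
theorem IsHomogeneous.val_eq_zero_of_poisson {F : SuperFun (κ ⊕ κ) (cot V)} {n : ℝ}
    (hF : IsHomogeneous F n) (hn : n ≠ 0) {f : ι ⊕ κ → SuperFun κ V} {U : Set (ι → ℝ)}
    (hU : IsOpen U) (hf : ∀ a, ∀ x : V, x.1 ∈ U → (f a).1 x = (coord a : SuperFun κ V).1 x)
    (h : ∀ a, ∀ y : cot V, y.1 ∘ Sum.inl ∈ U → (SuperFun.poisson F (SuperFun.toCot (f a))).1 y = 0)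
    (y : cot V) (hy : y.1 ∘ Sum.inl ∈ U) : F.1 y = 0 :=
  hF.val_eq_zero hn y fun a => val_pderiv_eq_zero_of_poisson F hU (hf a) y hy (h a y hy)

/-- A bracket with a momentum-free function lowers the degree by one, so the preceding lemma is
applied in the degrees 3, 2 and 1, none of which is zero. -/
theorem IsHomogeneous.val_eq_zero_of_poisson₃ {F : SuperFun (κ ⊕ κ) (cot V)}
    (hF : IsHomogeneous F 3) {f : ι ⊕ κ → SuperFun κ V} {U : Set (ι → ℝ)}
    (hU : IsOpen U) (hf : ∀ a, ∀ x : V, x.1 ∈ U → (f a).1 x = (coord a : SuperFun κ V).1 x)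
    (h : ∀ a b c, SuperFun.poisson (SuperFun.poisson (SuperFun.poisson F (SuperFun.toCot (f a)))
      (SuperFun.toCot (f b))) (SuperFun.toCot (f c)) = 0)
    (y : cot V) (hy : y.1 ∘ Sum.inl ∈ U) : F.1 y = 0 := by
  have h2 := fun a => (hF.poisson (IsHomogeneous.toCot (f a))).congr (m := 2) (by norm_num)
  have h1 := fun a b => ((h2 a).poisson (IsHomogeneous.toCot (f b))).congr (m := 1) (by norm_num)
  refine hF.val_eq_zero_of_poisson three_ne_zero hU hf (fun a => ?_) y hy
  refine (h2 a).val_eq_zero_of_poisson two_ne_zero hU hf fun b => ?_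
  refine (h1 a b).val_eq_zero_of_poisson one_ne_zero hU hf fun c y _ => ?_
  rw [h]
  rfl

end Euler

/-! ### Densities as functions on the extended domain -/

section Generating

variable {ι κ : Type*} [Fintype ι] [Fintype κ] {V : Opens (ι → ℝ)}

theorem toCot_injective : Function.Injective (toCot : SuperFun κ V →ₐ[ℝ] _) := by
  intro f g h
  ext x
  let y : cot V := ⟨Sum.elim x.1 0, x.2⟩
  have h' := congrArg (fun k => k.1 y) h
  rw [val_toCot, val_toCot] at h'
  exact Grassmann.rename_injective Sum.inl_injective h'

theorem generating_add (ψ χ : AddMonoidAlgebra (SuperFun κ V) ℝ) :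
    generating (ψ + χ) = generating ψ + generating χ :=
  Finsupp.sum_add_index' (fun w => by rw [map_zero, zero_mul])
    (fun w f g => by rw [map_add, add_mul])

theorem generating_smul (c : ℝ) (ψ : AddMonoidAlgebra (SuperFun κ V) ℝ) :
    generating (c • ψ) = c • generating ψ := by
  rw [generating, generating, Finsupp.smul_sum]
  refine (Finsupp.sum_smul_index' (g := ψ.coeff) (b := c) fun w => ?_).trans ?_
  · rw [map_zero, zero_mul]
  · simp only [map_smul, smul_mul_assoc]

theorem tpow_parity (w : ℝ) : HasParity (tpow w : SuperFun κ (hat V)) 0 := by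
  ext y
  rw [val_inv]
  change Grassmann.inv (algebraMap ℝ _ _) = (-1 : ℝ) ^ 0 • algebraMap ℝ (Grassmann κ) _
  rw [Grassmann.inv_algebraMap, pow_zero, one_smul]

theorem generating_parity {ψ : AddMonoidAlgebra (SuperFun κ V) ℝ} {k : ℕ}
    (h : ∀ w, HasParity (ψ.coeff w) k) : HasParity (generating ψ) k :=
  HasParity.sum fun w _ => ((h w).pull _).mul (tpow_parity w)

theorem val_generating (ψ : AddMonoidAlgebra (SuperFun κ V) ℝ) (y : hat V) :
    (generating ψ).1 y =
      ψ.coeff.sum fun w f => y.1 (.inr ()) ^ w • f.1 ⟨y.1 ∘ Sum.inl, y.2.1⟩ := by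
  rw [generating, Finsupp.sum, AddSubmonoidClass.coe_finsetSum, Finset.sum_apply]
  refine Finset.sum_congr rfl fun w _ => ?_
  change (toHat _).1 y * algebraMap ℝ _ _ = _
  rw [toHat, val_pull, Grassmann.rename_id, ← Algebra.commutes, ← Algebra.smul_def]

/-- The functions s ↦ exp(ws) are distinct characters of the additive group of ℝ, hence linearly
independent by Dedekind's theorem; vector coefficients are treated by their coordinates in a basis.
-/
theorem eq_zero_of_sum_exp_smul {E : Type*} [AddCommGroup E] [Module ℝ E]
    [Module.Free ℝ E] (c : ℝ →₀ E) (h : ∀ s : ℝ, (c.sum fun w v => Real.exp (w * s) • v) = 0) :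
    c = 0 := by
  let χ : ℝ → (Multiplicative ℝ →* ℝ) := fun w =>
    { toFun := fun s => Real.exp (w * s.toAdd)
      map_one' := by simp
      map_mul' := fun s t => by rw [toAdd_mul, mul_add, Real.exp_add] }
  have hχ : Function.Injective χ := fun v w hvw => by
    have := DFunLike.congr_fun hvw (Multiplicative.ofAdd 1)
    change Real.exp (v * 1) = Real.exp (w * 1) at this
    simpa using this
  have li := (linearIndependent_monoidHom (Multiplicative ℝ) ℝ).comp χ hχ
  let b := Module.Free.chooseBasis ℝ E
  ext w
  refine b.ext_elem fun i => ?_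
  have h0 : c.mapRange (fun v => b.repr v i) (by simp) = 0 := by
    refine (linearIndependent_iff.mp li) _ ?_
    ext s
    have hs := congrArg (fun v => b.repr v i) (h s.toAdd)
    simp only [map_zero, Finsupp.coe_zero, Pi.zero_apply] at hs
    rw [Finsupp.linearCombination_apply, Finsupp.sum_mapRange_index (by simp), Finsupp.sum,
      Finset.sum_apply]
    rw [Finsupp.sum, map_sum, Finsupp.finsetSum_apply] at hs
    refine Eq.trans (Finset.sum_congr rfl fun v _ => ?_) hs
    rw [map_smul, Finsupp.smul_apply, Pi.smul_apply, smul_eq_mul, smul_eq_mul, mul_comm]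
    rfl
  simpa using DFunLike.congr_fun h0 w

theorem eq_zero_of_generating_eq_zero {ψ : AddMonoidAlgebra (SuperFun κ V) ℝ}
    (h : generating ψ = 0) : ψ = 0 := by
  ext w x
  have key : ψ.coeff.mapRange (fun f => f.1 x) rfl = 0 := by
    refine eq_zero_of_sum_exp_smul _ fun s => ?_
    -- With t = exp s the powers t^w become the characters exp(ws).
    let y : hat V := ⟨Sum.elim x.1 fun _ => Real.exp s, x.2, Real.exp_pos s⟩
    have hy := val_generating ψ y
    rw [h] at hy
    rw [Finsupp.sum_mapRange_index fun _ => smul_zero _]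
    refine Eq.trans (Finset.sum_congr rfl fun w _ => ?_) hy.symm
    change _ = Real.exp s ^ w • _
    rw [← Real.exp_mul, mul_comm]
    rfl
  exact DFunLike.congr_fun key w

end Generating

end SuperFun

/-! ### Functions on T*M as functions on the cotangent bundle of the extended domain; the function t
p_t. -/

namespace SuperFun

section CotHat

variable {ι κ : Type*} [Fintype ι] [Fintype κ] {V : Opens (ι → ℝ)}

/-- A function on the cotangent bundle as a function on the cotangent bundle of the extended
domain. -/
def toCotHat : SuperFun (κ ⊕ κ) (cot V) →ₐ[ℝ] SuperFun (κ ⊕ κ) (cot (hat V)) :=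
  pull (Sum.map Sum.inl Sum.inl) id fun y (h : y ∘ Sum.inl ∈ hat V) => h.1

theorem val_toCotHat (F : SuperFun (κ ⊕ κ) (cot V)) (y : cot (hat V)) :
    (toCotHat F).1 y = F.1 ⟨y.1 ∘ Sum.map Sum.inl Sum.inl, y.2.1⟩ := by
  refine (val_pull _ _ _ F y).trans ?_
  rw [Grassmann.rename_id]

theorem toCotHat_toCot (f : SuperFun κ V) :
    toCotHat (toCot f) = toCot (toHat f : SuperFun κ (hat V)) := by
  ext y
  rw [val_toCotHat, val_toCot, val_toCot]
  refine congrArg (Grassmann.rename Sum.inl) ?_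
  refine Eq.trans ?_ (val_pull _ _ _ f _).symm
  rw [Grassmann.rename_id]
  rfl

theorem toCotHat_mom (a : ι ⊕ κ) :
    toCotHat (mom a : SuperFun (κ ⊕ κ) (cot V)) = mom (Sum.map Sum.inl id a) := by
  refine (pull_coord _ _).trans ?_
  rcases a with i | j <;> rfl

/-- The function `t p_t` on the cotangent bundle of the extended domain. -/
def weightMom : SuperFun (κ ⊕ κ) (cot (hat V)) :=
  toCot (coord (.inl (.inr ()))) * mom (.inl (.inr ()))

theorem val_weightMom (y : cot (hat V)) : (weightMom : SuperFun (κ ⊕ κ) (cot (hat V))).1 y =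
    algebraMap ℝ _ (y.1 (.inl (.inr ())) * y.1 (.inr (.inr ()))) := by
  rw [map_mul]
  change (toCot (coord (.inl (.inr ())))).1 y * _ = _
  rw [val_toCot]
  exact congrArg (· * _) (AlgHom.commutes _ _)

theorem weightMom_parity : HasParity (weightMom : SuperFun (κ ⊕ κ) (cot (hat V))) 0 := by
  have h0 : HasParity (coord (.inl (.inr ())) : SuperFun κ (hat V)) 0 :=
    coord_parity (Sum.inl (Sum.inr ()))
  have h1 : HasParity (toCot (coord (.inl (.inr ())) : SuperFun κ (hat V))) 0 := h0.pull _
  have h2 : HasParity (mom (.inl (.inr ())) : SuperFun (κ ⊕ κ) (cot (hat V))) 0 :=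
    coord_parity (Sum.inl (Sum.inr (Sum.inr ())))
  exact h1.mul h2

theorem weightMom_pow_parity (n : ℕ) :
    HasParity ((weightMom : SuperFun (κ ⊕ κ) (cot (hat V))) ^ n) 0 := by
  induction n with
  | zero =>
    rw [pow_zero]
    exact HasParity.one
  | succ n ih =>
    rw [pow_succ]
    exact ih.mul weightMom_parity

theorem HasParity.toCotHat {F : SuperFun (κ ⊕ κ) (cot V)} {k : ℕ} (hF : HasParity F k) :
    HasParity (toCotHat F) k := hF.pull _

variable [DecidableEq ι]

theorem pderiv_toCotHat (A : (ι ⊕ ι) ⊕ (κ ⊕ κ)) (F : SuperFun (κ ⊕ κ) (cot V)) :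
    pderiv (Sum.map (Sum.map Sum.inl Sum.inl) id A) (toCotHat F) = toCotHat (pderiv A F) :=
  pderiv_pull _ (Sum.map_injective.mpr ⟨Sum.inl_injective, Sum.inl_injective⟩)
    Function.injective_id A F

theorem pderiv_toCotHat_time (F : SuperFun (κ ⊕ κ) (cot V)) (A : Unit ⊕ Unit) :
    pderiv (.inl (Sum.map Sum.inr Sum.inr A)) (toCotHat F) = 0 := by
  refine pderiv_pull_of_notMem _ _ ?_ F
  rintro ⟨b, hb⟩
  rcases A with i | j <;> rcases b with (i' | j') | b <;> simp at hb

theorem poisson_toCotHat (F G : SuperFun (κ ⊕ κ) (cot V)) :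
    poisson (toCotHat F) (toCotHat G) = toCotHat (poisson F G) := by
  have h1 := fun F => pderiv_toCotHat_time (V := V) (κ := κ) F (.inl ())
  have h2 := fun F => pderiv_toCotHat_time (V := V) (κ := κ) F (.inr ())
  have h3 := fun i => pderiv_toCotHat (V := V) (κ := κ) (.inl (.inl i))
  have h4 := fun i => pderiv_toCotHat (V := V) (κ := κ) (.inl (.inr i))
  have h5 := fun i => pderiv_toCotHat (V := V) (κ := κ) (.inr (.inl i))
  have h6 := fun i => pderiv_toCotHat (V := V) (κ := κ) (.inr (.inr i))
  have h7 : ∀ F : SuperFun (κ ⊕ κ) (cot V), inv (toCotHat F) = toCotHat (inv F) := inv_pull _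
  simp only [Sum.map_inl, Sum.map_inr, id] at h1 h2 h3 h4 h5 h6
  simp only [poisson, Fintype.sum_sum_type, h1, h2, h3, h4, h5, h6, h7, map_add, map_sum, map_sub,
    map_mul]
  simp

theorem pderiv_weightMom (A : (ι ⊕ ι) ⊕ (κ ⊕ κ)) :
    pderiv (Sum.map (Sum.map Sum.inl Sum.inl) id A)
      (weightMom : SuperFun (κ ⊕ κ) (cot (hat V))) = 0 := by
  classical
  have e : toCot (coord (.inl (.inr ())) : SuperFun κ (hat V)) = coord (.inl (.inl (.inr ()))) :=
    pull_coord _ _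
  rw [weightMom, pderiv_mul, e, mom, pderiv_coord, pderiv_coord, if_neg, if_neg, zero_mul, mul_zero,
    add_zero] <;> rcases A with (i | i) | j <;> simp

theorem poisson_toCotHat_weightMom (F : SuperFun (κ ⊕ κ) (cot V)) :
    poisson (toCotHat F) weightMom = 0 := by
  have h1 := fun F => pderiv_toCotHat_time (V := V) (κ := κ) F (.inl ())
  have h2 := fun F => pderiv_toCotHat_time (V := V) (κ := κ) F (.inr ())
  have h3 := fun i => pderiv_weightMom (V := V) (κ := κ) (.inl (.inl i))
  have h4 := fun i => pderiv_weightMom (V := V) (κ := κ) (.inl (.inr i))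
  have h5 := fun i => pderiv_weightMom (V := V) (κ := κ) (.inr (.inl i))
  have h6 := fun i => pderiv_weightMom (V := V) (κ := κ) (.inr (.inr i))
  simp only [Sum.map_inl, Sum.map_inr, id] at h1 h2 h3 h4 h5 h6
  simp only [poisson, Fintype.sum_sum_type, h1, h2, h3, h4, h5, h6]
  simp

theorem poisson_weightMom_weightMom :
    poisson (weightMom : SuperFun (κ ⊕ κ) (cot (hat V))) weightMom = 0 := by
  have h := poisson_swap (weightMom_parity (V := V) (κ := κ)) weightMom_parity
  rw [pow_zero, neg_one_smul] at h
  exact Grassmann.eq_zero_of_eq_neg h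

theorem poisson_weightMom_pow_mul {X : SuperFun (κ ⊕ κ) (cot (hat V))} {k : ℕ}
    (hX : HasParity X k) (h : poisson X weightMom = 0) (n : ℕ)
    (Y : SuperFun (κ ⊕ κ) (cot (hat V))) :
    poisson X (weightMom ^ n * Y) = weightMom ^ n * poisson X Y := by
  induction n with
  | zero => simp
  | succ n ih =>
    rw [pow_succ', mul_assoc, poisson_mul_right hX weightMom_parity, h, zero_mul, zero_add, ih,
      mul_zero, pow_zero, one_smul, mul_assoc]

theorem poisson_weightMom_pow_mul_weightMom {F : SuperFun (κ ⊕ κ) (cot V)} {k : ℕ}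
    (hF : HasParity F k) (n : ℕ) : poisson (weightMom ^ n * toCotHat F) weightMom = 0 := by
  have h : poisson weightMom (toCotHat F) = 0 := by
    rw [poisson_swap weightMom_parity hF.toCotHat, poisson_toCotHat_weightMom, smul_zero]
  rw [poisson_swap ((weightMom_pow_parity n).mul hF.toCotHat) weightMom_parity,
    poisson_weightMom_pow_mul weightMom_parity poisson_weightMom_weightMom, h,
    mul_zero (weightMom ^ n), smul_zero]

/-- Since t p_t is even and commutes with itself and with everything pulled back from T*M, its
powers behave as scalars for the bracket. Powers leave the right argument first; those in the left
argument come out after a swap, and swapping back restores the sign. -/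
theorem poisson_weightMom_pow_mul_mul {F G : SuperFun (κ ⊕ κ) (cot V)} {k l : ℕ}
    (hF : HasParity F k) (hG : HasParity G l) (m n : ℕ) :
    poisson (weightMom ^ m * toCotHat F) (weightMom ^ n * toCotHat G) =
      weightMom ^ (m + n) * toCotHat (poisson F G) := by
  have hF' := (weightMom_pow_parity (V := V) (κ := κ) m).mul hF.toCotHat
  rw [poisson_weightMom_pow_mul hF' (poisson_weightMom_pow_mul_weightMom hF m),
    poisson_swap hF' hG.toCotHat, poisson_weightMom_pow_mul hG.toCotHat
      (poisson_toCotHat_weightMom G), poisson_toCotHat, poisson_swap hG hF, map_smul]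
  simp only [mul_smul_comm, smul_smul]
  rw [zero_add, mul_comm l k, neg_mul_neg, ← pow_add, ← two_mul, pow_mul,
    neg_one_sq, one_pow, one_smul, ← mul_assoc, ← pow_add, add_comm n]

end CotHat

end SuperFun

/-! ### The extended master Hamiltonian as a polynomial in t p_t. -/

namespace OddCoeffs

open SuperFun

variable {ι κ : Type*} [Fintype ι] [Fintype κ] {V : Opens (ι → ℝ)} (H : OddCoeffs κ V)

theorem mom_parity (a : ι ⊕ κ) :
    SuperFun.HasParity (mom a : SuperFun (κ ⊕ κ) (cot V)) (parity a) := by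
  have h := coord_parity (V := cot V) (Sum.map Sum.inr Sum.inr a : (ι ⊕ ι) ⊕ (κ ⊕ κ))
  rcases a with i | j <;> exact h

theorem hamS_parity : SuperFun.HasParity H.hamS 1 := by
  refine HasParity.smul _ (HasParity.sum fun a _ => HasParity.sum fun b _ => ?_)
  refine ((((H.parity_S a b).pull _).mul (mom_parity b)).mul (mom_parity a)).congr ?_
  rcases a with i | j <;> rcases b with i' | j' <;> norm_num [parity]

theorem hamγ_parity : SuperFun.HasParity H.hamγ 1 := by
  refine HasParity.sum fun a _ => (((H.parity_γ a).pull _).mul (mom_parity a)).congr ?_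
  rcases a with i | j <;> norm_num [parity]

theorem hamθ_parity : SuperFun.HasParity H.hamθ 1 := H.parity_θ.pull _

theorem hamHat_eq : H.hamHat = toCotHat H.hamS + weightMom ^ 1 * toCotHat H.hamγ
    + weightMom ^ 2 * toCotHat ((1 / 2 : ℝ) • H.hamθ) := by
  -- The momentum p_t is an even coordinate, so it commutes with every function; the rest is
  -- reordering.
  have ht : ∀ F : SuperFun (κ ⊕ κ) (cot (hat V)),
      (coord (Sum.inl (Sum.inr (Sum.inr ()))) : SuperFun (κ ⊕ κ) (cot (hat V))) * F =
        F * coord (Sum.inl (Sum.inr (Sum.inr ()))) :=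
    coord_mul_twist (V := cot (hat V)) (κ := κ ⊕ κ) (Sum.inl (Sum.inr (Sum.inr ())))
  simp only [hamHat, hamS, hamγ, hamθ, map_smul, map_sum, map_mul, toCotHat_toCot, toCotHat_mom,
    weightMom, smul_add, pow_one]
  congr 1
  · congr 1
    rw [smul_smul, one_div, inv_mul_cancel₀ two_ne_zero, one_smul, mul_assoc, mul_assoc]
    refine congrArg _ (ht _).symm
  · rw [mul_smul_comm, mom]
    congr 1
    simp only [Sum.map_inl, pow_two, mul_assoc]
    congr 1
    rw [ht, ht (toCot (coord _) * _)]
    simp only [mul_assoc]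
    rw [← mul_assoc (coord _), ht (toCot (toHat _)), mul_assoc]

variable [DecidableEq ι]

theorem hamHat_homogeneous : IsHomogeneous H.hamHat 2 := by
  have hl : ∀ f : SuperFun κ V, IsHomogeneous (toCot (toHat f)) 0 := fun f => .toCot _
  have hm : ∀ a, IsHomogeneous (mom a : SuperFun (κ ⊕ κ) (cot (hat V))) 1 := .mom
  refine IsHomogeneous.smul _ (((IsHomogeneous.sum fun a _ => IsHomogeneous.sum fun b _ =>
    ?_).add (IsHomogeneous.smul _ ?_)).add ?_)
  · exact (((hl _).mul (hm _)).mul (hm _)).congr (by norm_num)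
  · exact (((IsHomogeneous.toCot _).mul (IsHomogeneous.sum fun a _ => (hl _).mul (hm _))).mul
      (hm _)).congr (by norm_num)
  · rw [pow_two, pow_two]
    exact ((((IsHomogeneous.toCot _).mul (.toCot _)).mul (hl _)).mul ((hm _).mul (hm _))).congr
      (by norm_num)

theorem hamHat_parity : SuperFun.HasParity H.hamHat 1 := by
  rw [hamHat_eq]
  refine HasParity.add (HasParity.add H.hamS_parity.toCotHat ?_) ?_
  · exact ((weightMom_pow_parity 1).mul H.hamγ_parity.toCotHat).congr (by simp)
  · exact ((weightMom_pow_parity 2).mul (H.hamθ_parity.smul _).toCotHat).congr (by simp)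

/-- The self-bracket of the extended master Hamiltonian as a polynomial in `t p_t`. -/
theorem poisson_hamHat : poisson H.hamHat H.hamHat = toCotHat (poisson H.hamS H.hamS)
    + weightMom ^ 1 * toCotHat ((2 : ℝ) • poisson H.hamS H.hamγ)
    + weightMom ^ 2 * toCotHat (poisson H.hamS H.hamθ + poisson H.hamγ H.hamγ)
    + weightMom ^ 3 * toCotHat (poisson H.hamγ H.hamθ) := by
  have hs := H.hamS_parity
  have hg := H.hamγ_parity
  have hh := H.hamθ_parity.smul (1 / 2 : ℝ)
  have key := fun F G (hF : SuperFun.HasParity F 1) (hG : SuperFun.HasParity G 1) =>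
    poisson_weightMom_pow_mul_mul (V := V) (κ := κ) (F := F) (G := G) hF hG
  have e0 : ∀ F : SuperFun (κ ⊕ κ) (cot V), toCotHat F = weightMom ^ 0 * toCotHat F := fun F => by
    rw [pow_zero, one_mul]
  -- The bracket is symmetric on odd functions. Hence (S, γ) occurs twice, and the two halves coming
  -- from ½θ add up to (S, θ) and to (γ, θ).
  have e1 : poisson H.hamγ H.hamS = poisson H.hamS H.hamγ := by
    rw [poisson_swap hg hs]; simp
  have e2 : poisson H.hamθ H.hamS = poisson H.hamS H.hamθ := by
    rw [poisson_swap H.hamθ_parity hs]; simp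
  have e3 : poisson H.hamθ H.hamγ = poisson H.hamγ H.hamθ := by
    rw [poisson_swap H.hamθ_parity hg]; simp
  -- There is no term of degree four in t p_t, as θ is momentum-free.
  have e4 : poisson H.hamθ H.hamθ = 0 := poisson_toCot_toCot _ _
  rw [hamHat_eq, e0 H.hamS]
  simp only [poisson_add_left, poisson_add_right, key _ _ hs hs, key _ _ hs hg, key _ _ hg hs,
    key _ _ hg hg, key _ _ hs hh, key _ _ hh hs, key _ _ hg hh, key _ _ hh hg, key _ _ hh hh]
  simp only [poisson_smul_left, poisson_smul_right, e1, e2, e3, e4, smul_zero, map_zero, mul_zero, map_add,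
    map_smul, mul_add, mul_smul_comm, Nat.reduceAdd, add_zero, pow_zero, one_mul]
  module

/-- The value at 0 is a; then the values at 1 and -1 add up to 2c, and the value at 2 minus twice
the value at 1 is 6d. -/
theorem eq_zero_of_cubic {E : Type*} [AddCommGroup E] [Module ℝ E] {a b c d : E}
    (h : ∀ s : ℝ, a + s • b + s ^ 2 • c + s ^ 3 • d = 0) : a = 0 ∧ b = 0 ∧ c = 0 ∧ d = 0 := by
  have ha : a = 0 := by simpa using h 0
  subst ha
  have h1 := h 1
  have h2 := h (-1)
  have h3 := h 2
  have hc : c = 0 := by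
    have : (2 : ℝ) • c = 0 := by
      linear_combination (norm := module) h1 + h2
    exact (smul_eq_zero.mp this).resolve_left two_ne_zero
  subst hc
  have hd : d = 0 := by
    have : (6 : ℝ) • d = 0 := by
      linear_combination (norm := module) h3 - (2 : ℝ) • h1
    exact (smul_eq_zero.mp this).resolve_left (by norm_num)
  subst hd
  refine ⟨rfl, ?_, rfl, rfl⟩
  simpa using h1

/-- The extended master Hamiltonian commutes with itself if and only if its parts satisfy the
four equations. -/
theorem poisson_hamHat_eq_zero_iff : poisson H.hamHat H.hamHat = 0 ↔
    poisson H.hamS H.hamS = 0 ∧ poisson H.hamS H.hamγ = 0 ∧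
      poisson H.hamS H.hamθ + poisson H.hamγ H.hamγ = 0 ∧ poisson H.hamγ H.hamθ = 0 := by
  rw [poisson_hamHat]
  constructor
  · intro h
    set A := poisson H.hamS H.hamS
    set B := (2 : ℝ) • poisson H.hamS H.hamγ with hB
    set C := poisson H.hamS H.hamθ + poisson H.hamγ H.hamγ
    set D := poisson H.hamγ H.hamθ
    have key : ∀ (y : cot V) (s : ℝ),
        A.1 y + s • B.1 y + s ^ 2 • C.1 y + s ^ 3 • D.1 y = 0 := by
      intro y s
      -- The point over y with t = 1 and p_t = s, at which t p_t = s.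
      let z : cot (hat V) := ⟨Sum.elim (Sum.elim (y.1 ∘ Sum.inl) fun _ => 1)
        (Sum.elim (y.1 ∘ Sum.inr) fun _ => s), y.2, zero_lt_one⟩
      have hz : (⟨z.1 ∘ Sum.map Sum.inl Sum.inl, z.2.1⟩ : cot V) = y := by
        refine Subtype.ext (funext fun i => ?_)
        rcases i with i | i <;> rfl
      have hv := congrArg (fun F => F.1 z) h
      change (toCotHat A).1 z + weightMom.1 z ^ 1 * (toCotHat B).1 z +
        weightMom.1 z ^ 2 * (toCotHat C).1 z + weightMom.1 z ^ 3 * (toCotHat D).1 z = 0 at hv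
      have hw : (weightMom : SuperFun (κ ⊕ κ) (cot (hat V))).1 z = algebraMap ℝ _ s := by
        rw [val_weightMom]
        exact congrArg _ (one_mul s)
      rw [hw, val_toCotHat, val_toCotHat, val_toCotHat, val_toCotHat, hz, ← map_pow, ← map_pow,
        ← map_pow, ← Algebra.smul_def, ← Algebra.smul_def, ← Algebra.smul_def, pow_one] at hv
      exact hv
    have coeffs := fun y => eq_zero_of_cubic (key y)
    have hB0 : B = 0 := ext fun y => (coeffs y).2.1
    exact ⟨ext fun y => (coeffs y).1, (smul_eq_zero.mp hB0).resolve_left two_ne_zero,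
      ext fun y => (coeffs y).2.2.1, ext fun y => (coeffs y).2.2.2⟩
  · rintro ⟨h1, h2, h3, h4⟩
    rw [h1, h2, h3, h4, smul_zero, map_zero, mul_zero, mul_zero, mul_zero, add_zero, add_zero,
      add_zero]

end OddCoeffs

/-! ### Hadamard's lemma for maps of normed spaces. -/

section Hadamard

open MeasureTheory

variable {E F : Type*} [NormedAddCommGroup E] [NormedSpace ℝ E] [NormedAddCommGroup F]
  [NormedSpace ℝ F] [CompleteSpace F]

/-- The integral is the value at 0 of the convolution of the indicator of (0, 1] with s ↦ χ(s) G(x,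
-s), and a convolution with a smooth parameter-dependent factor supported in a fixed compact set is
smooth. The bump function χ is 1 on [-1, 1], so it does not change the integral. -/
theorem contDiff_integral_unitInterval {G : E → ℝ → F}
    (hG : ContDiff ℝ ∞ fun p : E × ℝ => G p.1 p.2) :
    ContDiff ℝ ∞ fun x => ∫ s in (0 : ℝ)..1, G x s := by
  let χ : ContDiffBump (0 : ℝ) := ⟨1, 2, one_pos, one_lt_two⟩
  have hloc : LocallyIntegrable (indicator (Ioc (0 : ℝ) 1) fun _ => (1 : ℝ)) :=
    ((integrable_indicator_iff measurableSet_Ioc).mpr (by simp)).locallyIntegrable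
  have hg : ContDiffOn ℝ ∞ (fun p : E × ℝ => χ p.2 • G p.1 (-p.2)) (univ ×ˢ univ) :=
    ((χ.contDiff.comp contDiff_snd).smul (hG.comp (contDiff_fst.prodMk contDiff_snd.neg))).contDiffOn
  have hk : ∀ (x : E) (s : ℝ), x ∈ univ → s ∉ Metric.closedBall (0 : ℝ) 2 →
      χ s • G x (-s) = 0 := by
    intro x s _ hs
    rw [Metric.mem_closedBall, not_le] at hs
    rw [χ.zero_of_le_dist hs.le, zero_smul]
  have h := contDiffOn_convolution_right_with_param (𝕜 := ℝ) (n := ⊤) (ContinuousLinearMap.lsmul ℝ ℝ)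
    (g := fun (x : E) (s : ℝ) => χ s • G x (-s)) isOpen_univ (isCompact_closedBall (0 : ℝ) 2) hk hloc hg
  have h2 : ContDiff ℝ ∞ fun x : E => convolution (indicator (Ioc (0 : ℝ) 1) fun _ => (1 : ℝ))
      (fun s : ℝ => χ s • G x (-s)) (ContinuousLinearMap.lsmul ℝ ℝ) volume 0 := by
    rw [univ_prod_univ, contDiffOn_univ] at h
    exact h.comp (contDiff_id.prodMk (contDiff_const (c := (0 : ℝ))))
  refine Eq.subst (motive := fun f => ContDiff ℝ ∞ f) (funext fun x => ?_) h2
  rw [convolution_def, intervalIntegral.integral_of_le zero_le_one,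
    ← integral_indicator measurableSet_Ioc]
  refine integral_congr_ae (Filter.Eventually.of_forall fun t => ?_)
  by_cases ht : t ∈ Ioc (0 : ℝ) 1
  · have h1 : χ (0 - t) = 1 := χ.one_of_mem_closedBall <| by
      rw [zero_sub, Metric.mem_closedBall, dist_zero_right, norm_neg, Real.norm_eq_abs,
        abs_of_pos ht.1]
      exact ht.2
    simp only [indicator_of_mem ht, h1]
    simp
  · simp [indicator_of_notMem ht]

/-- Hadamard's lemma. -/
theorem exists_contDiff_clm_eq {f : E → F} (hf : ContDiff ℝ ∞ f) (x₀ : E) :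
    ∃ L : E → E →L[ℝ] F, ContDiff ℝ ∞ L ∧ ∀ x, f x = f x₀ + L x (x - x₀) := by
  -- L x is the derivative of f averaged over the segment from x₀ to x; the identity is the
  -- fundamental theorem of calculus along this segment.
  refine ⟨fun x => ∫ s in (0 : ℝ)..1, fderiv ℝ f (x₀ + s • (x - x₀)),
    contDiff_integral_unitInterval ?_, fun x => ?_⟩
  · have h : ContDiff ℝ ∞ (fderiv ℝ f) := hf.fderiv_right (m := ∞) le_rfl
    exact h.comp (contDiff_const.add (contDiff_snd.smul (contDiff_fst.sub contDiff_const)))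
  · have hd : Continuous (fderiv ℝ f) := hf.continuous_fderiv (by simp)
    have hc : Continuous fun s : ℝ => fderiv ℝ f (x₀ + s • (x - x₀)) := by fun_prop
    rw [ContinuousLinearMap.intervalIntegral_apply (hc.intervalIntegrable 0 1)]
    have h : ∀ s ∈ Set.uIcc (0 : ℝ) 1, HasDerivAt (fun s : ℝ => f (x₀ + s • (x - x₀)))
        (fderiv ℝ f (x₀ + s • (x - x₀)) (x - x₀)) s := by
      intro s _
      have h1 : HasDerivAt (fun s : ℝ => x₀ + s • (x - x₀)) (x - x₀) s := by
        simpa using ((hasDerivAt_id s).smul_const (x - x₀)).const_add x₀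
      exact (hf.differentiable (by simp) _).hasFDerivAt.comp_hasDerivAt s h1
    rw [intervalIntegral.integral_eq_sub_of_hasDerivAt h
      ((hc.clm_apply continuous_const).intervalIntegrable 0 1)]
    simp

end Hadamard

/-! ### Hadamard's lemma for superfunctions, homomorphisms over a point, and the chain rule. -/

namespace SuperFun

variable {ι κ : Type*} [Fintype ι] [Fintype κ] {V : Opens (ι → ℝ)}

/-- A smooth real function as a superfunction. -/
def ofReal (V : Opens (ι → ℝ)) (r : (ι → ℝ) → ℝ) (hr : ContDiffOn ℝ ∞ r V) : SuperFun κ V :=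
  ofContDiffOn V (fun x => algebraMap ℝ _ (r x))
    ((Algebra.linearMap ℝ (Grassmann κ)).toContinuousLinearMap.contDiff.comp_contDiffOn hr)

theorem val_ofReal (r : (ι → ℝ) → ℝ) (hr : ContDiffOn ℝ ∞ r V) (x : V) :
    (ofReal V r hr : SuperFun κ V).1 x = algebraMap ℝ _ (r x) := rfl

theorem ofReal_parity (r : (ι → ℝ) → ℝ) (hr : ContDiffOn ℝ ∞ r V) :
    HasParity (ofReal V r hr : SuperFun κ V) 0 := by
  ext x
  rw [val_inv, val_ofReal, Grassmann.inv_algebraMap, pow_zero, one_smul, val_ofReal]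

/-- A constant superfunction. -/
def const (V : Opens (ι → ℝ)) : Grassmann κ →ₐ[ℝ] SuperFun κ V where
  toFun c := ofContDiffOn V (fun _ => c) contDiffOn_const
  map_one' := rfl
  map_zero' := rfl
  map_mul' _ _ := rfl
  map_add' _ _ := rfl
  commutes' _ := rfl

theorem exists_bump {x₀ : ι → ℝ} {U : Set (ι → ℝ)} (hU : U ∈ nhds x₀) :
    ∃ χ : (ι → ℝ) → ℝ, ContDiff ℝ ∞ χ ∧ HasCompactSupport χ ∧ tsupport χ ⊆ U ∧
      ∀ᶠ x in nhds x₀, χ x = 1 := by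
  obtain ⟨ε, hε, hU⟩ := Metric.mem_nhds_iff.mp hU
  let χ : ContDiffBump x₀ := ⟨ε / 4, ε / 2, by positivity, by linarith⟩
  refine ⟨χ, χ.contDiff, χ.hasCompactSupport, ?_, χ.eventuallyEq_one⟩
  rw [χ.tsupport_eq]
  exact (Metric.closedBall_subset_ball (by change ε / 2 < ε; linarith)).trans hU

/-- Hadamard's lemma for superfunctions, up to a remainder that vanishes near the point. -/
theorem exists_hadamard (f : SuperFun κ V) (x₀ : V) :
    ∃ (c : Grassmann κ) (g : ι → SuperFun κ V) (r : SuperFun κ V),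
      f = const V c + ∑ i, (coord (.inl i) - algebraMap ℝ _ (x₀.1 i)) * g i + r ∧
      ∀ᶠ x in nhds x₀.1, extZ r x = 0 := by
  classical
  obtain ⟨χ, hχ, hχc, hχs, hχ1⟩ := exists_bump (V.isOpen.mem_nhds x₀.2)
  -- The cut-off function χf is smooth on the whole space, being zero near every point outside V; so
  -- the global form of Hadamard's lemma applies to it.
  have hF : ContDiff ℝ ∞ fun x => χ x • extZ f x := by
    rw [contDiff_iff_contDiffAt]
    intro x
    by_cases hx : x ∈ V
    · exact hχ.contDiffAt.smul ((contDiffOn_extZ f).contDiffAt (V.isOpen.mem_nhds hx))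
    · have : (fun x => χ x • extZ f x) =ᶠ[nhds x] fun _ => 0 := by
        filter_upwards [(isClosed_tsupport χ).isOpen_compl.mem_nhds fun h => hx (hχs h)] with y hy
        rw [image_eq_zero_of_notMem_tsupport hy, zero_smul]
      exact contDiffAt_const.congr_of_eventuallyEq this
  obtain ⟨L, hL, hfL⟩ := exists_contDiff_clm_eq hF x₀.1
  -- The remainder is f - χf, which vanishes where χ = 1.
  refine ⟨χ x₀ • extZ f x₀, fun i => ofContDiffOn V (fun x => L x (Pi.single i 1))
    (hL.clm_apply contDiff_const).contDiffOn, f - ofContDiffOn V _ hF.contDiffOn, ?_, ?_⟩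
  · rw [← sub_eq_iff_eq_add, sub_sub_cancel]
    ext x
    refine (hfL x).trans ?_
    have hx : x.1 - x₀.1 = ∑ i, (x.1 i - x₀.1 i) • (Pi.single i 1 : ι → ℝ) := by
      ext k
      simp [Finset.sum_apply, Pi.single_apply]
    rw [hx, map_sum]
    change _ = _ + (∑ i, _ : SuperFun κ V).1 x
    rw [AddSubmonoidClass.coe_finsetSum, Finset.sum_apply]
    refine congrArg₂ _ rfl (Finset.sum_congr rfl fun i _ => ?_)
    rw [map_smul, Algebra.smul_def, map_sub]
    rfl
  · filter_upwards [hχ1, V.isOpen.mem_nhds x₀.2] with x hx hxV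
    rw [extZ_mk _ hxV]
    change f.1 ⟨x, hxV⟩ - χ x • extZ f x = 0
    rw [hx, one_smul, extZ_mk _ hxV, sub_self]

/-- A superalgebra homomorphism to a Grassmann algebra that lies over the evaluation at a point. -/
structure IsCentered {κ' : Type*} (φ : SuperFun κ V →ₐ[ℝ] Grassmann κ') (x₀ : V) : Prop where
  body_apply : ∀ f, Grassmann.body (φ f) = Grassmann.body (f.1 x₀)
  map_inv : ∀ f, φ (inv f) = Grassmann.inv (φ f)

namespace IsCentered

variable {κ' : Type*} {φ : SuperFun κ V →ₐ[ℝ] Grassmann κ'} {x₀ : V}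

theorem inv_apply (hφ : IsCentered φ x₀) {f : SuperFun κ V} {k : ℕ} (hf : HasParity f k) :
    Grassmann.inv (φ f) = (-1 : ℝ) ^ k • φ f := by
  rw [← hφ.map_inv, hf, map_smul]

/-- A superfunction that vanishes near the point is fixed by multiplication by an even
superfunction that vanishes at the point. -/
theorem exists_mul_eq_self {r : SuperFun κ V} (hr : ∀ᶠ x in nhds x₀.1, extZ r x = 0) :
    ∃ h : SuperFun κ V, HasParity h 0 ∧ h.1 x₀ = 0 ∧ h * r = r := by
  obtain ⟨χ, hχ, hχc, hχs, hχ1⟩ := exists_bump hr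
  refine ⟨1 - ofReal V χ hχ.contDiffOn, ?_, ?_, ?_⟩
  · rw [sub_eq_add_neg, ← neg_one_smul ℝ (ofReal _ _ _)]
    exact HasParity.one.add ((ofReal_parity _ _).smul _)
  · change 1 - algebraMap ℝ (Grassmann κ) (χ x₀.1) = 0
    rw [hχ1.self_of_nhds, map_one, sub_self]
  · ext x
    change (1 - algebraMap ℝ (Grassmann κ) (χ x.1)) * r.1 x = r.1 x
    by_cases hx : x.1 ∈ tsupport χ
    · have : extZ r x = 0 := hχs hx
      rw [← extZ_apply, this, mul_zero]
    · rw [image_eq_zero_of_notMem_tsupport hx, map_zero, sub_zero, one_mul]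

variable [Fintype κ']

/-- Locality of homomorphisms. Writing r = hr with h zero at the point gives φ(r) = φ(h)^n φ(r) for
all n, and φ(h) is nilpotent because its body is zero. -/
theorem apply_eq_zero (hφ : IsCentered φ x₀) {r : SuperFun κ V}
    (hr : ∀ᶠ x in nhds x₀.1, extZ r x = 0) : φ r = 0 := by
  obtain ⟨h, -, h0, hhr⟩ := exists_mul_eq_self hr
  have hn : ∀ n : ℕ, φ r = φ h ^ n * φ r := by
    intro n
    induction n with
    | zero => simp
    | succ n ih => rw [pow_succ, mul_assoc, ← map_mul φ h, hhr, ← ih]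
  have h1 : Grassmann.body (φ h) = 0 := by rw [hφ.body_apply, h0, map_zero]
  rw [hn, Grassmann.pow_eq_zero_of_body _ h1, zero_mul]

/-- A derivation along a centered homomorphism that kills the coordinates is zero. -/
theorem derivation_eq_zero (hφ : IsCentered φ x₀) (D : SuperFun κ V →ₗ[ℝ] Grassmann κ')
    (τ : Grassmann κ' → Grassmann κ') (hτ : ∀ a, Grassmann.inv a = a → τ a = a)
    (hD : ∀ f g, D (f * g) = D f * φ g + τ (φ f) * D g) (hc : ∀ a, D (coord a) = 0)
    (f : SuperFun κ V) : D f = 0 := by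
  classical
  have h1 : D 1 = 0 := by
    have := hD 1 1
    rw [map_one φ, hτ 1 (map_one _), mul_one, mul_one, one_mul] at this
    exact left_eq_add.mp this
  have halg : ∀ r : ℝ, D (algebraMap ℝ _ r) = 0 := fun r => by
    rw [Algebra.algebraMap_eq_smul_one, map_smul, h1, smul_zero]
  -- Constant superfunctions are polynomials in the odd coordinates, which D kills.
  have hconst : ∀ c, D (const V c) = 0 := by
    intro c
    induction c using Grassmann.induction_mul with
    | halg r => rw [AlgHom.commutes, halg]
    | hι v x hx =>
      have hv : D (const V (ExteriorAlgebra.ι ℝ v)) = 0 := by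
        have : D ∘ₗ (const V).toLinearMap ∘ₗ ExteriorAlgebra.ι ℝ = 0 :=
          Finsupp.lhom_ext' fun j => LinearMap.ext_ring (hc (.inr j))
        exact LinearMap.congr_fun this v
      rw [map_mul, hD, hv, hx, zero_mul, mul_zero, add_zero]
    | hadd x y hx hy => rw [map_add, map_add, hx, hy, add_zero]
  have hloc : ∀ r : SuperFun κ V, (∀ᶠ x in nhds x₀.1, extZ r x = 0) → D r = 0 := by
    intro r hr
    obtain ⟨h, hp, h0, hhr⟩ := exists_mul_eq_self hr
    have hinv : Grassmann.inv (φ h) = φ h := by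
      rw [hφ.inv_apply hp, pow_zero, one_smul]
    have hn : ∀ n : ℕ, D r = φ h ^ n * D r := by
      intro n
      induction n with
      | zero => simp
      | succ n ih =>
        have e := hD h r
        rw [hhr, hφ.apply_eq_zero hr, mul_zero, zero_add, hτ _ hinv] at e
        rw [pow_succ, mul_assoc, ← e, ← ih]
    have h1 : Grassmann.body (φ h) = 0 := by rw [hφ.body_apply, h0, map_zero]
    rw [hn, Grassmann.pow_eq_zero_of_body _ h1, zero_mul]
  -- The images of x_i - x_i(x₀) have zero body. They are even and nilpotent, so they generate a
  -- nilpotent ideal of the commutative ring of even elements, over which the Grassmann algebra is a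
  -- module.
  let n : ι → Grassmann.Even κ' := fun i =>
    ⟨φ (coord (.inl i) - algebraMap ℝ _ (x₀.1 i)), Grassmann.mem_even_iff.mpr <| by
      rw [map_sub, map_sub, hφ.inv_apply (coord_parity _), AlgHom.commutes,
        Grassmann.inv_algebraMap]
      exact congrArg₂ _ (one_smul ℝ _) rfl⟩
  let I : Ideal (Grassmann.Even κ') := Ideal.span (Set.range n)
  have hI : IsNilpotent I := by
    refine (Ideal.FG.isNilpotent_iff_le_nilradical
      (Submodule.fg_span (Set.finite_range n))).mpr (Ideal.span_le.mpr ?_)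
    rintro _ ⟨i, rfl⟩
    refine mem_nilradical.mpr ⟨Fintype.card κ' + 1, Subtype.ext ?_⟩
    refine Grassmann.pow_eq_zero_of_body _ ?_
    change Grassmann.body (φ _) = 0
    rw [hφ.body_apply]
    change Grassmann.body (algebraMap ℝ (Grassmann κ) (x₀.1 i) - algebraMap ℝ _ (x₀.1 i)) = 0
    rw [sub_self, map_zero]
  -- Hadamard's lemma gives D f = ∑ n_i D g_i with other superfunctions g_i; iterating it puts D f
  -- into every power of the nilpotent ideal.
  have key : ∀ (k : ℕ) (f : SuperFun κ V),
      D f ∈ (I ^ k • ⊤ : Submodule (Grassmann.Even κ') (Grassmann κ')) := by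
    intro k
    induction k with
    | zero => simp
    | succ k ih =>
      intro f
      obtain ⟨c, g, r, hf, hr⟩ := exists_hadamard f x₀
      rw [hf, map_add, map_add, hconst, hloc r hr, zero_add, add_zero, map_sum]
      refine Submodule.sum_mem _ fun i _ => ?_
      rw [hD, map_sub, hc, halg, sub_zero, zero_mul, zero_add,
        hτ _ (Grassmann.mem_even_iff.mp (n i).2), pow_succ', Submodule.mul_smul]
      exact Submodule.smul_mem_smul (Submodule.subset_span ⟨i, rfl⟩) (ih (g i))
  obtain ⟨k, hk⟩ := hI
  have := key k f
  rw [hk] at this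
  simpa using this

end IsCentered

/-- The chain rule at a point for a homomorphism of superalgebras of functions. -/
theorem pderiv_map {ι' κ' : Type*} [Fintype ι'] [Fintype κ'] [DecidableEq ι] [DecidableEq ι']
    {W : Opens (ι' → ℝ)} (T : SuperFun κ V →ₐ[ℝ] SuperFun κ' W) (y : W) (x₀ : V)
    (hT : ∀ f, T (inv f) = inv (T f))
    (hb : ∀ f, Grassmann.body ((T f).1 y) = Grassmann.body (f.1 x₀)) (a : ι' ⊕ κ')
    (f : SuperFun κ V) :
    (pderiv a (T f)).1 y = ∑ b, (pderiv a (T (coord b))).1 y * (T (pderiv b f)).1 y := by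
  classical
  let ev : SuperFun κ' W →ₐ[ℝ] Grassmann κ' :=
    (Pi.evalAlgHom ℝ (fun _ => Grassmann κ') y).comp (SuperFun κ' W).val
  have hφ : IsCentered (ev.comp T) x₀ :=
    ⟨hb, fun f => (congrArg (fun g => g.1 y) (hT f)).trans (val_inv _ y)⟩
  have hTp : ∀ {f : SuperFun κ V} {k : ℕ}, HasParity f k → HasParity (T f) k := fun h => by
    rw [HasParity, ← hT, h, map_smul]
  -- An entry of the Jacobi matrix has parity ã + b̃, so moving T F across it trades the sign of
  -- ∂/∂x^b for that of ∂/∂x^a.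
  have hswap : ∀ (b : ι ⊕ κ) (F : SuperFun κ V),
      pderiv a (T (coord b)) * T (twist b F) = twist a (T F) * pderiv a (T (coord b)) := by
    intro b F
    have hp := (hTp (coord_parity (V := V) b)).pderiv a
    ext z
    change (pderiv a (T (coord b))).1 z * (T (twist b F)).1 z = (twist a (T F)).1 z * _
    have hpz := hp.val z
    rcases a with i | j <;> rcases b with i' | j'
    · have e : Grassmann.inv ((pderiv (.inl i) (T (coord (.inl i')))).1 z) = _ :=
        hpz.trans (one_smul ℝ _)
      exact (Grassmann.even_central _ (Grassmann.mem_even_iff.mpr e) _).eq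
    · have e : Grassmann.inv ((pderiv (.inl i) (T (coord (.inr j')))).1 z) = -_ :=
        hpz.trans (by simp [parity]; rfl)
      change _ * (T (inv F)).1 z = (T F).1 z * _
      rw [Grassmann.odd_mul e, hT, val_inv, Grassmann.inv_inv]
    · have e : Grassmann.inv ((pderiv (.inr j) (T (coord (.inl i')))).1 z) = -_ :=
        hpz.trans (by simp [parity]; rfl)
      change _ * (T F).1 z = (inv (T F)).1 z * _
      rw [Grassmann.odd_mul e, val_inv]
    · have e : Grassmann.inv ((pderiv (.inr j) (T (coord (.inr j')))).1 z) = _ :=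
        hpz.trans (by simp [parity]; rfl)
      change _ * (T (inv F)).1 z = (inv (T F)).1 z * _
      rw [(Grassmann.even_central _ (Grassmann.mem_even_iff.mpr e) _).eq, hT]
  -- The difference of the two sides of the chain rule. It is a derivation along the centered
  -- homomorphism `ev.comp T` that kills the coordinates.
  let D : SuperFun κ V →ₗ[ℝ] Grassmann κ' :=
    ev.toLinearMap ∘ₗ (pderiv a ∘ₗ T.toLinearMap -
      ∑ b, LinearMap.mulLeft ℝ (pderiv a (T (coord b))) ∘ₗ T.toLinearMap ∘ₗ pderiv b)
  have hDf : ∀ f, D f = ev (pderiv a (T f) - ∑ b, pderiv a (T (coord b)) * T (pderiv b f)) := by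
    intro f
    simp only [D, LinearMap.comp_apply, LinearMap.sub_apply, LinearMap.sum_apply]
    rfl
  have h := hφ.derivation_eq_zero D (fun g => a.elim (fun _ => g) fun _ => Grassmann.inv g)
    (fun g hg => by rcases a with i | j; exacts [rfl, hg]) ?_ ?_ f
  · rw [hDf, map_sub, sub_eq_zero, map_sum] at h
    exact h
  · intro f g
    have e : (a.elim (fun _ => (ev.comp T) f) fun _ => Grassmann.inv ((ev.comp T) f)) =
        ev (twist a (T f)) := by
      rcases a with i | j
      · rfl
      · exact (val_inv _ y).symm
    have e2 : pderiv a (T (f * g)) - ∑ b, pderiv a (T (coord b)) * T (pderiv b (f * g)) =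
        (pderiv a (T f) - ∑ b, pderiv a (T (coord b)) * T (pderiv b f)) * T g +
          twist a (T f) * (pderiv a (T g) - ∑ b, pderiv a (T (coord b)) * T (pderiv b g)) := by
      simp only [map_mul, pderiv_mul, map_add, mul_add, ← mul_assoc, hswap, Finset.sum_add_distrib,
        sub_mul, mul_sub, Finset.sum_mul, Finset.mul_sum]
      abel
    rw [e, hDf, hDf, hDf, e2, map_add, map_mul, map_mul]
    rfl
  · intro c
    rw [hDf, Finset.sum_eq_single c, pderiv_coord, if_pos rfl, map_one, mul_one, sub_self, map_zero]
    · intro b _ hbc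
      rw [pderiv_coord, if_neg hbc, map_zero, mul_zero]
    · exact fun h => (h (Finset.mem_univ c)).elim

end SuperFun

/-! ### Polynomial functions of a real exponent -/

section PolyFun

variable {A : Type*} [CommRing A] [Algebra ℝ A]

/-- A function of a real variable given by a polynomial with coefficients in an algebra. -/
def IsPolyFun (f : ℝ → A) : Prop :=
  ∃ P : Polynomial A, ∀ w, f w = P.eval (algebraMap ℝ A w)

namespace IsPolyFun

variable {f g : ℝ → A}

theorem const (a : A) : IsPolyFun fun _ => a := ⟨Polynomial.C a, by simp⟩

theorem mul (hf : IsPolyFun f) (hg : IsPolyFun g) : IsPolyFun fun w => f w * g w := by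
  obtain ⟨P, hP⟩ := hf
  obtain ⟨Q, hQ⟩ := hg
  exact ⟨P * Q, fun w => by rw [Polynomial.eval_mul, ← hP, ← hQ]⟩

theorem sub (hf : IsPolyFun f) (hg : IsPolyFun g) : IsPolyFun fun w => f w - g w := by
  obtain ⟨P, hP⟩ := hf
  obtain ⟨Q, hQ⟩ := hg
  exact ⟨P - Q, fun w => by rw [Polynomial.eval_sub, ← hP, ← hQ]⟩

theorem sum {α : Type*} {s : Finset α} {f : α → ℝ → A} (hf : ∀ a ∈ s, IsPolyFun (f a)) :
    IsPolyFun fun w => ∑ a ∈ s, f a w := by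
  choose! P hP using hf
  refine ⟨∑ a ∈ s, P a, fun w => ?_⟩
  rw [Polynomial.eval_finsetSum]
  exact Finset.sum_congr rfl fun a ha => hP a ha w

theorem ofPoly (p : Polynomial ℝ) : IsPolyFun fun w => algebraMap ℝ A (p.eval w) :=
  ⟨p.map (algebraMap ℝ A), fun w => by rw [Polynomial.eval_map, Polynomial.eval₂_hom]⟩

theorem choose_smul (k : ℕ) (a : A) : IsPolyFun fun w : ℝ => Ring.choose w k • a := by
  have h : ∀ w : ℝ, Ring.choose w k =
      (Polynomial.C ((k.factorial : ℝ)⁻¹) * descPochhammer ℝ k).eval w := by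
    intro w
    have h1 := Ring.descPochhammer_eq_factorial_smul_choose w k
    rw [← Polynomial.aeval_eq_smeval, Polynomial.aeval_def, ← Polynomial.eval_map,
      algebraMap_int_eq, descPochhammer_map, nsmul_eq_mul] at h1
    rw [Polynomial.eval_mul, Polynomial.eval_C, h1, inv_mul_cancel_left₀]
    exact_mod_cast k.factorial_ne_zero
  have := (ofPoly (A := A) (Polynomial.C ((k.factorial : ℝ)⁻¹) * descPochhammer ℝ k)).mul
    (const a)
  simpa only [← h, ← Algebra.smul_def] using this

/-- In the coordinates of a basis this is a real polynomial with infinitely many zeros. Even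
integers are used because |g|^{2n} = g^{2n} holds whatever the sign of the body of g. -/
theorem eq_zero_of_even (hf : IsPolyFun f) (h : ∀ n : ℕ, f (2 * n) = 0) (w : ℝ) : f w = 0 := by
  obtain ⟨P, hP⟩ := hf
  let b := Module.Free.chooseBasis ℝ A
  refine b.ext_elem fun i => ?_
  rw [map_zero, Finsupp.zero_apply]
  let φ : A →ₗ[ℝ] ℝ := b.coord i
  change φ (f w) = 0
  let p : Polynomial ℝ := ∑ k ∈ P.support, Polynomial.C (φ (P.coeff k)) * Polynomial.X ^ k
  have hp : ∀ w, φ (f w) = p.eval w := by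
    intro w
    rw [hP, Polynomial.eval_eq_sum, Polynomial.sum, map_sum, Polynomial.eval_finsetSum]
    refine Finset.sum_congr rfl fun k _ => ?_
    rw [← map_pow, mul_comm, ← Algebra.smul_def, map_smul]
    rw [smul_eq_mul, mul_comm, Polynomial.eval_mul, Polynomial.eval_C, Polynomial.eval_pow,
      Polynomial.eval_X]
  have hp0 : p = 0 := by
    refine Polynomial.eq_zero_of_infinite_isRoot p ?_
    refine Set.Infinite.mono (s := Set.range fun n : ℕ => (2 * n : ℝ)) ?_
      (Set.infinite_range_of_injective fun m n hmn => by simpa using hmn)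
    rintro _ ⟨n, rfl⟩
    change p.eval _ = 0
    rw [← hp, h, map_zero]
  rw [hp, hp0, Polynomial.eval_zero]

end IsPolyFun

/-- The truncated binomial series. -/
def binomSum (N : ℕ) (m : A) (w : ℝ) : A := ∑ k ∈ Finset.range N, Ring.choose w k • m ^ k

theorem isPolyFun_binomSum (N : ℕ) (m : A) : IsPolyFun (binomSum N m) :=
  IsPolyFun.sum fun k _ => IsPolyFun.choose_smul k (m ^ k)

/-- Both sums are extended to a common range: the terms added to the truncated series vanish because
m^N = 0, those added to the binomial theorem because (n choose k) = 0 for k > n. -/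
theorem binomSum_natCast {N : ℕ} {m : A} (hm : m ^ N = 0) (n : ℕ) :
    binomSum N m n = (1 + m) ^ n := by
  have h : ∀ K, ∑ k ∈ Finset.range (K + (n + 1)), (n.choose k : ℝ) • m ^ k = (1 + m) ^ n := by
    intro K
    rw [add_comm 1 m, add_pow, eq_comm, Finset.sum_subset (Finset.range_mono (Nat.le_add_left (n + 1) K))]
    · refine Finset.sum_congr rfl fun k _ => ?_
      rw [one_pow, mul_one, mul_comm, Nat.cast_smul_eq_nsmul, nsmul_eq_mul]
    · intro k _ hk
      rw [Finset.mem_range, not_lt] at hk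
      rw [Nat.choose_eq_zero_of_lt hk, Nat.cast_zero, mul_zero]
  rw [← h N, binomSum, Finset.sum_subset (Finset.range_mono (Nat.le_add_right N (n + 1)))]
  · refine Finset.sum_congr rfl fun k _ => ?_
    rw [Ring.choose_natCast]
  · intro k _ hk
    rw [Finset.mem_range, not_lt] at hk
    rw [pow_eq_zero_of_le hk hm, smul_zero]

end PolyFun

/-! ### Powers |g|^w of even elements of a Grassmann algebra. -/

namespace Grassmann

variable {κ : Type*} [Fintype κ]

/-- The normalised nilpotent part of an even element. -/
def nilPart (g : Even κ) : Even κ :=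
  (body g.1)⁻¹ • (g - algebraMap ℝ _ (body g.1))

theorem coe_nilPart (g : Even κ) : (nilPart g : Grassmann κ) =
    (body g.1)⁻¹ • (g.1 - algebraMap ℝ _ (body g.1)) := rfl

theorem nilPart_pow (g : Even κ) : nilPart g ^ (Fintype.card κ + 1) = 0 :=
  Subtype.ext <| pow_eq_zero_of_body _ <| by
    rw [coe_nilPart, map_smul, map_sub, body_algebraMap, sub_self, smul_zero]

theorem one_add_nilPart {g : Even κ} (hg : body g.1 ≠ 0) :
    1 + nilPart g = (body g.1)⁻¹ • g := by
  rw [nilPart, smul_sub, Algebra.algebraMap_eq_smul_one, smul_smul, inv_mul_cancel₀ hg, one_smul,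
    add_sub_cancel]

/-- The power `|g|^w` as an even element. -/
def absPowEven (g : Even κ) (w : ℝ) : Even κ :=
  Real.exp (w * Real.log (body g.1)) • binomSum (Fintype.card κ + 1) (nilPart g) w

theorem coe_absPowEven (g : Even κ) (w : ℝ) : (absPowEven g w : Grassmann κ) = absPow g.1 w := by
  simp only [absPowEven, absPow, binomSum, coe_nilPart, SetLike.val_smul,
    AddSubmonoidClass.coe_finsetSum, SubmonoidClass.coe_pow]

/-- The exponential factors multiply by the additivity of log on the bodies. The remaining identity
between binomial series is polynomial in w, and at natural numbers it says that powers of 1 + n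
multiply, where 1 + n = g / body g. -/
theorem absPow_mul {g h : Even κ} (hg : body g.1 ≠ 0) (hh : body h.1 ≠ 0) (w : ℝ) :
    absPow (g * h : Even κ).1 w = absPow g.1 w * absPow h.1 w := by
  rw [← coe_absPowEven, ← coe_absPowEven, ← coe_absPowEven]
  change _ = ((absPowEven g w * absPowEven h w : Even κ) : Grassmann κ)
  refine congrArg Subtype.val ?_
  have hgh : body (g * h : Even κ).1 = body g.1 * body h.1 := map_mul body _ _
  have hgh0 : body (g * h : Even κ).1 ≠ 0 := by rw [hgh]; exact mul_ne_zero hg hh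
  simp only [absPowEven]
  rw [smul_mul_smul_comm, ← Real.exp_add, ← mul_add, ← Real.log_mul hg hh, ← hgh]
  congr 1
  refine sub_eq_zero.mp (((isPolyFun_binomSum _ _).sub ((isPolyFun_binomSum _ _).mul
    (isPolyFun_binomSum _ _))).eq_zero_of_even (fun n => ?_) w)
  have e : (2 * n : ℝ) = ((2 * n : ℕ) : ℝ) := by push_cast; rfl
  rw [e, binomSum_natCast (nilPart_pow _), binomSum_natCast (nilPart_pow _),
    binomSum_natCast (nilPart_pow _), one_add_nilPart hg, one_add_nilPart hh, one_add_nilPart hgh0,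
    ← mul_pow, smul_mul_smul_comm, hgh, mul_inv, sub_self]

theorem absPow_two {g : Even κ} (hg : body g.1 ≠ 0) : absPowEven g 2 = g ^ 2 := by
  have h := binomSum_natCast (nilPart_pow g) 2
  rw [Nat.cast_ofNat] at h
  rw [absPowEven, h, one_add_nilPart hg, smul_pow, smul_smul, mul_comm (2 : ℝ), Real.exp_mul,
    Real.rpow_two, Real.exp_log_eq_abs hg, sq_abs, inv_pow, mul_inv_cancel₀ (pow_ne_zero 2 hg),
    one_smul]

theorem absPowEven_two_mul_natCast {g : Even κ} (hg : body g.1 ≠ 0) (n : ℕ) :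
    absPowEven g (2 * n) = g ^ (2 * n) := by
  induction n with
  | zero =>
    refine Subtype.ext ?_
    rw [coe_absPowEven, Nat.cast_zero, mul_zero, absPow_zero, Nat.mul_zero, pow_zero]
    rfl
  | succ n ih =>
    rw [mul_add, pow_add, ← ih, mul_one, ← absPow_two hg]
    refine Subtype.ext ?_
    rw [MulMemClass.coe_mul, coe_absPowEven, coe_absPowEven, coe_absPowEven, ← absPow_add,
      Nat.cast_succ, mul_add, mul_one]

/-- An explicit inverse of g, namely g |g|^{-2}. -/
theorem mul_mul_absPowEven {g : Even κ} (hg : body g.1 ≠ 0) : g * (g * absPowEven g (-2)) = 1 := by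
  rw [← mul_assoc, ← sq, ← absPow_two hg]
  refine Subtype.ext ?_
  rw [MulMemClass.coe_mul, coe_absPowEven, coe_absPowEven, ← absPow_add, add_neg_cancel,
    absPow_zero]
  rfl

theorem isUnit_even_iff {g : Even κ} : IsUnit g ↔ body g.1 ≠ 0 := by
  refine ⟨fun h => ?_, fun h => IsUnit.of_mul_eq_one _ (mul_mul_absPowEven h)⟩
  exact (h.map ((body (κ := κ)).comp (Even κ).val)).ne_zero

end Grassmann

/-- Hadamard's lemma at 0, applied K times. It allows an algebra homomorphism to be computed on an
exponential: only the polynomial part survives once s^K is sent to zero, and the values of the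
coefficients do not matter. -/
theorem exists_exp_expansion (K : ℕ) : ∃ (c : ℕ → ℝ) (h : ℝ → ℝ), ContDiff ℝ ∞ h ∧
    ∀ s, Real.exp s = ∑ k ∈ Finset.range K, c k * s ^ k + s ^ K * h s := by
  induction K with
  | zero => exact ⟨0, Real.exp, Real.contDiff_exp, by simp⟩
  | succ K ih =>
    obtain ⟨c, h, hh, hc⟩ := ih
    obtain ⟨L, hL, hLh⟩ := exists_contDiff_clm_eq hh 0
    refine ⟨Function.update c K (h 0), fun s => L s 1, hL.clm_apply contDiff_const, fun s => ?_⟩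
    have e : L s s = s * L s 1 := by
      rw [← smul_eq_mul, ← map_smul, smul_eq_mul, mul_one]
    rw [hc, Finset.sum_range_succ, Function.update_self, hLh s, sub_zero, e, add_assoc]
    refine congrArg₂ _ (Finset.sum_congr rfl fun k hk => ?_) (by ring)
    rw [Function.update_of_ne (Finset.mem_range.mp hk).ne]

/-! ### Powers |J|^w of superfunctions and their images under homomorphisms. -/

namespace SuperFun

variable {ι κ : Type*} [Fintype ι] [Fintype κ] {V : Opens (ι → ℝ)}

theorem contDiffOn_body (J : SuperFun κ V) :
    ContDiffOn ℝ ∞ (fun x => Grassmann.body (extZ J x)) V :=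
  (Grassmann.body (κ := κ)).toLinearMap.toContinuousLinearMap.contDiff.comp_contDiffOn
    (contDiffOn_extZ J)

theorem body_extZ_ne_zero {J : SuperFun κ V} (hJ : ∀ x, Grassmann.body (J.1 x) ≠ 0) :
    ∀ x ∈ V, Grassmann.body (extZ J x) ≠ 0 := fun x hx => by
  rw [extZ_mk _ hx]
  exact hJ _

/-- The nilpotent part `J / b - 1` of a superfunction with non-vanishing body `b`. -/
def nilFun (J : SuperFun κ V) (hJ : ∀ x, Grassmann.body (J.1 x) ≠ 0) : SuperFun κ V :=
  ofReal V _ ((contDiffOn_body J).inv (body_extZ_ne_zero hJ)) * (J - ofReal V _ (contDiffOn_body J))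

/-- The superfunction `|J|^w`. -/
def absPowFun (J : SuperFun κ V) (hJ : ∀ x, Grassmann.body (J.1 x) ≠ 0) (w : ℝ) : SuperFun κ V :=
  ofReal V (fun x => Real.exp (w * Real.log (Grassmann.body (extZ J x))))
      (contDiffOn_const.mul ((contDiffOn_body J).log (body_extZ_ne_zero hJ))).exp *
    ∑ k ∈ Finset.range (Fintype.card κ + 1), Ring.choose w k • nilFun J hJ ^ k

variable {J : SuperFun κ V} (hJ : ∀ x, Grassmann.body (J.1 x) ≠ 0)

theorem val_nilFun (x : V) : (nilFun J hJ).1 x =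
    (Grassmann.body (J.1 x))⁻¹ • (J.1 x - algebraMap ℝ _ (Grassmann.body (J.1 x))) := by
  change algebraMap ℝ _ (Grassmann.body (extZ J x))⁻¹ *
    (J.1 x - algebraMap ℝ _ (Grassmann.body (extZ J x))) = _
  rw [extZ_apply, Algebra.smul_def]

theorem val_absPowFun (w : ℝ) (x : V) : (absPowFun J hJ w).1 x = Grassmann.absPow (J.1 x) w := by
  rw [absPowFun]
  change algebraMap ℝ _ _ * (∑ k ∈ _, _ : SuperFun κ V).1 x = _
  rw [AddSubmonoidClass.coe_finsetSum, Finset.sum_apply, ← Algebra.smul_def]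
  change Real.exp (w * Real.log (Grassmann.body (extZ J x))) • _ = _
  rw [extZ_apply]
  refine congrArg _ (Finset.sum_congr rfl fun k _ => ?_)
  rw [← val_nilFun hJ]
  rfl

theorem absPowFun_parity (hp : HasParity J 0) (w : ℝ) : HasParity (absPowFun J hJ w) 0 := by
  ext x
  rw [val_inv, val_absPowFun, Grassmann.mem_even_iff.mp (Grassmann.absPow_mem_even _
    (Grassmann.mem_even_iff.mpr ((hp.val x).trans (one_smul ℝ _))) w), pow_zero, one_smul,
    val_absPowFun]

variable {κ' : Type*} [Fintype κ'] {φ : SuperFun κ V →ₐ[ℝ] Grassmann κ'} {x₀ : V}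

/-- As u vanishes at the point, φ(u) is nilpotent; the remainder in the expansion of exp(wu) is sent
to zero and the other terms are polynomial in w. -/
theorem IsCentered.map_exp (hφ : IsCentered φ x₀) {u : (ι → ℝ) → ℝ} (hu : ContDiffOn ℝ ∞ u V)
    (hu0 : u x₀ = 0) : ∃ P : ℝ → Grassmann.Even κ', IsPolyFun P ∧
      ∀ w : ℝ, φ (ofReal V (fun x => Real.exp (w * u x)) (contDiffOn_const.mul hu).exp) = P w := by
  obtain ⟨c, h, hh, hc⟩ := exists_exp_expansion (Fintype.card κ' + 1)
  let U : Grassmann.Even κ' := ⟨φ (ofReal V u hu), Grassmann.mem_even_iff.mpr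
    ((hφ.inv_apply (ofReal_parity u hu)).trans (one_smul ℝ _))⟩
  have hU : φ (ofReal V u hu) ^ (Fintype.card κ' + 1) = 0 := by
    refine Grassmann.pow_eq_zero_of_body _ ?_
    rw [hφ.body_apply, val_ofReal, hu0, map_zero, map_zero]
  refine ⟨fun w => ∑ k ∈ Finset.range (Fintype.card κ' + 1), (c k * w ^ k) • U ^ k,
    IsPolyFun.sum fun k _ => ?_, fun w => ?_⟩
  · have := (IsPolyFun.ofPoly (A := Grassmann.Even κ')
      (Polynomial.C (c k) * Polynomial.X ^ k)).mul (IsPolyFun.const (U ^ k))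
    refine Eq.subst (motive := IsPolyFun) (funext fun w => ?_) this
    rw [Polynomial.eval_mul, Polynomial.eval_C, Polynomial.eval_pow, Polynomial.eval_X,
      Algebra.smul_def]
  · have hhw : ContDiffOn ℝ ∞ (fun x => w ^ (Fintype.card κ' + 1) * h (w * u x)) V :=
      contDiffOn_const.mul (hh.comp_contDiffOn (contDiffOn_const.mul hu))
    have e : ofReal V (fun x => Real.exp (w * u x)) (contDiffOn_const.mul hu).exp =
        ∑ k ∈ Finset.range (Fintype.card κ' + 1), (c k * w ^ k) • (ofReal V u hu : SuperFun κ V) ^ k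
          + ofReal V u hu ^ (Fintype.card κ' + 1) * ofReal V _ hhw := by
      ext x
      change _ = (∑ k ∈ _, _ : SuperFun κ V).1 x +
        (algebraMap ℝ (Grassmann κ) (u x)) ^ (Fintype.card κ' + 1) * algebraMap ℝ _ _
      rw [AddSubmonoidClass.coe_finsetSum, Finset.sum_apply, val_ofReal, hc, map_add, map_sum,
        ← map_pow, ← map_mul]
      refine congrArg₂ _ (Finset.sum_congr rfl fun k _ => ?_) (congrArg _ (by ring))
      change _ = (c k * w ^ k) • (algebraMap ℝ (Grassmann κ) (u x)) ^ k
      rw [Algebra.smul_def, ← map_pow, ← map_mul]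
      exact congrArg _ (by ring)
    rw [e, map_add, map_mul, map_pow, hU, zero_mul, add_zero, map_sum,
      AddSubmonoidClass.coe_finsetSum]
    refine Finset.sum_congr rfl fun k _ => ?_
    rw [map_smul, map_pow]
    rfl

/-- Powers of superfunctions commute with homomorphisms. -/
theorem IsCentered.map_absPowFun (hφ : IsCentered φ x₀) (hp : HasParity J 0) (w : ℝ) :
    φ (absPowFun J hJ w) = Grassmann.absPow (φ J) w := by
  set b₀ := Grassmann.body (J.1 x₀) with hb₀
  -- Subtracting log |b₀| produces a function that vanishes at x₀, so that `map_exp` applies; the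
  -- constant factor |b₀|^w is common to both sides.
  have hu : ContDiffOn ℝ ∞ (fun x => Real.log (Grassmann.body (extZ J x)) - Real.log b₀) V :=
    ((contDiffOn_body J).log (body_extZ_ne_zero hJ)).sub contDiffOn_const
  obtain ⟨P, hP, hPφ⟩ := hφ.map_exp hu (by rw [extZ_apply, sub_self])
  have hev : ∀ {f : SuperFun κ V}, HasParity f 0 → φ f ∈ Grassmann.Even κ' := fun hf =>
    Grassmann.mem_even_iff.mpr ((hφ.inv_apply hf).trans (one_smul ℝ _))
  have hnp : HasParity (nilFun J hJ) 0 := by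
    have h1 : HasParity (ofReal V _ (contDiffOn_body J) : SuperFun κ V) 0 := ofReal_parity _ _
    have h2 : HasParity (J - ofReal V _ (contDiffOn_body J)) 0 := by
      rw [sub_eq_add_neg, ← neg_one_smul ℝ (ofReal V _ (contDiffOn_body J) : SuperFun κ V)]
      exact hp.add (h1.smul _)
    exact (ofReal_parity (κ := κ) _
      ((contDiffOn_body J).inv (body_extZ_ne_zero hJ))).mul h2
  let g : Grassmann.Even κ' := ⟨φ J, hev hp⟩
  let n : Grassmann.Even κ' := ⟨φ (nilFun J hJ), hev hnp⟩
  have hg : Grassmann.body g.1 = b₀ := hφ.body_apply J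
  have hg0 : Grassmann.body g.1 ≠ 0 := hg ▸ hJ x₀
  have e1 : ∀ w, φ (absPowFun J hJ w) =
      (Real.exp (w * Real.log b₀) • (P w * binomSum (Fintype.card κ + 1) n w) :
        Grassmann.Even κ') := by
    intro w
    have : ofReal V (fun x => Real.exp (w * Real.log (Grassmann.body (extZ J x))))
        (contDiffOn_const.mul ((contDiffOn_body J).log (body_extZ_ne_zero hJ))).exp =
        Real.exp (w * Real.log b₀) • (ofReal V (fun x => Real.exp (w *
          (Real.log (Grassmann.body (extZ J x)) - Real.log b₀))) (contDiffOn_const.mul hu).exp :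
            SuperFun κ V) := by
      ext x
      change _ = Real.exp (w * Real.log b₀) • algebraMap ℝ (Grassmann κ) _
      rw [Algebra.smul_def, ← map_mul, ← Real.exp_add, val_ofReal]
      exact congrArg _ (congrArg _ (by ring))
    rw [absPowFun, this, map_mul, map_smul, hPφ, map_sum, smul_mul_assoc]
    simp only [binomSum, map_smul, map_pow, SetLike.val_smul, MulMemClass.coe_mul,
      AddSubmonoidClass.coe_finsetSum, SubmonoidClass.coe_pow]
    rfl
  have e2 : Grassmann.absPow (φ J) w = (Grassmann.absPowEven g w : Grassmann κ') :=
    (Grassmann.coe_absPowEven g w).symm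
  rw [e1, e2]
  refine congrArg Subtype.val ?_
  rw [Grassmann.absPowEven, hg]
  -- Both sides are now polynomial in w. At w = 2m the superfunction |J|^w is J^{2m}, whose image
  -- under φ is φ(J)^{2m}.
  refine congrArg _ (sub_eq_zero.mp (((hP.mul (isPolyFun_binomSum _ _)).sub
    (isPolyFun_binomSum _ _)).eq_zero_of_even (fun m => ?_) w))
  rw [sub_eq_zero]
  refine smul_right_injective _ (Real.exp_ne_zero (2 * m * Real.log b₀)) (Subtype.ext ?_)
  refine (e1 (2 * m)).symm.trans ?_
  have h1 : absPowFun J hJ (2 * m) = J ^ (2 * m) := by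
    ext x
    rw [val_absPowFun]
    let gx : Grassmann.Even κ := ⟨J.1 x, Grassmann.mem_even_iff.mpr
      ((hp.val x).trans (one_smul ℝ _))⟩
    exact (Grassmann.coe_absPowEven gx _).symm.trans
      (congrArg Subtype.val (Grassmann.absPowEven_two_mul_natCast (g := gx) (hJ x) m))
  have h2 := Grassmann.absPowEven_two_mul_natCast hg0 m
  rw [Grassmann.absPowEven, hg] at h2
  rw [h1, map_pow]
  exact (congrArg Subtype.val h2).symm

end SuperFun

/-! ## The Berezinian -/

/-- A commutative ring `E`, embedded in `R` by `i`, as the even part of `R` with respect to the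
parity automorphism `σ`, odd elements being anticommutative. -/
structure IsEvenPart {E R : Type*} [CommRing E] [Ring R] (i : E →+* R) (σ : R →+* R) : Prop where
  injective : Function.Injective i
  exists_eq : ∀ r, σ r = r → ∃ e, i e = r
  map_apply : ∀ e, σ (i e) = i e
  anticomm : ∀ x y, σ x = -x → σ y = -y → x * y = -(y * x)
  mul_self : ∀ x, σ x = -x → x * x = 0

namespace IsEvenPart

variable {E R : Type*} [CommRing E] [Ring R] {i : E →+* R} {σ : R →+* R}
  {m n : Type*} [Fintype m] [Fintype n] [DecidableEq m] [DecidableEq n]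

theorem matrix_injective (h : IsEvenPart i σ) {X Y : Matrix m n E} (hXY : X.map i = Y.map i) :
    X = Y := Matrix.map_injective h.injective hXY

theorem exists_matrix (h : IsEvenPart i σ) {X : Matrix m n R} (hX : X.map σ = X) :
    ∃ Y : Matrix m n E, Y.map i = X := by
  choose f hf using fun a b => h.exists_eq (X a b) (congrFun (congrFun hX a) b)
  exact ⟨f, by ext a b; exact hf a b⟩

theorem matrix_map (h : IsEvenPart i σ) (X : Matrix m n E) : (X.map i).map σ = X.map i := by
  ext a b
  exact h.map_apply _

theorem exists_mul (h : IsEvenPart i σ) {B : Matrix m n R} {C : Matrix n m R}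
    (hB : B.map σ = -B) (hC : C.map σ = -C) : ∃ Y : Matrix m m E, Y.map i = B * C :=
  h.exists_matrix (by rw [Matrix.map_mul, hB, hC, Matrix.neg_mul, Matrix.mul_neg, neg_neg])

theorem map_inv_mul {X : Matrix m m E} (hX : IsUnit X.det) : (X⁻¹).map i * X.map i = 1 := by
  rw [← Matrix.map_mul, Matrix.nonsing_inv_mul _ hX, Matrix.map_one _ (map_zero i) (map_one i)]

theorem map_mul_inv {X : Matrix m m E} (hX : IsUnit X.det) : X.map i * (X⁻¹).map i = 1 := by
  rw [← Matrix.map_mul, Matrix.mul_nonsing_inv _ hX, Matrix.map_one _ (map_zero i) (map_one i)]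

theorem map_one_add (X : Matrix m m E) : (1 + X).map i = 1 + X.map i := by
  rw [Matrix.map_add _ (map_add i), Matrix.map_one _ (map_zero i) (map_one i)]

theorem inv_intertwine {B : Matrix m n R} {X : Matrix m m E} {Y : Matrix n n E}
    (hX : IsUnit X.det) (hY : IsUnit Y.det) (hXY : X.map i * B = B * Y.map i) :
    (X⁻¹).map i * B = B * (Y⁻¹).map i := by
  calc (X⁻¹).map i * B = (X⁻¹).map i * (B * (Y.map i * (Y⁻¹).map i)) := by
        rw [map_mul_inv hY, Matrix.mul_one]
    _ = (X⁻¹).map i * (X.map i * B) * (Y⁻¹).map i := by simp only [hXY, Matrix.mul_assoc]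
    _ = B * (Y⁻¹).map i := by rw [← Matrix.mul_assoc, map_inv_mul hX, Matrix.one_mul]

/-- With c the only non-zero entry of the second matrix, both products are of rank one. The
determinants are 1 + b c and 1 + c b = 1 - b c with b = B k j, and their product is 1 because c² =
0. -/
theorem det_single (h : IsEvenPart i σ) {B : Matrix m n R} (hB : B.map σ = -B) {c : R}
    (hc : σ c = -c) (j : n) (k : m) {X : Matrix m m E} {Y : Matrix n n E}
    (hX : X.map i = B * Matrix.single j k c) (hY : Y.map i = Matrix.single j k c * B) :
    (1 + X).det * (1 + Y).det = 1 := by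
  have hBe : ∀ a b, σ (B a b) = -B a b := fun a b => congrFun (congrFun hB a) b
  choose u hu using fun a b => h.exists_eq (B a b * c) (by rw [map_mul, hBe, hc, neg_mul_neg])
  choose v hv using fun a b => h.exists_eq (c * B a b) (by rw [map_mul, hBe, hc, neg_mul_neg])
  have eX : X = Matrix.replicateCol Unit (fun a => u a j) *
      Matrix.replicateRow Unit (Pi.single k (1 : E)) := by
    refine h.matrix_injective ?_
    rw [hX]
    ext a b
    rw [Matrix.mul_apply, Matrix.map_apply, Matrix.mul_apply]
    by_cases hkb : k = b
    · subst hkb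
      simp [hu, Matrix.single_apply]
    · simp [Matrix.single_apply, hkb, Ne.symm hkb]
  have eY : Y = Matrix.replicateCol Unit (Pi.single j (1 : E)) *
      Matrix.replicateRow Unit (fun b => v k b) := by
    refine h.matrix_injective ?_
    rw [hY]
    ext a b
    rw [Matrix.mul_apply, Matrix.map_apply, Matrix.mul_apply]
    by_cases hja : j = a
    · subst hja
      simp [hv, Matrix.single_apply]
    · simp [Matrix.single_apply, hja, Ne.symm hja]
  rw [eX, eY, Matrix.det_one_add_replicateCol_mul_replicateRow,
    Matrix.det_one_add_replicateCol_mul_replicateRow, single_one_dotProduct, dotProduct_single_one]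
  refine h.injective ?_
  have hac := h.anticomm c (B k j) hc (hBe k j)
  rw [map_mul, map_add, map_add, map_one, hu, hv, hac, add_mul, mul_add, mul_add, one_mul, one_mul,
    mul_one, mul_neg, mul_assoc, ← mul_assoc c, hac, neg_mul, mul_assoc (B k j) c c,
    h.mul_self c hc]
  simp

/-- `det (1 + BC) det (1 + CB) = 1` for odd matrices `B`, `C`. -/
theorem det_mul_det (h : IsEvenPart i σ) {B : Matrix m n R} {C : Matrix n m R}
    (hB : B.map σ = -B) (hC : C.map σ = -C) {X : Matrix m m E} {Y : Matrix n n E}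
    (hX : X.map i = B * C) (hY : Y.map i = C * B) : (1 + X).det * (1 + Y).det = 1 := by
  -- Quantifying over all B makes the claim additive in C. With B' = (1 + BC₁)⁻¹B = B(1 + C₁B)⁻¹,
  -- which is again odd, one has 1 + B(C₁ + C₂) = (1 + BC₁)(1 + B'C₂) and 1 + (C₁ + C₂)B = (1 +
  -- C₂B')(1 + C₁B). So C may be split into its single entries.
  let P : Matrix n m R → Prop := fun C => C.map σ = -C ∧ ∀ (B : Matrix m n R), B.map σ = -B →
    ∀ (X : Matrix m m E) (Y : Matrix n n E), X.map i = B * C → Y.map i = C * B →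
      (1 + X).det * (1 + Y).det = 1
  have hadd : ∀ C₁ C₂, P C₁ → P C₂ → P (C₁ + C₂) := by
    rintro C₁ C₂ ⟨o₁, h₁⟩ ⟨o₂, h₂⟩
    refine ⟨by rw [Matrix.map_add _ (map_add σ), o₁, o₂, neg_add], fun B hB X Y hX hY => ?_⟩
    obtain ⟨X₁, hX₁⟩ := h.exists_mul hB o₁
    obtain ⟨Y₁, hY₁⟩ := h.exists_mul o₁ hB
    have d₁ := h₁ B hB X₁ Y₁ hX₁ hY₁
    have uX : IsUnit (1 + X₁).det := IsUnit.of_mul_eq_one _ d₁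
    have uY : IsUnit (1 + Y₁).det := IsUnit.of_mul_eq_one_right _ d₁
    have hint : ((1 + X₁)⁻¹).map i * B = B * ((1 + Y₁)⁻¹).map i := by
      refine inv_intertwine uX uY ?_
      rw [map_one_add, map_one_add, hX₁, hY₁, Matrix.add_mul, Matrix.mul_add, Matrix.one_mul,
        Matrix.mul_one, Matrix.mul_assoc]
    have hB' : (((1 + X₁)⁻¹).map i * B).map σ = -(((1 + X₁)⁻¹).map i * B) := by
      rw [Matrix.map_mul, h.matrix_map, hB, Matrix.mul_neg]
    obtain ⟨X₂, hX₂⟩ := h.exists_mul hB' o₂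
    obtain ⟨Y₂, hY₂⟩ := h.exists_mul o₂ hB'
    have d₂ := h₂ _ hB' X₂ Y₂ hX₂ hY₂
    have e1 : 1 + X = (1 + X₁) * (1 + X₂) := by
      refine h.matrix_injective ?_
      rw [Matrix.map_mul, map_one_add X₂, hX₂, Matrix.mul_add, Matrix.mul_one, ← Matrix.mul_assoc,
        ← Matrix.mul_assoc, map_mul_inv uX, Matrix.one_mul, map_one_add, map_one_add, hX, hX₁,
        Matrix.mul_add, add_assoc]
    have e2 : 1 + Y = (1 + Y₂) * (1 + Y₁) := by
      refine h.matrix_injective ?_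
      rw [Matrix.map_mul, map_one_add Y₂, hY₂, hint, Matrix.add_mul, Matrix.one_mul,
        Matrix.mul_assoc, Matrix.mul_assoc, map_inv_mul uY, Matrix.mul_one, map_one_add,
        map_one_add, hY, hY₁, Matrix.add_mul, add_assoc]
    rw [e1, e2, Matrix.det_mul, Matrix.det_mul]
    linear_combination (1 + X₂).det * (1 + Y₂).det * d₁ + d₂
  have hzero : P 0 := by
    refine ⟨by rw [Matrix.map_zero _ (map_zero σ), neg_zero], fun B _ X Y hX hY => ?_⟩
    have e1 : X = 0 := h.matrix_injective (by
      rw [hX, Matrix.mul_zero, Matrix.map_zero _ (map_zero i)])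
    have e2 : Y = 0 := h.matrix_injective (by
      rw [hY, Matrix.zero_mul, Matrix.map_zero _ (map_zero i)])
    rw [e1, e2, add_zero, add_zero, Matrix.det_one, Matrix.det_one, one_mul]
  have hP : P C := by
    rw [Matrix.matrix_eq_sum_single C]
    refine Finset.sum_induction _ P hadd hzero fun j _ => Finset.sum_induction _ P hadd hzero
      fun k _ => ?_
    have hc : σ (C j k) = -C j k := congrFun (congrFun hC j) k
    refine ⟨?_, fun B hB X Y hX hY => h.det_single hB hc j k hX hY⟩
    rw [Matrix.map_single _ _ _ σ, hc]
    exact map_neg (Matrix.singleAddMonoidHom j k) (C j k)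
  exact hP.2 B hB X Y hX hY

end IsEvenPart

/-- `β` is the Berezinian of the block matrix `X`, expressed by a factorisation of `X` in an upper
triangular, a block diagonal and a lower triangular matrix. -/
structure IsBer {E R : Type*} [CommRing E] [Ring R] (i : E →+* R) {m n : Type*} [Fintype m]
    [Fintype n] [DecidableEq m] [DecidableEq n] (X : Matrix (m ⊕ n) (m ⊕ n) R) (β : E)
    (a : Matrix m m E) (d : Matrix n n E) (B : Matrix m n R) (C : Matrix n m R) : Prop where
  isUnit : IsUnit d.det
  eq : X = Matrix.fromBlocks (a.map i + B * d.map i * C) (B * d.map i) (d.map i * C) (d.map i)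
  mul_det : β * d.det = a.det

/-- An even block matrix: even diagonal blocks, odd off-diagonal blocks. -/
structure IsEvenBlock {R : Type*} [Ring R] (σ : R →+* R) {m n : Type*}
    (X : Matrix (m ⊕ n) (m ⊕ n) R) : Prop where
  map₁₁ : X.toBlocks₁₁.map σ = X.toBlocks₁₁
  map₁₂ : X.toBlocks₁₂.map σ = -X.toBlocks₁₂
  map₂₁ : X.toBlocks₂₁.map σ = -X.toBlocks₂₁
  map₂₂ : X.toBlocks₂₂.map σ = X.toBlocks₂₂

section Ber

variable {E R : Type*} [CommRing E] [Ring R] {i : E →+* R} {σ : R →+* R}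
  {m n : Type*} [Fintype m] [Fintype n] [DecidableEq m] [DecidableEq n]

/-- The factorisation contains no inverses, so it passes along any compatible pair of homomorphisms;
this is how Berezinians of superfunctions are evaluated. -/
theorem IsBer.map {E' R' : Type*} [CommRing E'] [Ring R'] {i' : E' →+* R'} (f : E →+* E')
    (g : R →+* R') (hfg : ∀ e, g (i e) = i' (f e)) {X : Matrix (m ⊕ n) (m ⊕ n) R} {β : E}
    {a : Matrix m m E} {d : Matrix n n E} {B : Matrix m n R} {C : Matrix n m R}
    (h : IsBer i X β a d B C) :
    IsBer i' (X.map g) (f β) (a.map f) (d.map f) (B.map g) (C.map g) := by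
  have hd : (d.map f).det = f d.det := (RingHom.map_det f d).symm
  have ha : (a.map f).det = f a.det := (RingHom.map_det f a).symm
  have hdg : (d.map i).map g = (d.map f).map i' := by ext; exact hfg _
  have hag : (a.map i).map g = (a.map f).map i' := by ext; exact hfg _
  refine ⟨hd ▸ h.isUnit.map f, ?_, by rw [hd, ha, ← map_mul, h.mul_det]⟩
  rw [h.eq, Matrix.fromBlocks_map, Matrix.map_add _ (map_add g), Matrix.map_mul, Matrix.map_mul,
    Matrix.map_mul, hdg, hag]

/-- Block elimination with pivot the odd-odd block D: the factors are BD⁻¹, D⁻¹C and the Schur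
complement A - BD⁻¹C. -/
theorem IsEvenPart.exists_isBer (h : IsEvenPart i σ) {X : Matrix (m ⊕ n) (m ⊕ n) R}
    (hX : IsEvenBlock σ X) (hu : ∀ d : Matrix n n E, d.map i = X.toBlocks₂₂ → IsUnit d.det) :
    ∃ β a d B C, IsBer i X β a d B C ∧ B.map σ = -B ∧ C.map σ = -C := by
  obtain ⟨d, hd⟩ := h.exists_matrix hX.map₂₂
  have ud := hu d hd
  have hB : (X.toBlocks₁₂ * (d⁻¹).map i).map σ = -(X.toBlocks₁₂ * (d⁻¹).map i) := by
    rw [Matrix.map_mul, hX.map₁₂, h.matrix_map, Matrix.neg_mul]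
  have hC : ((d⁻¹).map i * X.toBlocks₂₁).map σ = -((d⁻¹).map i * X.toBlocks₂₁) := by
    rw [Matrix.map_mul, hX.map₂₁, h.matrix_map, Matrix.mul_neg]
  obtain ⟨a, ha⟩ := h.exists_matrix (X := X.toBlocks₁₁ - X.toBlocks₁₂ * (d⁻¹).map i * X.toBlocks₂₁)
    (by rw [Matrix.map_sub _ (map_sub σ), hX.map₁₁, Matrix.map_mul, hB, hX.map₂₁, Matrix.neg_mul,
      Matrix.mul_neg, neg_neg])
  refine ⟨a.det * d⁻¹.det, a, d, _, _, ⟨ud, ?_, ?_⟩, hB, hC⟩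
  · have e1 : X.toBlocks₁₂ * (d⁻¹).map i * d.map i = X.toBlocks₁₂ := by
      rw [Matrix.mul_assoc, map_inv_mul ud, Matrix.mul_one]
    rw [e1, ← Matrix.mul_assoc, ← Matrix.mul_assoc, map_mul_inv ud, Matrix.one_mul, ha,
      sub_add_cancel, hd, Matrix.fromBlocks_toBlocks]
  · rw [mul_assoc, ← Matrix.det_mul, Matrix.nonsing_inv_mul _ ud, Matrix.det_one, mul_one]

/-- Only the product of the lower triangular factor of X with the upper triangular factor of X' must
be factored anew. With x = B'C and y = CB', its diagonal blocks are 1 - B'(1 + y)⁻¹C = (1 + x)⁻¹ and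
1 + y. Their determinants coincide by `det_mul_det`, so this middle factor has Berezinian 1. -/
theorem IsEvenPart.isBer_mul (h : IsEvenPart i σ) {X X' : Matrix (m ⊕ n) (m ⊕ n) R} {β β' : E}
    {a a' : Matrix m m E} {d d' : Matrix n n E} {B B' : Matrix m n R} {C C' : Matrix n m R}
    (hX : IsBer i X β a d B C) (hX' : IsBer i X' β' a' d' B' C') (hC : C.map σ = -C)
    (hB' : B'.map σ = -B') :
    ∃ a d B C, IsBer i (X * X') (β * β') a d B C := by
  obtain ⟨x, hx⟩ := h.exists_mul hB' hC
  obtain ⟨y, hy⟩ := h.exists_mul hC hB'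
  have hxy := h.det_mul_det hB' hC hx hy
  have ux : IsUnit (1 + x).det := IsUnit.of_mul_eq_one _ hxy
  have uy : IsUnit (1 + y).det := IsUnit.of_mul_eq_one_right _ hxy
  have hint : ((1 + x)⁻¹).map i * B' = B' * ((1 + y)⁻¹).map i := by
    refine IsEvenPart.inv_intertwine ux uy ?_
    rw [IsEvenPart.map_one_add, IsEvenPart.map_one_add, hx, hy, Matrix.add_mul, Matrix.mul_add,
      Matrix.one_mul, Matrix.mul_one, Matrix.mul_assoc]
  have hdet : (1 + x)⁻¹.det = (1 + y).det := by
    refine ux.mul_left_cancel ?_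
    rw [hxy, ← Matrix.det_mul, Matrix.mul_nonsing_inv _ ux, Matrix.det_one]
  have hxi : ((1 + x)⁻¹).map i = 1 - B' * ((1 + y)⁻¹).map i * C := by
    rw [eq_sub_iff_add_eq, ← hint, Matrix.mul_assoc, ← hx]
    have := IsEvenPart.map_inv_mul (i := i) ux
    rwa [IsEvenPart.map_one_add, Matrix.mul_add, Matrix.mul_one] at this
  have ud := IsEvenPart.map_mul_inv (i := i) hX.isUnit
  have ud' := IsEvenPart.map_mul_inv (i := i) hX'.isUnit
  have vd := IsEvenPart.map_inv_mul (i := i) hX.isUnit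
  have vd' := IsEvenPart.map_inv_mul (i := i) hX'.isUnit
  have vy := IsEvenPart.map_inv_mul (i := i) uy
  have uy' := IsEvenPart.map_mul_inv (i := i) uy
  have hyC : C * B' = (1 + y).map i - 1 := by
    rw [IsEvenPart.map_one_add, hy, add_sub_cancel_left]
  refine ⟨a * (1 + x)⁻¹ * a', d * (1 + y) * d',
    B + a.map i * B' * ((1 + y)⁻¹).map i * (d⁻¹).map i,
    C' + (d'⁻¹).map i * ((1 + y)⁻¹).map i * C * a'.map i, ?_, ?_, ?_⟩
  · rw [Matrix.det_mul, Matrix.det_mul]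
    exact (hX.isUnit.mul uy).mul hX'.isUnit
  · have e12 : (B + a.map i * B' * ((1 + y)⁻¹).map i * (d⁻¹).map i) * (d * (1 + y) * d').map i =
        a.map i * B' * d'.map i + B * d.map i * (1 + y).map i * d'.map i := by
      rw [Matrix.map_mul, Matrix.map_mul, Matrix.add_mul, add_comm]
      congr 1
      · calc _ = a.map i * B' * (((1 + y)⁻¹).map i * ((d⁻¹).map i * d.map i) * (1 + y).map i) *
              d'.map i := by simp only [Matrix.mul_assoc]
          _ = _ := by rw [vd, Matrix.mul_one, vy, Matrix.mul_one]
      · simp only [Matrix.mul_assoc]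
    have e21 : (d * (1 + y) * d').map i * (C' + (d'⁻¹).map i * ((1 + y)⁻¹).map i * C * a'.map i) =
        d.map i * C * a'.map i + d.map i * (1 + y).map i * d'.map i * C' := by
      rw [Matrix.map_mul, Matrix.map_mul, Matrix.mul_add, add_comm]
      congr 1
      calc _ = d.map i * ((1 + y).map i * (d'.map i * (d'⁻¹).map i) * ((1 + y)⁻¹).map i) * C *
              a'.map i := by simp only [Matrix.mul_assoc]
          _ = _ := by rw [ud', Matrix.mul_one, uy', Matrix.mul_one]
    have e11 : a.map i * B' * d'.map i * ((d'⁻¹).map i * ((1 + y)⁻¹).map i * C * a'.map i) =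
        a.map i * a'.map i - (a * (1 + x)⁻¹ * a').map i := by
      calc _ = a.map i * B' * (d'.map i * (d'⁻¹).map i) * ((1 + y)⁻¹).map i * C * a'.map i := by
            simp only [Matrix.mul_assoc]
          _ = _ := by
            rw [ud', Matrix.mul_one, Matrix.map_mul, Matrix.map_mul, hxi, Matrix.mul_sub,
              Matrix.sub_mul, Matrix.mul_one, sub_sub_cancel]
            simp only [Matrix.mul_assoc]
    have e11' : B * d.map i * (1 + y).map i * d'.map i *
        ((d'⁻¹).map i * ((1 + y)⁻¹).map i * C * a'.map i) = B * d.map i * C * a'.map i := by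
      calc _ = B * d.map i * ((1 + y).map i * (d'.map i * (d'⁻¹).map i) * ((1 + y)⁻¹).map i) * C *
              a'.map i := by simp only [Matrix.mul_assoc]
          _ = _ := by rw [ud', Matrix.mul_one, uy', Matrix.mul_one]
    have e22 : d.map i * C * (B' * d'.map i) = d.map i * (1 + y).map i * d'.map i -
        d.map i * d'.map i := by
      calc _ = d.map i * (C * B') * d'.map i := by simp only [Matrix.mul_assoc]
          _ = _ := by rw [hyC, Matrix.mul_sub, Matrix.mul_one, Matrix.sub_mul]
    rw [e12, e21, hX.eq, hX'.eq, Matrix.fromBlocks_multiply]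
    congr 1
    · rw [Matrix.mul_add _ C', Matrix.add_mul _ _ (_ * C * _), e11, e11', Matrix.add_mul,
        Matrix.mul_add, Matrix.mul_add, Matrix.add_mul]
      have : B * d.map i * C * (B' * d'.map i * C') = B * d.map i * (1 + y).map i * d'.map i * C' -
          B * d.map i * (d'.map i * C') := by
        have := congrArg (fun Z => B * Z * C') e22
        simp only [Matrix.mul_sub, Matrix.sub_mul, Matrix.mul_assoc] at this ⊢
        exact this
      rw [this]
      simp only [Matrix.mul_assoc]
      abel
    · rw [Matrix.add_mul]
      have := congrArg (fun Z => B * Z) e22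
      simp only [Matrix.mul_sub, Matrix.mul_assoc] at this ⊢
      rw [this]
      abel
    · rw [Matrix.mul_add]
      have := congrArg (fun Z => Z * C') e22
      simp only [Matrix.sub_mul, Matrix.mul_assoc] at this ⊢
      rw [this]
      abel
    · rw [e22, Matrix.map_mul, Matrix.map_mul, sub_add_cancel]
  · rw [Matrix.det_mul, Matrix.det_mul, Matrix.det_mul, Matrix.det_mul, hdet, ← hX.mul_det,
      ← hX'.mul_det]
    ring

end Ber

section Parity

variable {m n : Type*}

theorem IsEvenBlock.of_parity {R : Type*} [Ring R] [Module ℝ R] {σ : R →+* R}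
    {X : Matrix (m ⊕ n) (m ⊕ n) R}
    (h : ∀ a b, σ (X a b) = (-1 : ℝ) ^ (SuperFun.parity a + SuperFun.parity b) • X a b) :
    IsEvenBlock σ X := by
  refine ⟨?_, ?_, ?_, ?_⟩ <;> ext a b
  · exact (h (.inl a) (.inl b)).trans (by simp [SuperFun.parity]; rfl)
  · exact (h (.inl a) (.inr b)).trans (by simp [SuperFun.parity]; rfl)
  · exact (h (.inr a) (.inl b)).trans (by simp [SuperFun.parity]; rfl)
  · exact (h (.inr a) (.inr b)).trans (by simp [SuperFun.parity]; rfl)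

end Parity

/-! ### Berezinians over a Grassmann algebra. -/

namespace Grassmann

variable {κ : Type*}

theorem isEvenPart : IsEvenPart (Even κ).val.toRingHom (inv (κ := κ)).toRingHom where
  injective := Subtype.val_injective
  exists_eq r hr := ⟨⟨r, mem_even_iff.mpr hr⟩, rfl⟩
  map_apply e := inv_coe_even e
  anticomm x y hx hy := by
    rw [odd_mul hx, show inv y = -y from hy, neg_mul]
  mul_self x hx := by
    refine eq_zero_of_eq_neg ?_
    conv_lhs => rw [odd_mul hx, show inv x = -x from hx, neg_mul]

variable {m n : Type*} [Fintype m] [Fintype n] [DecidableEq m] [DecidableEq n]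

theorem evenProj_add (x y : Grassmann κ) : evenProj (x + y) = evenProj x + evenProj y :=
  Subtype.ext (map_add (GradedRing.proj (CliffordAlgebra.evenOdd (0 : QuadraticForm ℝ (κ →₀ ℝ))) 0) x y)

/-- Any factorisation computes `ber`: its diagonal factors are recovered as the odd-odd block and
the Schur complement. -/
theorem ber_eq {X : Matrix (m ⊕ n) (m ⊕ n) (Grassmann κ)} {β : Even κ} {a : Matrix m m (Even κ)}
    {d : Matrix n n (Even κ)} {B : Matrix m n (Grassmann κ)} {C : Matrix n m (Grassmann κ)}
    (h : IsBer (Even κ).val.toRingHom X β a d B C) : ber X = β := by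
  have hd : X.toBlocks₂₂.map evenProj = d := by
    rw [h.eq, Matrix.toBlocks_fromBlocks₂₂]
    ext a b
    exact congrArg Subtype.val (evenProj_coe _)
  have hBC : X.toBlocks₁₂ * (d⁻¹).map Subtype.val * X.toBlocks₂₁ =
      B * d.map (Even κ).val.toRingHom * C := by
    rw [h.eq, Matrix.toBlocks_fromBlocks₁₂, Matrix.toBlocks_fromBlocks₂₁, Matrix.mul_assoc B]
    have : d.map (Even κ).val.toRingHom * (d⁻¹).map Subtype.val = 1 :=
      IsEvenPart.map_mul_inv h.isUnit
    rw [this, Matrix.mul_one, Matrix.mul_assoc]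
  rw [ber, hd, hBC]
  have ha : X.toBlocks₁₁.map evenProj - (B * d.map (Even κ).val.toRingHom * C).map evenProj = a := by
    rw [h.eq, Matrix.toBlocks_fromBlocks₁₁]
    ext i j
    rw [Matrix.sub_apply, Matrix.map_apply, Matrix.map_apply, Matrix.add_apply, evenProj_add,
      add_sub_cancel_right]
    exact congrArg Subtype.val (evenProj_coe _)
  simp only [ha]
  rw [← h.mul_det, mul_assoc, ← Matrix.det_mul, Matrix.mul_nonsing_inv _ h.isUnit, Matrix.det_one,
    mul_one]

theorem ber_one : ber (1 : Matrix (m ⊕ n) (m ⊕ n) (Grassmann κ)) = 1 := by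
  refine ber_eq (a := 1) (d := 1) (B := 0) (C := 0) ⟨?_, ?_, ?_⟩
  · rw [Matrix.det_one]
    exact isUnit_one
  · rw [Matrix.map_one _ (map_zero _) (map_one _), Matrix.map_one _ (map_zero _) (map_one _),
      Matrix.zero_mul, Matrix.zero_mul, Matrix.mul_zero, add_zero, Matrix.fromBlocks_one]
  · rw [Matrix.det_one, Matrix.det_one, mul_one]

/-- An even block matrix with entries in a Grassmann algebra, whose odd-odd block is invertible. -/
structure IsInvBlock [Fintype κ] (X : Matrix (m ⊕ n) (m ⊕ n) (Grassmann κ)) : Prop where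
  parity : ∀ a b, inv (X a b) = (-1 : ℝ) ^ (SuperFun.parity a + SuperFun.parity b) • X a b
  det_ne_zero : (X.toBlocks₂₂.map body).det ≠ 0

variable [Fintype κ]

theorem IsInvBlock.exists_isBer {X : Matrix (m ⊕ n) (m ⊕ n) (Grassmann κ)} (hX : IsInvBlock X) :
    ∃ β a d B C, IsBer (Even κ).val.toRingHom X β a d B C ∧
      B.map (inv (κ := κ)).toRingHom = -B ∧ C.map (inv (κ := κ)).toRingHom = -C := by
  refine isEvenPart.exists_isBer (IsEvenBlock.of_parity hX.parity) fun d hd => ?_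
  rw [isUnit_even_iff]
  have h := RingHom.map_det ((body (κ := κ)).comp (Even κ).val).toRingHom d
  have h' : ((body (κ := κ)).comp (Even κ).val).toRingHom.mapMatrix d = X.toBlocks₂₂.map body := by
    rw [← hd]
    rfl
  rw [h'] at h
  exact h.trans_ne hX.det_ne_zero

theorem ber_mul {X Y : Matrix (m ⊕ n) (m ⊕ n) (Grassmann κ)} (hX : IsInvBlock X)
    (hY : IsInvBlock Y) : ber (X * Y) = ber X * ber Y := by
  obtain ⟨β, a, d, B, C, h, -, hC⟩ := hX.exists_isBer
  obtain ⟨β', a', d', B', C', h', hB', -⟩ := hY.exists_isBer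
  obtain ⟨a'', d'', B'', C'', h''⟩ := isEvenPart.isBer_mul h h' hC hB'
  rw [ber_eq h, ber_eq h', ber_eq h'']

/-- Bodies of odd entries vanish, so the odd-odd corner of the body of XY = 1 expresses that the
body of the block D of X has a right inverse. -/
theorem IsInvBlock.of_mul_eq_one {X Y : Matrix (m ⊕ n) (m ⊕ n) (Grassmann κ)}
    (hX : ∀ a b, inv (X a b) = (-1 : ℝ) ^ (SuperFun.parity a + SuperFun.parity b) • X a b)
    (hXY : X * Y = 1) : IsInvBlock X := by
  refine ⟨hX, ?_⟩
  have h := congrArg (fun Z => (Matrix.map Z body).toBlocks₂₂) hXY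
  simp only [Matrix.map_mul] at h
  have h21 : (X.map body).toBlocks₂₁ = 0 := by
    ext a b
    exact body_of_odd ((hX (.inr a) (.inl b)).trans (by simp [SuperFun.parity]))
  rw [← Matrix.fromBlocks_toBlocks (X.map body), ← Matrix.fromBlocks_toBlocks (Y.map body),
    Matrix.fromBlocks_multiply, Matrix.toBlocks_fromBlocks₂₂, h21, Matrix.zero_mul, zero_add,
    Matrix.map_one _ (map_zero _) (map_one _), ← Matrix.fromBlocks_one,
    Matrix.toBlocks_fromBlocks₂₂] at h
  have h' := congrArg Matrix.det h
  rw [Matrix.det_mul, Matrix.det_one] at h'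
  exact left_ne_zero_of_mul_eq_one h'

end Grassmann

/-! ### Berezinians of matrices of superfunctions. -/

namespace SuperFun

variable {ι κ : Type*} [Fintype ι] [Fintype κ] {V : Opens (ι → ℝ)}

/-- Evaluation of superfunctions at a point of the underlying domain. -/
def ev (x : V) : SuperFun κ V →ₐ[ℝ] Grassmann κ :=
  (Pi.evalAlgHom ℝ (fun _ => Grassmann κ) x).comp (SuperFun κ V).val

theorem ev_apply (x : V) (f : SuperFun κ V) : ev x f = f.1 x := rfl

theorem ev_inv (x : V) (f : SuperFun κ V) : ev x (inv f) = Grassmann.inv (ev x f) := val_inv f x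

/-- The parity operator as a ring homomorphism. -/
def invHom : SuperFun κ V →+* SuperFun κ V where
  toFun := inv
  map_one' := inv_one
  map_zero' := map_zero inv
  map_mul' := inv_mul
  map_add' := map_add inv

/-- The subring of even superfunctions. -/
def evenFun (κ : Type*) [Fintype κ] (V : Opens (ι → ℝ)) : Subring (SuperFun κ V) :=
  RingHom.eqLocus invHom (RingHom.id _)

theorem mem_evenFun {f : SuperFun κ V} : f ∈ evenFun κ V ↔ inv f = f := Iff.rfl

theorem parity_zero_iff {f : SuperFun κ V} : HasParity f 0 ↔ inv f = f := by
  rw [HasParity, pow_zero, one_smul]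

instance : CommRing (evenFun κ V) where
  mul_comm f g := Subtype.ext <| by
    have h := (parity_zero_iff.mpr f.2).mul_comm (parity_zero_iff.mpr g.2)
    rwa [mul_zero, pow_zero, one_smul] at h

theorem isEvenPart : IsEvenPart (evenFun κ V).subtype (invHom (V := V) (κ := κ)) where
  injective := Subtype.val_injective
  exists_eq f hf := ⟨⟨f, hf⟩, rfl⟩
  map_apply e := e.2
  anticomm f g hf hg := by
    ext x
    have e : ∀ {f : SuperFun κ V}, invHom f = -f → Grassmann.inv (f.1 x) = -f.1 x := fun {f} hf =>
      (val_inv f x).symm.trans (congrArg (fun g : SuperFun κ V => g.1 x) hf)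
    exact Grassmann.isEvenPart.anticomm _ _ (e hf) (e hg)
  mul_self f hf := by
    ext x
    exact Grassmann.isEvenPart.mul_self _
      ((val_inv f x).symm.trans (congrArg (fun g : SuperFun κ V => g.1 x) hf))

/-- A superfunction with non-vanishing body is invertible. -/
theorem isUnit_of_body {f : SuperFun κ V} (hf : ∀ x, Grassmann.body (f.1 x) ≠ 0) : IsUnit f := by
  let b : SuperFun κ V := ofReal V _ (contDiffOn_body f)
  have hb : IsUnit b := by
    let b' : SuperFun κ V := ofReal V _ ((contDiffOn_body f).inv (body_extZ_ne_zero hf))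
    have h : ∀ x : V, Grassmann.body (extZ f x) ≠ 0 := fun x => body_extZ_ne_zero hf x x.2
    refine ⟨⟨b, b', ?_, ?_⟩, rfl⟩ <;> ext x
    · change algebraMap ℝ (Grassmann κ) _ * algebraMap ℝ (Grassmann κ) _ = 1
      rw [← map_mul]
      exact (congrArg _ (mul_inv_cancel₀ (h x))).trans (map_one _)
    · change algebraMap ℝ (Grassmann κ) _ * algebraMap ℝ (Grassmann κ) _ = 1
      rw [← map_mul]
      exact (congrArg _ (inv_mul_cancel₀ (h x))).trans (map_one _)
  have hn : IsNilpotent (f - b) := by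
    refine ⟨Fintype.card κ + 1, ?_⟩
    ext x
    refine Grassmann.pow_eq_zero_of_body (f.1 x - algebraMap ℝ _ (Grassmann.body (extZ f x))) ?_
    rw [extZ_apply, map_sub, Grassmann.body_algebraMap, sub_self]
  have hc : Commute (f - b) b := by
    ext x
    exact (Algebra.commutes (Grassmann.body (extZ f x)) ((f - b).1 x)).symm
  simpa using hn.isUnit_add_left_of_commute hb hc

theorem isUnit_evenFun {f : evenFun κ V} (hf : ∀ x, Grassmann.body (f.1.1 x) ≠ 0) : IsUnit f := by
  obtain ⟨u, hu⟩ := isUnit_of_body hf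
  have h1 : f.1 * u⁻¹.1 = 1 := by rw [← hu, Units.mul_inv]
  have h2 : f.1 * inv u⁻¹.1 = 1 := by
    rw [← mem_evenFun.mp f.2, ← inv_mul, h1, inv_one]
  have h3 : inv u⁻¹.1 = u⁻¹.1 := by
    rw [← hu] at h1 h2
    exact u.isUnit.mul_left_cancel (h2.trans h1.symm)
  have h4 : f * ⟨u⁻¹.1, h3⟩ = 1 := Subtype.ext h1
  exact ⟨⟨f, _, h4, (mul_comm _ _).trans h4⟩, rfl⟩

variable {m n : Type*} [Fintype m] [Fintype n] [DecidableEq m] [DecidableEq n]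

/-- The Berezinian of an invertible even matrix of superfunctions is a superfunction. -/
theorem exists_ber {X : Matrix (m ⊕ n) (m ⊕ n) (SuperFun κ V)}
    (hX : ∀ x, Grassmann.IsInvBlock (X.map (ev x))) :
    ∃ β : SuperFun κ V, HasParity β 0 ∧ ∀ φ : SuperFun κ V →ₐ[ℝ] Grassmann κ,
      (∀ f, φ (inv f) = Grassmann.inv (φ f)) → φ β = Grassmann.ber (X.map φ) := by
  have hXp : ∀ a b, invHom (X a b) = (-1 : ℝ) ^ (parity a + parity b) • X a b := by
    intro a b
    ext x
    exact (val_inv _ x).trans ((hX x).parity a b)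
  obtain ⟨β, a, d, B, C, h, -, -⟩ := isEvenPart.exists_isBer (IsEvenBlock.of_parity hXp)
    fun d hd => by
      refine isUnit_evenFun fun x => ?_
      let f : evenFun κ V →+* ℝ :=
        (((Grassmann.body (κ := κ)).comp (ev x)).toRingHom).comp (evenFun κ V).subtype
      have h := RingHom.map_det f d
      have h' : f.mapMatrix d = (X.map (ev x)).toBlocks₂₂.map Grassmann.body := by
        have := congrArg (fun Z => Matrix.map Z ((Grassmann.body (κ := κ)).comp (ev x))) hd
        exact this
      rw [h'] at h
      exact h.trans_ne (hX x).det_ne_zero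
  -- The factorisation over superfunctions is carried along φ, so one β serves both for evaluation
  -- at a point and for a change of coordinates followed by evaluation.
  refine ⟨β, parity_zero_iff.mpr β.2, fun φ hφ => ?_⟩
  let f : evenFun κ V →+* Grassmann.Even κ :=
    { toFun := fun e => ⟨φ e.1, Grassmann.mem_even_iff.mpr (by rw [← hφ, mem_evenFun.mp e.2])⟩
      map_one' := Subtype.ext (map_one φ)
      map_zero' := Subtype.ext (map_zero φ)
      map_mul' := fun _ _ => Subtype.ext (map_mul φ _ _)
      map_add' := fun _ _ => Subtype.ext (map_add φ _ _) }
  have := Grassmann.ber_eq (h.map (i' := (Grassmann.Even κ).val.toRingHom) f φ.toRingHom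
    fun _ => rfl)
  exact (congrArg Subtype.val this).symm

end SuperFun

theorem SuperFun.res_coord {ι κ : Type*} [Fintype ι] [Fintype κ] {V V' : Opens (ι → ℝ)}
    (h : V' ≤ V) (a : ι ⊕ κ) : res h (coord a : SuperFun κ V) = coord a := by
  ext x
  rw [val_res]
  rcases a with i | j <;> rfl

/-! ### Changes of coordinates at a point, Jacobi matrices and the cocycle |J|^w. -/

namespace Supermanifold

open SuperFun

universe u v

variable {p q : ℕ} (M : Supermanifold.{u, v} p q)

section Point

variable {M} {W W' : Opens M.carrier}

/-- The coordinates of a point of `W` in the chart `i`. -/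
def pt (i : M.Idx) (hi : (W : Set M.carrier) ⊆ (M.chart i).source) {z : M.carrier} (hz : z ∈ W) :
    chartImage (M.chart i) W :=
  ⟨M.chart i z, (M.chart i).map_source (hi hz), by
    change (M.chart i).symm (M.chart i z) ∈ W
    rwa [(M.chart i).left_inv (hi hz)]⟩

theorem exists_pt (i : M.Idx) (hi : (W : Set M.carrier) ⊆ (M.chart i).source)
    (y : chartImage (M.chart i) W) : ∃ (z : M.carrier) (hz : z ∈ W), y = pt i hi hz :=
  ⟨(M.chart i).symm y, y.2.2, Subtype.ext ((M.chart i).right_inv y.2.1).symm⟩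

variable (i j k : M.Idx) (hi : (W : Set M.carrier) ⊆ (M.chart i).source)
  (hj : (W : Set M.carrier) ⊆ (M.chart j).source) (hk : (W : Set M.carrier) ⊆ (M.chart k).source)

theorem res_pt (h : W' ≤ W) {z : M.carrier} (hz : z ∈ W')
    (f : SuperFun (Fin q) (chartImage (M.chart i) W)) :
    (res (chartImage_mono (M.chart i) h) f).1 (pt i (fun _ hx => hi (h hx)) hz) =
      f.1 (pt i hi (h hz)) :=
  val_res _ f _

/-- Near a point where its body is non-zero a superfunction is invertible, and homomorphisms
preserve invertibility. The restriction to a smaller open set uses the compatibility `change_res`.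
-/
theorem body_change_ne_zero {z : M.carrier} (hz : z ∈ W)
    {f : SuperFun (Fin q) (chartImage (M.chart j) W)}
    (hf : Grassmann.body (f.1 (pt j hj hz)) ≠ 0) :
    Grassmann.body ((M.change i j W hi hj f).1 (pt i hi hz)) ≠ 0 := by
  have hO : IsOpen ((chartImage (M.chart j) W : Set (Fin p → ℝ)) ∩
      (fun x => Grassmann.body (extZ f x)) ⁻¹' {0}ᶜ) :=
    (contDiffOn_body f).continuousOn.isOpen_inter_preimage (chartImage (M.chart j) W).isOpen
      isOpen_compl_singleton
  let W' : Opens M.carrier := ⟨_, (M.chart j).isOpen_inter_preimage hO⟩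
  have h : W' ≤ W := fun x hx => by
    have := hx.2.1.2
    change (M.chart j).symm (M.chart j x) ∈ W at this
    rwa [(M.chart j).left_inv hx.1] at this
  have hz' : z ∈ W' := by
    refine ⟨hj hz, (pt j hj hz).2, ?_⟩
    change Grassmann.body (extZ f (pt j hj hz)) ≠ 0
    rwa [extZ_apply]
  have hu : IsUnit (res (chartImage_mono (M.chart j) h) f) := by
    refine isUnit_of_body fun x => ?_
    rw [val_res, ← extZ_mk]
    have := x.2.2.2.2
    change Grassmann.body (extZ f (M.chart j ((M.chart j).symm x))) ≠ 0 at this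
    rwa [(M.chart j).right_inv x.2.1] at this
  have hu' := hu.map ((Grassmann.body.comp (ev (pt i (fun _ hx => hi (h hx)) hz'))).comp
    (M.change i j W' (fun _ hx => hi (h hx)) (fun _ hx => hj (h hx))))
  rw [AlgHom.comp_apply, M.change_res i j W W' h hi hj, AlgHom.comp_apply, ev_apply, res_pt] at hu'
  exact hu'.ne_zero

theorem change_change (f : SuperFun (Fin q) (chartImage (M.chart k) W)) :
    M.change i j W hi hj (M.change j k W hj hk f) = M.change i k W hi hk f :=
  congrArg (· f) (M.change_comp i j k W hi hj hk)

theorem change_self_apply (f : SuperFun (Fin q) (chartImage (M.chart i) W)) :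
    M.change i i W hi hi f = f :=
  congrArg (· f) (M.change_self i W hi)

/-- A change of coordinates lies over the point map. If f had another value in the chart i, then f -
r, with r its value in the chart j, would have non-zero body in the chart i; the change back would
preserve this, although f - r vanishes at the point in the chart j. -/
theorem body_change {z : M.carrier} (hz : z ∈ W)
    (f : SuperFun (Fin q) (chartImage (M.chart j) W)) :
    Grassmann.body ((M.change i j W hi hj f).1 (pt i hi hz)) =
      Grassmann.body (f.1 (pt j hj hz)) := by
  set r := Grassmann.body (f.1 (pt j hj hz)) with hr
  by_contra hne
  have h0 : Grassmann.body ((M.change i j W hi hj (f - algebraMap ℝ _ r)).1 (pt i hi hz)) ≠ 0 := by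
    rw [map_sub, AlgHom.commutes]
    change Grassmann.body (_ - algebraMap ℝ (Grassmann (Fin q)) r) ≠ 0
    rwa [map_sub, Grassmann.body_algebraMap, sub_ne_zero]
  have h1 := body_change_ne_zero j i hj hi hz h0
  rw [change_change, change_self_apply] at h1
  refine h1 ?_
  change Grassmann.body (_ - algebraMap ℝ (Grassmann (Fin q)) r) = 0
  rw [map_sub, Grassmann.body_algebraMap, hr, sub_self]

/-- The change of coordinates followed by the evaluation at a point. -/
def changeAt {z : M.carrier} (hz : z ∈ W) :
    SuperFun (Fin q) (chartImage (M.chart j) W) →ₐ[ℝ] Grassmann (Fin q) :=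
  (ev (pt i hi hz)).comp (M.change i j W hi hj)

theorem changeAt_isCentered {z : M.carrier} (hz : z ∈ W) :
    IsCentered (changeAt i j hi hj hz) (pt j hj hz) :=
  ⟨body_change i j hi hj hz, fun f => by
    rw [changeAt, AlgHom.comp_apply, M.change_parity, ev_inv]
    rfl⟩

theorem change_hasParity {f : SuperFun (Fin q) (chartImage (M.chart j) W)} {n : ℕ}
    (hf : SuperFun.HasParity f n) : SuperFun.HasParity (M.change i j W hi hj f) n := by
  rw [SuperFun.HasParity, ← M.change_parity, hf, map_smul]

/-- The Jacobi matrix of a change of coordinates over an open set. -/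
def jac : Matrix (Fin p ⊕ Fin q) (Fin p ⊕ Fin q) (SuperFun (Fin q) (chartImage (M.chart i) W)) :=
  fun a b => pderiv a (M.change i j W hi hj (coord b))

theorem jac_parity (a b : Fin p ⊕ Fin q) :
    SuperFun.HasParity (jac i j hi hj a b) (parity a + parity b) := by
  have h := (change_hasParity i j hi hj (coord_parity (κ := Fin q) b)).pderiv a
  rwa [add_comm] at h

theorem jac_map_res (h : W' ≤ W) :
    (jac i j hi hj).map (res (chartImage_mono (M.chart i) h)) =
      jac i j (fun _ hx => hi (h hx)) (fun _ hx => hj (h hx)) := by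
  ext1 a b
  rw [Matrix.map_apply, jac, ← pderiv_res, ← M.change_res i j W W' h hi hj, res_coord]
  rfl

theorem jac_map_ev (h : W' ≤ W) {z : M.carrier} (hz : z ∈ W') :
    (jac i j (fun _ hx => hi (h hx)) (fun _ hx => hj (h hx))).map
        (ev (pt i (fun _ hx => hi (h hx)) hz)) = (jac i j hi hj).map (ev (pt i hi (h hz))) := by
  rw [← jac_map_res i j hi hj h]
  ext1 a b
  exact res_pt i hi h hz _

theorem jac_self : jac i i hi hi = 1 := by
  ext1 a b
  rw [jac, change_self_apply, pderiv_coord, Matrix.one_apply]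

/-- The chain rule. -/
theorem jac_mul {z : M.carrier} (hz : z ∈ W) :
    (jac i j hi hj).map (ev (pt i hi hz)) * (jac j k hj hk).map (changeAt i j hi hj hz) =
      (jac i k hi hk).map (ev (pt i hi hz)) := by
  ext1 a c
  rw [Matrix.mul_apply, Matrix.map_apply, jac, ← change_change i j k hi hj hk]
  exact (pderiv_map (M.change i j W hi hj) (pt i hi hz) (pt j hj hz) (M.change_parity i j W hi hj)
    (body_change i j hi hj hz) a _).symm

/-- The chain rule for the change of coordinates and its inverse gives a right inverse of the Jacobi
matrix. -/
theorem jac_isInvBlock {z : M.carrier} (hz : z ∈ W) :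
    Grassmann.IsInvBlock ((jac i j hi hj).map (ev (pt i hi hz))) := by
  refine Grassmann.IsInvBlock.of_mul_eq_one (Y := (jac j i hj hi).map (changeAt i j hi hj hz))
    (fun a b => (jac_parity i j hi hj a b).val _) ?_
  rw [jac_mul, jac_self, Matrix.map_one _ (map_zero _) (map_one _)]

/-- Invertibility depends on bodies only, and on these `changeAt` agrees with evaluation in the
chart j. -/
theorem jac_isInvBlock_changeAt {z : M.carrier} (hz : z ∈ W) :
    Grassmann.IsInvBlock ((jac j k hj hk).map (changeAt i j hi hj hz)) := by
  refine ⟨fun a b => (changeAt_isCentered i j hi hj hz).inv_apply (jac_parity j k hj hk a b), ?_⟩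
  convert (jac_isInvBlock j k hj hk hz).det_ne_zero using 2
  ext a b
  exact (changeAt_isCentered i j hi hj hz).body_apply _

theorem exists_jacFun : ∃ β : SuperFun (Fin q) (chartImage (M.chart i) W),
    SuperFun.HasParity β 0 ∧
      ∀ φ : SuperFun (Fin q) (chartImage (M.chart i) W) →ₐ[ℝ] Grassmann (Fin q),
        (∀ f, φ (inv f) = Grassmann.inv (φ f)) → φ β = Grassmann.ber ((jac i j hi hj).map φ) := by
  refine SuperFun.exists_ber fun y => ?_
  obtain ⟨z, hz, rfl⟩ := exists_pt i hi y
  exact jac_isInvBlock i j hi hj hz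

/-- The Jacobian as a superfunction. -/
def jacFun : SuperFun (Fin q) (chartImage (M.chart i) W) := (exists_jacFun i j hi hj).choose

theorem jacFun_parity : SuperFun.HasParity (jacFun i j hi hj) 0 :=
  (exists_jacFun i j hi hj).choose_spec.1

theorem val_jacFun {z : M.carrier} (hz : z ∈ W) : (jacFun i j hi hj).1 (pt i hi hz) =
    Grassmann.ber ((jac i j hi hj).map (ev (pt i hi hz))) :=
  (exists_jacFun i j hi hj).choose_spec.2 _ (ev_inv _)

theorem changeAt_jacFun {z : M.carrier} (hz : z ∈ W) :
    changeAt i j hi hj hz (jacFun j k hj hk) =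
      Grassmann.ber ((jac j k hj hk).map (changeAt i j hi hj hz)) :=
  (exists_jacFun j k hj hk).choose_spec.2 _ (changeAt_isCentered i j hi hj hz).map_inv

theorem overlap_left : (M.overlap i j : Set M.carrier) ⊆ (M.chart i).source := inter_subset_left

theorem overlap_right : (M.overlap i j : Set M.carrier) ⊆ (M.chart j).source := inter_subset_right

theorem jacobian_eq {z : M.carrier} (h : W ≤ M.overlap i j) (hz : z ∈ W) :
    (M.jacobian i j (pt i (overlap_left i j) (h hz))).1 = (jacFun i j hi hj).1 (pt i hi hz) := by
  rw [val_jacFun, jac_map_ev i j (overlap_left i j) (overlap_right i j) h hz]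
  rfl

theorem ber_jac_mul {z : M.carrier} (hz : z ∈ W) :
    Grassmann.ber ((jac i j hi hj).map (ev (pt i hi hz))) *
      Grassmann.ber ((jac j k hj hk).map (changeAt i j hi hj hz)) =
      Grassmann.ber ((jac i k hi hk).map (ev (pt i hi hz))) := by
  rw [← Grassmann.ber_mul (jac_isInvBlock i j hi hj hz) (jac_isInvBlock_changeAt i j k hi hj hk hz),
    jac_mul]

theorem isUnit_ber_jac {z : M.carrier} (hz : z ∈ W) :
    IsUnit (Grassmann.ber ((jac i j hi hj).map (ev (pt i hi hz)))) := by
  have h := ber_jac_mul i j i hi hj hi hz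
  rw [jac_self, Matrix.map_one _ (map_zero _) (map_one _), Grassmann.ber_one] at h
  exact IsUnit.of_mul_eq_one _ h

theorem body_jacFun_ne_zero (y : chartImage (M.chart i) W) :
    Grassmann.body ((jacFun i j hi hj).1 y) ≠ 0 := by
  obtain ⟨z, hz, rfl⟩ := exists_pt i hi y
  rw [val_jacFun]
  exact Grassmann.isUnit_even_iff.mp (isUnit_ber_jac i j hi hj hz)

/-- The factor `|J|^w` as a superfunction. -/
def jacPow (w : ℝ) : SuperFun (Fin q) (chartImage (M.chart i) W) :=
  absPowFun (jacFun i j hi hj) (body_jacFun_ne_zero i j hi hj) w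

theorem jacPow_parity (w : ℝ) : SuperFun.HasParity (jacPow i j hi hj w) 0 :=
  absPowFun_parity _ (jacFun_parity i j hi hj) w

theorem val_jacPow {z : M.carrier} (h : W ≤ M.overlap i j) (hz : z ∈ W) (w : ℝ) :
    (jacPow i j hi hj w).1 (pt i hi hz) =
      Grassmann.absPow (M.jacobian i j (pt i (overlap_left i j) (h hz))).1 w := by
  rw [jacPow, val_absPowFun, jacobian_eq i j hi hj h hz]

/-- The cocycle property of `|J|^w`. -/
theorem jacPow_mul {z : M.carrier} (hz : z ∈ W) (w : ℝ) :
    (jacPow i j hi hj w).1 (pt i hi hz) * changeAt i j hi hj hz (jacPow j k hj hk w) =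
      (jacPow i k hi hk w).1 (pt i hi hz) := by
  rw [jacPow, jacPow, jacPow, (changeAt_isCentered i j hi hj hz).map_absPowFun _
    (jacFun_parity j k hj hk), val_absPowFun, val_absPowFun, val_jacFun, val_jacFun,
    changeAt_jacFun, ← ber_jac_mul i j k hi hj hk hz, Grassmann.absPow_mul]
  · exact Grassmann.isUnit_even_iff.mp (isUnit_ber_jac i j hi hj hz)
  · rw [← changeAt_jacFun i j k hi hj hk hz, (changeAt_isCentered i j hi hj hz).body_apply]
    exact body_jacFun_ne_zero j k hj hk _

end Point

end Supermanifold

theorem Grassmann.absPow_one {κ : Type*} [Fintype κ] (w : ℝ) :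
    Grassmann.absPow (1 : Grassmann κ) w = 1 := by
  rw [Grassmann.absPow, Finset.sum_range_succ', Finset.sum_eq_zero]
  · simp
  · intro k _
    rw [map_one, map_one, sub_self, smul_zero, zero_pow k.succ_ne_zero, smul_zero]

/-- By the hypotheses the derived brackets are again momentum-free, so they commute with the
arguments, as `derived_jacobiator` requires. -/
theorem SuperFun.derived_jacobiator_toCot {ι κ : Type*} [Fintype ι] [Fintype κ] [DecidableEq ι]
    {V : Opens (ι → ℝ)} {Θ : SuperFun (κ ⊕ κ) (cot V)}
    {a b c ab ca bc ac abc cab bca : SuperFun κ V} {k l m : ℕ} (hΘ : HasParity Θ 1)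
    (ha : HasParity a k) (hb : HasParity b l) (hc : HasParity c m)
    (hab : toCot ab = poisson (poisson Θ (toCot a)) (toCot b))
    (hca : toCot ca = poisson (poisson Θ (toCot c)) (toCot a))
    (hbc : toCot bc = poisson (poisson Θ (toCot b)) (toCot c))
    (hac : toCot ac = poisson (poisson Θ (toCot a)) (toCot c))
    (habc : toCot abc = poisson (poisson Θ (toCot ab)) (toCot c))
    (hcab : toCot cab = poisson (poisson Θ (toCot ca)) (toCot b))
    (hbca : toCot bca = poisson (poisson Θ (toCot bc)) (toCot a)) :
    toCot ((-1 : ℝ) ^ (k * m) • abc + (-1 : ℝ) ^ (m * l) • cab + (-1 : ℝ) ^ (l * k) • bca) =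
      ((-1 : ℝ) ^ (k * m) / 2) • poisson (poisson (poisson (poisson Θ Θ) (toCot a)) (toCot b))
        (toCot c) := by
  have hp : ∀ {f : SuperFun κ V} {k : ℕ}, HasParity f k → HasParity (toCot f) k := fun h => h.pull _
  have hd := derived_jacobiator hΘ (hp ha) (hp hb) (hp hc) (poisson_toCot_toCot _ _) (by rw [← hbc, poisson_toCot_toCot])
    (by rw [← hac, poisson_toCot_toCot])
  rw [← hab, ← hca, ← hbc, ← habc, ← hcab, ← hbca] at hd
  rw [map_add, map_add, map_smul, map_smul, map_smul, hd]

/-! ### Densities supported in one chart. -/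

namespace Supermanifold

open SuperFun

universe u v

variable {p q : ℕ} {M : Supermanifold.{u, v} p q}

section Glue

variable (i j k : M.Idx) (F : SuperFun (Fin q) (M.dom i)) (w : ℝ)

/-- The coefficient in the chart `j` of the density of weight `w` with the coefficient `F` in the
chart `i`, over an open subset of the overlap of the charts. -/
def spreadOn {W : Opens M.carrier} (hj : (W : Set M.carrier) ⊆ (M.chart j).source)
    (hi : (W : Set M.carrier) ⊆ (M.chart i).source) :
    SuperFun (Fin q) (chartImage (M.chart j) W) :=
  M.change j i W hj hi (res (M.chartImage_le_dom i W) F) * jacPow j i hj hi w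

theorem spreadOn_parity {n : ℕ} (hF : SuperFun.HasParity F n) {W : Opens M.carrier}
    (hj : (W : Set M.carrier) ⊆ (M.chart j).source)
    (hi : (W : Set M.carrier) ⊆ (M.chart i).source) :
    SuperFun.HasParity (spreadOn i j F w hj hi) n := by
  refine (change_hasParity j i hj hi (f := res _ F) ?_).mul (jacPow_parity j i hj hi w)
  ext x
  rw [val_inv, val_res, hF.val]
  exact congrArg _ (val_res _ F x).symm

theorem val_spreadOn {W : Opens M.carrier} (h : W ≤ M.overlap j i)
    (hj : (W : Set M.carrier) ⊆ (M.chart j).source)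
    (hi : (W : Set M.carrier) ⊆ (M.chart i).source) {z : M.carrier} (hz : z ∈ W) :
    (spreadOn i j F w hj hi).1 (pt j hj hz) =
      (spreadOn i j F w (overlap_left j i) (overlap_right j i)).1
        (pt j (overlap_left j i) (h hz)) := by
  change (M.change j i W hj hi (res (M.chartImage_le_dom i W) F)).1 (pt j hj hz) *
    (jacPow j i hj hi w).1 (pt j hj hz) = (M.change j i _ _ _ (res _ F)).1 _ * (jacPow j i _ _ w).1 _
  have e : res (M.chartImage_le_dom i W) F = res (chartImage_mono (M.chart i) h)
      (res (M.chartImage_le_dom i (M.overlap j i)) F) := by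
    ext x
    rw [val_res, val_res, val_res]
  rw [val_jacPow j i hj hi h hz, val_jacPow j i (overlap_left j i) (overlap_right j i) le_rfl, e]
  congr 1
  rw [M.change_res j i (M.overlap j i) W h (overlap_left j i) (overlap_right j i), val_res]
  rfl

theorem spreadOn_self {W : Opens M.carrier} (hi : (W : Set M.carrier) ⊆ (M.chart i).source)
    {z : M.carrier} (hz : z ∈ W) :
    (spreadOn i i F w hi hi).1 (pt i hi hz) = extZ F (M.chart i z) := by
  change (M.change i i W hi hi (res _ F)).1 _ * (absPowFun _ _ w).1 _ = _
  rw [change_self_apply, val_absPowFun, val_jacFun, jac_self,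
    Matrix.map_one _ (map_zero _) (map_one _), Grassmann.ber_one]
  change _ * Grassmann.absPow 1 w = _
  rw [Grassmann.absPow_one, mul_one]
  rfl

/-- The transformation law between the charts j and k over a set inside all three charts: the
cocycle properties of the changes of coordinates and of |J|^w. -/
theorem changeAt_spreadOn {W : Opens M.carrier} (hj : (W : Set M.carrier) ⊆ (M.chart j).source)
    (hk : (W : Set M.carrier) ⊆ (M.chart k).source)
    (hi : (W : Set M.carrier) ⊆ (M.chart i).source) {z : M.carrier} (hz : z ∈ W) :
    changeAt j k hj hk hz (spreadOn i k F w hk hi) * (jacPow j k hj hk w).1 (pt j hj hz) =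
      (spreadOn i j F w hj hi).1 (pt j hj hz) := by
  have e := (jacPow_parity j k hj hk w).val (pt j hj hz)
  rw [pow_zero, one_smul] at e
  rw [spreadOn, map_mul, mul_assoc,
    ← (Grassmann.even_central _ (Grassmann.mem_even_iff.mpr e) _).eq, jacPow_mul]
  change (M.change j k W hj hk (M.change k i W hk hi (res _ F))).1 _ * _ = _
  rw [change_change]
  rfl

variable {F} {K : Set M.carrier}

/-- On the overlap, F vanishes near the corresponding point of the chart i because K is closed, and
changes of coordinates are local; off the overlap the value is zero by the convention for `extZ`. -/
theorem extZ_spreadOn (hK : IsClosed K)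
    (hF : ∀ z ∈ (M.chart i).source, z ∉ K → extZ F (M.chart i z) = 0) {x : Fin p → ℝ}
    (hxK : (M.chart j).symm x ∉ K) :
    extZ (spreadOn i j F w (overlap_left j i) (overlap_right j i)) x = 0 := by
  by_cases hxo : x ∈ chartImage (M.chart j) (M.overlap j i)
  · rw [extZ_mk _ hxo]
    obtain ⟨z, hz, hxz⟩ := exists_pt j (overlap_left j i) ⟨x, hxo⟩
    have hxz' : x = M.chart j z := congrArg Subtype.val hxz
    rw [hxz', (M.chart j).left_inv hz.1] at hxK
    rw [hxz]
    refine (mul_eq_zero_of_left ?_ _ : _ * _ = (0 : Grassmann (Fin q)))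
    refine (changeAt_isCentered j i (overlap_left j i) (overlap_right j i) hz).apply_eq_zero ?_
    have hz' : M.chart i z ∈ (M.chart i).target := (M.chart i).map_source hz.2
    have hc := (M.chart i).continuousAt_symm hz'
    have hn : Kᶜ ∈ nhds ((M.chart i).symm (M.chart i z)) := by
      rw [(M.chart i).left_inv hz.2]
      exact hK.isOpen_compl.mem_nhds hxK
    change ∀ᶠ x in nhds (M.chart i z), _
    filter_upwards [hc hn, (chartImage (M.chart i) (M.overlap j i)).isOpen.mem_nhds
      (pt i (overlap_right j i) hz).2] with x hx hxo
    rw [extZ_mk _ hxo, val_res, ← extZ_mk]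
    have := hF _ ((M.chart i).map_target hxo.1) hx
    rwa [(M.chart i).right_inv hxo.1] at this
  · exact extZ_of_notMem _ hxo

variable (hK : IsClosed K) (hKi : K ⊆ (M.chart i).source)
  (hF : ∀ z ∈ (M.chart i).source, z ∉ K → extZ F (M.chart i z) = 0)

/-- A point of the chart j lies in the chart i, where smoothness is known, or else off the closed
set K, near which the extension is zero. -/
theorem contDiffOn_spreadOn (hK : IsClosed K) (hKi : K ⊆ (M.chart i).source)
    (hF : ∀ z ∈ (M.chart i).source, z ∉ K → extZ F (M.chart i z) = 0) :
    ContDiffOn ℝ ∞ (extZ (spreadOn i j F w (overlap_left j i) (overlap_right j i))) (M.dom j) := by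
  intro x hx
  refine ContDiffAt.contDiffWithinAt ?_
  by_cases hxi : (M.chart j).symm x ∈ (M.chart i).source
  · have hxo : x ∈ chartImage (M.chart j) (M.overlap j i) :=
      ⟨hx, (M.chart j).map_target hx, hxi⟩
    exact (contDiffOn_extZ _).contDiffAt
      ((chartImage (M.chart j) (M.overlap j i)).isOpen.mem_nhds hxo)
  · have hxK : (M.chart j).symm x ∉ K := fun h => hxi (hKi h)
    have he : extZ (spreadOn i j F w (overlap_left j i) (overlap_right j i)) =ᶠ[nhds x]
        fun _ => 0 := by
      filter_upwards [(M.chart j).continuousAt_symm hx (hK.isOpen_compl.mem_nhds hxK)] with y hy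
      exact extZ_spreadOn i j w hK hF hy
    exact contDiffAt_const.congr_of_eventuallyEq he

/-- The coefficient in the chart `j` of the density of weight `w` with the coefficient `F`, with
support in `K`, in the chart `i`. -/
def spread : SuperFun (Fin q) (M.dom j) :=
  ofContDiffOn (M.dom j) _ (contDiffOn_spreadOn i j w hK hKi hF)

theorem val_spread (y : M.dom j) : (spread i j w hK hKi hF).1 y =
    extZ (spreadOn i j F w (overlap_left j i) (overlap_right j i)) y := rfl

theorem spread_parity {n : ℕ} (hFn : SuperFun.HasParity F n) :
    SuperFun.HasParity (spread i j w hK hKi hF) n := by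
  ext y
  rw [val_inv, val_spread]
  change _ = (-1 : ℝ) ^ n • (spread i j w hK hKi hF).1 y
  rw [val_spread]
  by_cases hy : y.1 ∈ chartImage (M.chart j) (M.overlap j i)
  · rw [extZ_mk _ hy]
    exact (spreadOn_parity i j F w hFn _ _).val _
  · rw [extZ_of_notMem _ hy, map_zero, smul_zero]

theorem spread_self : spread i i w hK hKi hF = F := by
  ext y
  rw [val_spread, ← extZ_apply F]
  have hy : y.1 ∈ chartImage (M.chart i) (M.overlap i i) :=
    ⟨y.2, (M.chart i).map_target y.2, (M.chart i).map_target y.2⟩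
  rw [extZ_mk _ hy]
  obtain ⟨z, hz, hyz⟩ := exists_pt i (overlap_left i i) ⟨y, hy⟩
  rw [hyz, spreadOn_self]
  exact congrArg (extZ F) (congrArg Subtype.val hyz).symm

theorem spread_compatible {z : M.carrier} (hz : z ∈ M.overlap j k) :
    extZ (spread i j w hK hKi hF) (M.chart j z) =
      (M.transition j k (res (M.chartImage_le_dom k _) (spread i k w hK hKi hF))).1
        (pt j (overlap_left j k) hz) *
      Grassmann.absPow (M.jacobian j k (pt j (overlap_left j k) hz)).1 w := by
  have hjz : M.chart j z ∈ M.dom j := (M.chart j).map_source hz.1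
  rw [extZ_mk _ hjz, val_spread]
  change extZ _ (M.chart j z) = _
  -- Inside the chart i this is the cocycle law on the triple overlap; outside it z is not in K, and
  -- both sides vanish.
  by_cases hzi : z ∈ (M.chart i).source
  · let W : Opens M.carrier := ⟨M.overlap j k ∩ (M.chart i).source,
      (M.overlap j k).isOpen.inter (M.chart i).open_source⟩
    have hzW : z ∈ W := ⟨hz, hzi⟩
    have hW : W ≤ M.overlap j k := fun x hx => hx.1
    have hj : (W : Set M.carrier) ⊆ (M.chart j).source := fun x hx => hx.1.1
    have hk : (W : Set M.carrier) ⊆ (M.chart k).source := fun x hx => hx.1.2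
    have hi : (W : Set M.carrier) ⊆ (M.chart i).source := fun x hx => hx.2
    have hji : W ≤ M.overlap j i := fun x hx => ⟨hx.1.1, hx.2⟩
    have hki : W ≤ M.overlap k i := fun x hx => ⟨hx.1.2, hx.2⟩
    refine (extZ_mk _ (pt j (overlap_left j i) (hji hzW)).2).trans ?_
    refine (val_spreadOn i j F w hji hj hi hzW).symm.trans ?_
    rw [← changeAt_spreadOn i j k F w hj hk hi hzW, val_jacPow j k hj hk hW hzW]
    refine congrArg₂ _ ?_ rfl
    have e : spreadOn i k F w hk hi = res (chartImage_mono (M.chart k) hW)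
        (res (M.chartImage_le_dom k _) (spread i k w hK hKi hF)) := by
      ext y
      obtain ⟨z', hz', rfl⟩ := exists_pt k hk y
      rw [val_spreadOn i k F w hki hk hi hz', val_res, val_res, val_spread]
      exact (extZ_mk _ _).symm
    rw [e]
    change (M.change j k W hj hk _).1 _ = _
    rw [M.change_res j k (M.overlap j k) W hW (overlap_left j k) (overlap_right j k), val_res]
    rfl
  · have hzK : z ∉ K := fun h => hzi (hKi h)
    rw [extZ_spreadOn i j w hK hF (by rwa [(M.chart j).left_inv hz.1])]
    symm
    refine mul_eq_zero_of_left ?_ _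
    refine (changeAt_isCentered j k (overlap_left j k) (overlap_right j k) hz).apply_eq_zero ?_
    have hz' : M.chart k z ∈ (M.chart k).target := (M.chart k).map_source hz.2
    have hc := (M.chart k).continuousAt_symm hz'
    have hn : Kᶜ ∈ nhds ((M.chart k).symm (M.chart k z)) := by
      rw [(M.chart k).left_inv hz.2]
      exact hK.isOpen_compl.mem_nhds hzK
    change ∀ᶠ x in nhds (M.chart k z), _
    filter_upwards [hc hn, (chartImage (M.chart k) (M.overlap j k)).isOpen.mem_nhds
      (pt k (overlap_right j k) hz).2] with x hx hxo
    rw [extZ_mk _ hxo, val_res]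
    exact extZ_spreadOn i k w hK hF hx

/-- A compactly supported superfunction in a chart, extended by zero to a density. -/
def spreadDensity : M.Densities :=
  ⟨fun j => AddMonoidAlgebra.single w (spread i j w hK hKi hF), ⟨{w}, fun _ =>
    Finsupp.support_single_subset⟩, fun j k v x => by
    obtain ⟨z, hz, rfl⟩ := exists_pt j (overlap_left j k) x
    rw [AddMonoidAlgebra.coeff_single, AddMonoidAlgebra.coeff_single]
    rcases eq_or_ne v w with rfl | hv
    · rw [Finsupp.single_eq_same, Finsupp.single_eq_same]
      exact spread_compatible i j k v hK hKi hF hz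
    · rw [Finsupp.single_eq_of_ne hv, Finsupp.single_eq_of_ne hv, map_zero, map_zero,
        extZ_mk _ ((M.chart j).map_source hz.1)]
      exact (zero_mul _).symm⟩

end Glue

/-- Every superfunction in a chart agrees near a given point with a coefficient of a density. -/
theorem exists_density (i : M.Idx) (G : SuperFun (Fin q) (M.dom i)) {n : ℕ}
    (hG : SuperFun.HasParity G n) (w : ℝ) (x₀ : M.dom i) :
    ∃ (ψ : M.Densities) (F : SuperFun (Fin q) (M.dom i)), HasParity ψ n ∧
      ψ.1 i = AddMonoidAlgebra.single w F ∧ ∀ᶠ x in nhds x₀.1, extZ F x = extZ G x := by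
  obtain ⟨χ, hχ, hχc, hχs, hχ1⟩ := exists_bump ((M.dom i).isOpen.mem_nhds x₀.2)
  let F : SuperFun (Fin q) (M.dom i) := ofReal (M.dom i) χ hχ.contDiffOn * G
  have hFp : SuperFun.HasParity F n := by
    have := (ofReal_parity (κ := Fin q) (V := M.dom i) χ hχ.contDiffOn).mul hG
    rwa [zero_add] at this
  have hFv : ∀ x, x ∈ M.dom i → extZ F x = χ x • extZ G x := by
    intro x hx
    rw [extZ_mul, extZ_mk _ hx, val_ofReal, ← Algebra.smul_def]
  let K : Set M.carrier := (M.chart i).symm '' tsupport χ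
  -- The image of the compact support is compact, hence closed since the carrier is Hausdorff.
  have hK : IsClosed K :=
    (hχc.isCompact.image_of_continuousOn ((M.chart i).continuousOn_symm.mono hχs)).isClosed
  have hKi : K ⊆ (M.chart i).source := by
    rintro _ ⟨x, hx, rfl⟩
    exact (M.chart i).map_target (hχs hx)
  have hF : ∀ z ∈ (M.chart i).source, z ∉ K → extZ F (M.chart i z) = 0 := by
    intro z hz hzK
    have h0 : χ (M.chart i z) = 0 :=
      image_eq_zero_of_notMem_tsupport fun h => hzK ⟨_, h, (M.chart i).left_inv hz⟩
    rw [hFv _ ((M.chart i).map_source hz), h0, zero_smul]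
  refine ⟨spreadDensity i w hK hKi hF, F, fun j v => ?_, ?_, ?_⟩
  · change SuperFun.HasParity ((AddMonoidAlgebra.single w (spread i j w hK hKi hF)).coeff v) n
    rw [AddMonoidAlgebra.coeff_single]
    rcases eq_or_ne v w with rfl | hv
    · rw [Finsupp.single_eq_same]
      exact spread_parity i j v hK hKi hF hFp
    · rw [Finsupp.single_eq_of_ne hv]
      exact SuperFun.HasParity.zero n
  · exact congrArg (AddMonoidAlgebra.single w) (spread_self i w hK hKi hF)
  · filter_upwards [hχ1, (M.dom i).isOpen.mem_nhds x₀.2] with x hx hxi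
    rw [hFv x hxi, hx, one_smul]

/-- Every coordinate of the extended domain agrees over a neighbourhood of a given point with the
generating function of a density. -/
theorem exists_density_coord (i : M.Idx) (x₀ : M.dom i) (a : (Fin p ⊕ Unit) ⊕ Fin q) :
    ∃ ψ : M.Densities, HasParity ψ (parity a) ∧ ∀ᶠ x in nhds x₀.1, ∀ y : hat (M.dom i),
      y.1 ∘ Sum.inl = x → (generating (ψ.1 i)).1 y = (coord a : SuperFun (Fin q) _).1 y := by
  have key : ∀ (G : SuperFun (Fin q) (M.dom i)) (w : ℝ), SuperFun.HasParity G (parity a) →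
      (∀ (y : hat (M.dom i)), y.1 (.inr ()) ^ w • G.1 ⟨y.1 ∘ Sum.inl, y.2.1⟩ =
        (coord a : SuperFun (Fin q) _).1 y) →
      ∃ ψ : M.Densities, HasParity ψ (parity a) ∧ ∀ᶠ x in nhds x₀.1, ∀ y : hat (M.dom i),
        y.1 ∘ Sum.inl = x → (generating (ψ.1 i)).1 y = (coord a : SuperFun (Fin q) _).1 y := by
    intro G w hG h
    obtain ⟨ψ, F, hψ, hF, hFG⟩ := exists_density i G hG w x₀
    refine ⟨ψ, hψ, ?_⟩
    filter_upwards [hFG] with x hx y hy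
    rw [val_generating, hF, AddMonoidAlgebra.coeff_single, Finsupp.sum_single_index, ← h y]
    · subst hy
      rw [extZ_mk _ y.2.1, extZ_mk _ y.2.1] at hx
      rw [hx]
    · exact smul_zero _
  -- The coordinates x_i and ξ_j have weight 0; t is the generating function of the local density
  -- |Dx|, of weight 1 with coefficient 1.
  rcases a with (i' | ⟨⟩) | j
  · exact key (coord (.inl i')) 0 (coord_parity _) fun y => by
      rw [Real.rpow_zero, one_smul]
      rfl
  · exact key 1 1 SuperFun.HasParity.one fun y => by
      rw [Real.rpow_one]
      exact (Algebra.algebraMap_eq_smul_one _).symm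
  · exact key (coord (.inr j)) 0 (coord_parity _) fun y => by
      rw [Real.rpow_zero, one_smul]
      rfl

theorem generating_linearCombination (r s t : ℝ) (a b c : M.Densities) (i : M.Idx) :
    generating ((r • a + s • b + t • c).1 i) =
      r • generating (a.1 i) + s • generating (b.1 i) + t • generating (c.1 i) := by
  change generating (r • a.1 i + s • b.1 i + t • c.1 i) = _
  rw [generating_add, generating_add, generating_smul, generating_smul, generating_smul]

/-! ### The Jacobi identity and the equation (Ŝ, Ŝ) = 0. -/

namespace LongBracket

variable {B : M.LongBracket 1} {H : ∀ i, OddCoeffs (Fin q) (M.dom i)}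

theorem IsSpecifiedBy.jacobiator (hBH : B.IsSpecifiedBy H) {a b c : M.Densities} {k l m : ℕ}
    (ha : HasParity a k) (hb : HasParity b l) (hc : HasParity c m) (i : M.Idx) :
    toCot (generating (((-1 : ℝ) ^ (k * m) • B.toFun (B.toFun a b) c
      + (-1 : ℝ) ^ (m * l) • B.toFun (B.toFun c a) b
      + (-1 : ℝ) ^ (l * k) • B.toFun (B.toFun b c) a).1 i)) =
    ((-1 : ℝ) ^ (k * m) / 2) • poisson (poisson (poisson
      (poisson (H i).hamHat (H i).hamHat) (toCot (generating (a.1 i))))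
        (toCot (generating (b.1 i)))) (toCot (generating (c.1 i))) := by
  have hp : ∀ {a : M.Densities} {k : ℕ}, HasParity a k →
      SuperFun.HasParity (generating (a.1 i)) k := fun h => generating_parity (h i)
  refine Eq.trans ?_ (derived_jacobiator_toCot (H i).hamHat_parity (hp ha) (hp hb) (hp hc)
    (hBH a b i) (hBH c a i) (hBH b c i) (hBH a c i) (hBH _ c i) (hBH _ b i) (hBH _ a i))
  exact congrArg toCot (generating_linearCombination _ _ _ _ _ _ i)

/-- The Jacobiator is the triple bracket of (Ŝ, Ŝ), up to a non-zero factor. Testing it on densities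
that represent the coordinates of the extended domain near a base point already forces the cubic (Ŝ,
Ŝ) to vanish there; the converse holds since a density is determined by its generating functions. -/
theorem IsSpecifiedBy.jacobi_iff (hBH : B.IsSpecifiedBy H) :
    B.Jacobi ↔ ∀ i, poisson (H i).hamHat (H i).hamHat = 0 := by
  constructor
  · intro hJ i
    ext y
    let x₀ : M.dom i := ⟨fun j => y.1 (.inl (.inl j)), y.2.1⟩
    choose ψ hψ hψx using exists_density_coord i x₀
    -- There are finitely many coordinates, so one neighbourhood of the base point serves all of
    -- them.
    have hev := Filter.eventually_all.mpr hψx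
    obtain ⟨U, hU, hUo, hxU⟩ := eventually_nhds_iff.mp hev
    have hcont : Continuous fun y : Fin p ⊕ Unit → ℝ => y ∘ Sum.inl := by fun_prop
    refine (((H i).hamHat_homogeneous.poisson (H i).hamHat_homogeneous).congr
      (m := 3) (by norm_num)).val_eq_zero_of_poisson₃ (hUo.preimage hcont)
      (f := fun a => generating ((ψ a).1 i)) (fun a x hx => hU _ hx a x rfl) (fun a b c => ?_)
      y hxU
    have h := hBH.jacobiator (hψ a) (hψ b) (hψ c) i
    rw [hJ _ _ _ _ _ _ (hψ a) (hψ b) (hψ c)] at h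
    have h0 : toCot (generating ((0 : M.Densities).1 i)) = 0 :=
      (congrArg toCot (Finsupp.sum_zero_index)).trans (map_zero toCot)
    rw [h0] at h
    refine (smul_eq_zero.mp h.symm).resolve_left ?_
    exact div_ne_zero (pow_ne_zero _ (by norm_num)) two_ne_zero
  · intro hQ a b c k l m ha hb hc
    refine Subtype.ext (funext fun i => ?_)
    refine eq_zero_of_generating_eq_zero (toCot_injective ?_)
    rw [hBH.jacobiator ha hb hc i, hQ, poisson_zero_left, poisson_zero_left, poisson_zero_left,
      smul_zero, map_zero]

end LongBracket

end Supermanifold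

theorem mainTheorem4 {p q : ℕ} (M : Supermanifold p q) (B : M.LongBracket 1)
    (hB : B.OfWeight 0) (H : ∀ i, OddCoeffs (Fin q) (M.dom i)) (hBH : B.IsSpecifiedBy H) :
    B.Jacobi ↔ ∀ i : M.Idx,
      SuperFun.poisson (H i).hamS (H i).hamS = 0 ∧
      SuperFun.poisson (H i).hamS (H i).hamγ = 0 ∧
      SuperFun.poisson (H i).hamS (H i).hamθ + SuperFun.poisson (H i).hamγ (H i).hamγ = 0 ∧
      SuperFun.poisson (H i).hamγ (H i).hamθ = 0 := by
  rw [hBH.jacobi_iff]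
  exact forall_congr' fun i => (H i).poisson_hamHat_eq_zero_iff


end
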